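/- Conventions. A supermanifold $M=(|M|,\mathcal O_M)$ of dimension $n|m$ is a Hausdorff second countable topological space $|M|$ with a sheaf $\mathcal O_M$ of supercommutative $\mathbb R$-superalgebras that is locally isomorphic to $\mathbb R^{n|m}=(\mathbb R^n, C^\infty\otimes\Lambda(\xi^1,\dots,\xi^m))$. Morphisms are morphisms of superringed spaces over $\mathbb R$, i.e. a continuous map together with parity-preserving $\mathbb R$-algebra morphisms of sections compatible with restriction. A Lie supergroup is a group object in the category of supermanifolds. Write $C^\infty(M)=\mathcal O_M(|M|)$, let $\mathrm{Vect}(M)$ be the $C^\infty(M)$-module of vector fields, i.e. of global sections of the sheaf of ($\mathbb Z_2$-graded) derivations of $\mathcal O_M$, and let $\widetilde A\in\mathbb Z_2$ denote the parity of $A$. An odd connection on $M$ is a pair $(\nabla,\rho)$ consisting of an $\mathbb R$-bilinear map $\nabla:\mathrm{Vect}(M)\times\mathrm{Vect}(M)\to\mathrm{Vect}(M)$ and an odd $C^\infty(M)$-module endomorphism $\rho$ of $\mathrm{Vect}(M)$ (so $\rho$ is $\mathbb R$-linear, $\widetilde{\rho(X)}=\widetilde X+1$ and $\rho(fX)=(-1)^{\widetilde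 f}f\rho(X)$) with $\rho\circ\rho=\mathrm{id}$, such that for all homogeneous $X,Y\in\mathrm{Vect}(M)$ and $f\in C^\infty(M)$: $$\widetilde{\nabla_XY}=\widetilde X+\widetilde Y+1,\qquad \nabla_{fX}Y=(-1)^{\widetilde f}f\,\nabla_XY,\qquad \nabla_X(fY)=\rho(X)(f)\,Y+(-1)^{(\widetilde X+1)\widetilde f}f\,\nabla_XY.$$ Theorem. Let $n\ge 0$ and let $G$ be an $n|n$-dimensional Lie supergroup. Then the set of odd connections on $G$ is non-empty. -/

import Mathlib

open CategoryTheory CategoryTheory.Limits TopologicalSpace Opposite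
open scoped Manifold ContDiff TensorProduct

universe u

attribute [instance 2000] AlgCat.isRing AlgCat.isAlgebra

namespace SuperGeometry

/-- The sign `(-1)^i` of a parity `i : ℤ/2`, as a real number. -/
noncomputable def sgn (i : ZMod 2) : ℝ := if i = 0 then 1 else -1

theorem sgn_add (i j : ZMod 2) : sgn (i + j) = sgn i * sgn j := by
  have h : ∀ i j : ZMod 2, (i = 0 ∧ j = 0 ∧ i + j = 0) ∨ (i = 0 ∧ j ≠ 0 ∧ i + j ≠ 0) ∨
      (i ≠ 0 ∧ j = 0 ∧ i + j ≠ 0) ∨ (i ≠ 0 ∧ j ≠ 0 ∧ i + j = 0) := by decide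
  rcases h i j with h | h | h | h <;> simp [sgn, h]

/-! ### Superringed spaces over the reals -/

/-- A topological space with a sheaf of supercommutative associative unital `ℝ`-superalgebras. -/
structure SuperSpace where
  /-- the underlying topological space -/
  carrier : TopCat.{u}
  /-- the structure sheaf -/
  sheaf : TopCat.Sheaf (AlgCat.{u} ℝ) carrier
  /-- the even (`0`) and odd (`1`) sections over an open set -/
  parity : ∀ U : Opens carrier, ZMod 2 → Submodule ℝ (sheaf.presheaf.obj (op U))
  [graded : ∀ U : Opens carrier, GradedAlgebra (parity U)]
  res_parity : ∀ {U V : Opens carrier} (h : V ≤ U) (i : ZMod 2) (s : sheaf.presheaf.obj (op U)),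
    s ∈ parity U i → (sheaf.presheaf.map (homOfLE h).op).hom s ∈ parity V i
  supercomm : ∀ (U : Opens carrier) (i j : ZMod 2) (s t : sheaf.presheaf.obj (op U)),
    s ∈ parity U i → t ∈ parity U j → s * t = sgn (i * j) • (t * s)

namespace SuperSpace

attribute [instance] SuperSpace.graded

/-- Sections of the structure sheaf over `U`. -/
abbrev Sec (X : SuperSpace.{u}) (U : Opens X.carrier) : Type u := X.sheaf.presheaf.obj (op U)

/-- Restriction of sections. -/
def res (X : SuperSpace.{u}) {U V : Opens X.carrier} (h : V ≤ U) : X.Sec U →ₐ[ℝ] X.Sec V :=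
  (X.sheaf.presheaf.map (homOfLE h).op).hom

theorem res_self (X : SuperSpace.{u}) {U : Opens X.carrier} (h : U ≤ U) (s : X.Sec U) :
    X.res h s = s := by
  have : (homOfLE h).op = 𝟙 (op U) := rfl
  simp [res]

theorem res_res (X : SuperSpace.{u}) {U V W : Opens X.carrier} (h : V ≤ U) (k : W ≤ V)
    (s : X.Sec U) : X.res k (X.res h s) = X.res (k.trans h) s := by
  have : (homOfLE (k.trans h)).op = (homOfLE h).op ≫ (homOfLE k).op := rfl
  simp [res, this]

/-- A morphism `X ⟶ Y`: a continuous map together with parity-preserving `ℝ`-algebra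
morphisms `O_Y(V) → O_X(base⁻¹ V)` that respect the restriction maps. -/
@[ext]
structure Hom (X Y : SuperSpace.{u}) where
  base : C(X.carrier, Y.carrier)
  pullback : ∀ V : Opens Y.carrier, Y.Sec V →ₐ[ℝ] X.Sec (Opens.comap base V)
  pullback_res : ∀ {U V : Opens Y.carrier} (h : V ≤ U) (s : Y.Sec U),
    pullback V (Y.res h s) = X.res (Opens.comap_mono base h) (pullback U s)
  pullback_parity : ∀ (V : Opens Y.carrier) (i : ZMod 2) (s : Y.Sec V),
    s ∈ Y.parity V i → pullback V s ∈ X.parity (Opens.comap base V) i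

/-- The identity morphism. -/
def Hom.id (X : SuperSpace.{u}) : Hom X X where
  base := ContinuousMap.id _
  pullback V := AlgHom.id ℝ (X.Sec V)
  pullback_res _ _ := rfl
  pullback_parity _ _ _ hs := hs

/-- Composition of morphisms. -/
def Hom.comp {X Y Z : SuperSpace.{u}} (f : Hom X Y) (g : Hom Y Z) : Hom X Z where
  base := g.base.comp f.base
  pullback V := (f.pullback (Opens.comap g.base V)).comp (g.pullback V)
  pullback_res h s := by
    change f.pullback _ (g.pullback _ _) = X.res _ (f.pullback _ (g.pullback _ s))
    rw [g.pullback_res h s]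
    exact f.pullback_res _ _
  pullback_parity V i s hs := f.pullback_parity _ i _ (g.pullback_parity V i s hs)

instance : Category SuperSpace.{u} where
  Hom := Hom
  id := Hom.id
  comp := Hom.comp

end SuperSpace

/-! ### Supermanifolds -/

/-- The algebra `C^∞(W) ⊗ Λ(ξ¹, …, ξᵐ)` of functions on an open `W ⊆ ℝⁿ` of `ℝ^{n|m}`. -/
abbrev ModelSec (n m : ℕ) (W : Opens (EuclideanSpace ℝ (Fin n))) : Type :=
  C^∞⟮𝓘(ℝ, EuclideanSpace ℝ (Fin n)), W; 𝓘(ℝ, ℝ), ℝ⟯ ⊗[ℝ] ExteriorAlgebra ℝ (Fin m → ℝ)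

/-- Restriction of smooth functions to a smaller open set. -/
noncomputable def smoothRes (n : ℕ) {W W' : Opens (EuclideanSpace ℝ (Fin n))} (h : W' ≤ W) :
    C^∞⟮𝓘(ℝ, EuclideanSpace ℝ (Fin n)), W; 𝓘(ℝ, ℝ), ℝ⟯ →ₐ[ℝ]
      C^∞⟮𝓘(ℝ, EuclideanSpace ℝ (Fin n)), W'; 𝓘(ℝ, ℝ), ℝ⟯ :=
  { ContMDiffMap.restrictRingHom 𝓘(ℝ, EuclideanSpace ℝ (Fin n)) 𝓘(ℝ, ℝ) ℝ h with
    commutes' := fun _ => rfl }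

/-- Restriction maps of the structure sheaf of `ℝ^{n|m}`. -/
noncomputable def modelRes (n m : ℕ) {W W' : Opens (EuclideanSpace ℝ (Fin n))} (h : W' ≤ W) :
    ModelSec n m W →ₐ[ℝ] ModelSec n m W' :=
  Algebra.TensorProduct.map (smoothRes n h) (AlgHom.id ℝ _)

/-- Parity on `C^∞(W) ⊗ Λ`: functions are even and each generator `ξ` is odd. (The exterior
algebra is the Clifford algebra of the zero quadratic form.) -/
noncomputable def modelParity (n m : ℕ) (W : Opens (EuclideanSpace ℝ (Fin n))) (i : ZMod 2) :
    Submodule ℝ (ModelSec n m W) :=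
  LinearMap.range (LinearMap.lTensor
    C^∞⟮𝓘(ℝ, EuclideanSpace ℝ (Fin n)), W; 𝓘(ℝ, ℝ), ℝ⟯
    (CliffordAlgebra.evenOdd (0 : QuadraticForm ℝ (Fin m → ℝ)) i).subtype)

namespace SuperSpace

/-- A chart of dimension `n|m`: an isomorphism of superringed spaces between an open subspace
`coord.source` of `X` and an open subspace `coord.target` of `ℝ^{n|m}`. -/
structure Chart (X : SuperSpace.{u}) (n m : ℕ) where
  coord : OpenPartialHomeomorph X.carrier (EuclideanSpace ℝ (Fin n))
  iso : ∀ W : Opens (EuclideanSpace ℝ (Fin n)), (W : Set _) ⊆ coord.target →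
    (X.Sec ⟨coord.source ∩ coord ⁻¹' W, coord.isOpen_inter_preimage W.isOpen⟩ ≃ₐ[ℝ]
      ModelSec n m W)
  iso_res : ∀ (W W' : Opens (EuclideanSpace ℝ (Fin n))) (hW : (W : Set _) ⊆ coord.target)
    (hW' : (W' : Set _) ⊆ coord.target) (h : W' ≤ W)
    (s : X.Sec ⟨coord.source ∩ coord ⁻¹' W, coord.isOpen_inter_preimage W.isOpen⟩),
    iso W' hW' (X.res (Set.inter_subset_inter_right _ (Set.preimage_mono h)) s) = modelRes n m h (iso W hW s)
  iso_parity : ∀ (W : Opens (EuclideanSpace ℝ (Fin n))) (hW : (W : Set _) ⊆ coord.target)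
    (i : ZMod 2) (s : X.Sec ⟨coord.source ∩ coord ⁻¹' W, coord.isOpen_inter_preimage W.isOpen⟩),
    iso W hW s ∈ modelParity n m W i ↔ s ∈ X.parity _ i

/-- `X` is a supermanifold of dimension `n|m`: Hausdorff, second countable and locally isomorphic
to `ℝ^{n|m}`. -/
structure IsSupermanifold (X : SuperSpace.{u}) (n m : ℕ) : Prop where
  t2 : T2Space X.carrier
  secondCountable : SecondCountableTopology X.carrier
  exists_chart : ∀ x : X.carrier, ∃ c : X.Chart n m, x ∈ c.coord.source

end SuperSpace

/-- The category of supermanifolds (of arbitrary dimension), as a full subcategory of the category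
of superringed spaces over `ℝ`. -/
abbrev Supermanifold : Type (u + 1) :=
  ObjectProperty.FullSubcategory fun X : SuperSpace.{u} => ∃ n m : ℕ, X.IsSupermanifold n m

/-! ### Lie supergroups -/

/-- The structure of a Lie supergroup on a supermanifold `G`, i.e. of a group object in the category
of supermanifolds. The product `G × G` and the one-point supermanifold are given by their universal
properties; the group axioms are written for generalized points `S ⟶ G`. -/
structure LieSupergroup (G : Supermanifold.{u}) where
  /-- a product of `G` with itself -/
  prod : BinaryFan G G
  isLimit : IsLimit prod
  /-- a terminal supermanifold -/
  point : Supermanifold.{u}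
  isTerminal : IsTerminal point
  mul : prod.pt ⟶ G
  one : point ⟶ G
  inv : G ⟶ G
  mul_assoc : ∀ {S : Supermanifold.{u}} (a b c : S ⟶ G),
    isLimit.lift (BinaryFan.mk (isLimit.lift (BinaryFan.mk a b) ≫ mul) c) ≫ mul =
      isLimit.lift (BinaryFan.mk a (isLimit.lift (BinaryFan.mk b c) ≫ mul)) ≫ mul
  one_mul : ∀ {S : Supermanifold.{u}} (a : S ⟶ G),
    isLimit.lift (BinaryFan.mk (isTerminal.from S ≫ one) a) ≫ mul = a
  mul_one : ∀ {S : Supermanifold.{u}} (a : S ⟶ G),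
    isLimit.lift (BinaryFan.mk a (isTerminal.from S ≫ one)) ≫ mul = a
  inv_mul : ∀ {S : Supermanifold.{u}} (a : S ⟶ G),
    isLimit.lift (BinaryFan.mk (a ≫ inv) a) ≫ mul = isTerminal.from S ≫ one
  mul_inv : ∀ {S : Supermanifold.{u}} (a : S ⟶ G),
    isLimit.lift (BinaryFan.mk a (a ≫ inv)) ≫ mul = isTerminal.from S ≫ one

/-! ### Vector fields -/

namespace SuperSpace

/-- The superalgebra `C^∞(X)` of global functions. -/
abbrev Fun (X : SuperSpace.{u}) : Type u := X.Sec ⊤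

/-- Families of linear operators on the sections over all open sets. -/
abbrev Operator (X : SuperSpace.{u}) : Type u :=
  ∀ U : Opens X.carrier, X.Sec U →ₗ[ℝ] X.Sec U

/-- The homogeneous vector fields of parity `p`: the derivations of parity `p` of the
structure sheaf. -/
def homVect (X : SuperSpace.{u}) (p : ZMod 2) : Submodule ℝ X.Operator where
  carrier := {D |
    (∀ (U V : Opens X.carrier) (h : V ≤ U) (s : X.Sec U), D V (X.res h s) = X.res h (D U s)) ∧
    (∀ (U : Opens X.carrier) (i : ZMod 2) (s : X.Sec U),
      s ∈ X.parity U i → D U s ∈ X.parity U (p + i)) ∧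
    (∀ (U : Opens X.carrier) (i : ZMod 2) (s t : X.Sec U), s ∈ X.parity U i →
      D U (s * t) = D U s * t + sgn (p * i) • (s * D U t))}
  zero_mem' := by
    refine ⟨fun U V h s => by simp, fun U i s _ => by simp, fun U i s t _ => by simp⟩
  add_mem' := by
    rintro D E ⟨h1, h2, h3⟩ ⟨k1, k2, k3⟩
    refine ⟨fun U V h s => ?_, fun U i s hs => ?_, fun U i s t hs => ?_⟩
    · simp [h1 U V h, k1 U V h]
    · exact add_mem (h2 U i s hs) (k2 U i s hs)
    · simp only [Pi.add_apply, LinearMap.add_apply, h3 U i s t hs, k3 U i s t hs, add_mul,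
        mul_add, smul_add]
      abel
  smul_mem' := by
    rintro c D ⟨h1, h2, h3⟩
    refine ⟨fun U V h s => ?_, fun U i s hs => ?_, fun U i s t hs => ?_⟩
    · simp [h1 U V h]
    · exact Submodule.smul_mem _ c (h2 U i s hs)
    · simp only [Pi.smul_apply, LinearMap.smul_apply, h3 U i s t hs, smul_add,
        smul_mul_assoc, mul_smul_comm, smul_comm c]

/-- The space `Vect(X)` of vector fields: sums of an even and an odd derivation of the
structure sheaf. -/
def vect (X : SuperSpace.{u}) : Submodule ℝ X.Operator := X.homVect 0 ⊔ X.homVect 1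

/-- Left multiplication of an operator by a global function. -/
def funMul (X : SuperSpace.{u}) (f : X.Fun) (D : X.Operator) : X.Operator :=
  fun U => LinearMap.mulLeft ℝ (X.res (le_top : U ≤ ⊤) f) ∘ₗ D U

theorem funMul_apply (X : SuperSpace.{u}) (f : X.Fun) (D : X.Operator) (U : Opens X.carrier)
    (s : X.Sec U) : X.funMul f D U s = X.res (le_top : U ≤ ⊤) f * D U s := rfl

theorem funMul_add (X : SuperSpace.{u}) (f : X.Fun) (D E : X.Operator) :
    X.funMul f (D + E) = X.funMul f D + X.funMul f E := by
  funext U; ext s; simp [funMul_apply, mul_add]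

theorem add_funMul (X : SuperSpace.{u}) (f g : X.Fun) (D : X.Operator) :
    X.funMul (f + g) D = X.funMul f D + X.funMul g D := by
  funext U; ext s; simp [funMul_apply, add_mul]

theorem homVect_le_vect (X : SuperSpace.{u}) (p : ZMod 2) : X.homVect p ≤ X.vect := by
  have h : ∀ p : ZMod 2, p = 0 ∨ p = 1 := by decide
  rcases h p with rfl | rfl
  · exact le_sup_left
  · exact le_sup_right

theorem funMul_mem_homVect (X : SuperSpace.{u}) {i p : ZMod 2} {f : X.Fun} {D : X.Operator}
    (hf : f ∈ X.parity ⊤ i) (hD : D ∈ X.homVect p) : X.funMul f D ∈ X.homVect (i + p) := by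
  obtain ⟨h1, h2, h3⟩ := hD
  refine ⟨fun U V h s => ?_, fun U j s hs => ?_, fun U j s t hs => ?_⟩
  · simp only [funMul_apply, h1 U V h, map_mul, res_res]
  · rw [funMul_apply, add_assoc]
    exact SetLike.mul_mem_graded (X.res_parity _ i f hf) (h2 U j s hs)
  · have hfs := X.supercomm U i j _ s (X.res_parity (le_top : U ≤ ⊤) i f hf) hs
    change X.res _ f * s = _ • (s * X.res _ f) at hfs
    simp only [funMul_apply, h3 U j s t hs, mul_add, mul_smul_comm, ← mul_assoc, hfs, add_mul i p j,
      sgn_add, smul_mul_assoc, smul_smul]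
    rw [mul_comm (sgn (p * j))]

theorem funMul_mem_vect (X : SuperSpace.{u}) (f : X.Fun) {D : X.Operator} (hD : D ∈ X.vect) :
    X.funMul f D ∈ X.vect := by
  classical
  obtain ⟨D₀, h₀, D₁, h₁, rfl⟩ := Submodule.mem_sup.mp hD
  induction f using DirectSum.Decomposition.inductionOn (X.parity ⊤) with
  | zero =>
    convert X.vect.zero_mem
    funext U; ext s; simp [funMul_apply]
  | homogeneous f =>
    rw [funMul_add]
    exact add_mem (X.homVect_le_vect _ (X.funMul_mem_homVect f.2 h₀))
      (X.homVect_le_vect _ (X.funMul_mem_homVect f.2 h₁))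
  | add f g hf hg =>
    rw [add_funMul]
    exact add_mem hf hg

/-- `Vect(X)` is a left module over `C^∞(X)`. -/
instance vectModule (X : SuperSpace.{u}) : Module X.Fun X.vect where
  smul f D := ⟨X.funMul f D.1, X.funMul_mem_vect f D.2⟩
  one_smul D := Subtype.ext <| by
    funext U; ext s
    change X.res _ 1 * _ = _
    simp
  mul_smul f g D := Subtype.ext <| by
    funext U; ext s
    change X.res _ (f * g) * _ = X.res _ f * (X.res _ g * _)
    rw [map_mul, mul_assoc]
  smul_zero f := Subtype.ext <| by
    funext U; ext s
    change X.res _ f * 0 = 0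
    simp
  smul_add f D E := Subtype.ext (X.funMul_add f D.1 E.1)
  add_smul f g D := Subtype.ext (X.add_funMul f g D.1)
  zero_smul D := Subtype.ext <| by
    funext U; ext s
    change X.res _ 0 * _ = 0
    simp

/-- `D.HasParity p`: the vector field `D` is homogeneous of parity `p`. -/
def HasParity (X : SuperSpace.{u}) (D : X.vect) (p : ZMod 2) : Prop := D.1 ∈ X.homVect p

/-- The action `D f` of a vector field on a global function. -/
def act (X : SuperSpace.{u}) (D : X.vect) (f : X.Fun) : X.Fun := D.1 ⊤ f

/-! ### Odd connections -/

/-- An odd quasi-connection `(∇, ρ)` on `X`. -/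
structure OddQuasiConnection (X : SuperSpace.{u}) where
  nabla : X.vect →ₗ[ℝ] X.vect →ₗ[ℝ] X.vect
  rho : X.vect →ₗ[ℝ] X.vect
  rho_parity : ∀ (p : ZMod 2) (D : X.vect), X.HasParity D p → X.HasParity (rho D) (p + 1)
  rho_smul : ∀ (i : ZMod 2) (f : X.Fun) (D : X.vect), f ∈ X.parity ⊤ i →
    rho (f • D) = sgn i • (f • rho D)
  nabla_parity : ∀ (p q : ZMod 2) (D E : X.vect), X.HasParity D p → X.HasParity E q →
    X.HasParity (nabla D E) (p + q + 1)
  nabla_smul_left : ∀ (i : ZMod 2) (f : X.Fun) (D E : X.vect), f ∈ X.parity ⊤ i →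
    nabla (f • D) E = sgn i • (f • nabla D E)
  nabla_smul_right : ∀ (i p : ZMod 2) (f : X.Fun) (D E : X.vect), f ∈ X.parity ⊤ i →
    X.HasParity D p →
    nabla D (f • E) = X.act (rho D) f • E + sgn ((p + 1) * i) • (f • nabla D E)

/-- An odd connection: an odd quasi-connection `(∇, ρ)` such that `ρ` is an involution. -/
structure OddConnection (X : SuperSpace.{u}) extends OddQuasiConnection X where
  rho_rho : ∀ D : X.vect, rho (rho D) = D

end SuperSpace

end SuperGeometry

namespace SuperGeometry

/-! A Lie supergroup is parallelizable, and a frame with as many even as odd members carries an odd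
connection. Let `E a` be a homogeneous global frame with `n` even and `n` odd members, and put `ρ (∑
f a • E a) = ∑ σ (f a) • E a.swap`, with `σ` the grade involution. The swap makes `ρ` odd and uses
that both dimensions are `n`; `σ` produces the sign of `ρ (f X)`; both are involutions, so `ρ ∘ ρ =
id`. Declaring the frame parallel, `∇_X (∑ g a • E a) = ∑ ρ(X)(g a) • E a`, the Leibniz rule for `∇`
is that of the derivation `ρ(X)` (`IsFrame.oddConnection`).

The frame consists of left-invariant fields. An odd tangent vector `v` at the unit `e` gives a
morphism `τ : G × ℝ^{0|1} → G`, `f ↦ f(e) + v(f) ε`. The product `pr · τ` of generalized points is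
the identity modulo `ε`, so the coefficient of `ε` in its pullback is an odd derivation. For even
`v` the same works on `G × ℝ^{0|2}` with the even square-zero function `ε₂ ε₁`. Freezing the first
factor at `p` turns `pr · τ` into `L_p ∘ τ`, so the value of the field at `p` is `v` pushed forward
by the left translation `L_p` (`exists_odd_field`, `exists_even_field`). Translations are
invertible, hence a basis at `e` becomes a basis at every point (`exists_frame`). Only the universal
property of `G × G` is used; the test objects are `G` and its odd thickenings.

A pointwise basis is a basis of the module of vector fields. In a chart the matrix of the `E a`
applied to the coordinates is invertible at every point, hence over superfunctions, since the odd
variables are nilpotent (`isUnit_matrix_model`). Inverting it gives candidate components. They are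
correct because a derivation killing the coordinates vanishes, by Hadamard's lemma
(`sheafDerivation_eq_zero`, `exists_coef`); being unique, they glue (`exists_eq_sum`). -/

theorem zmod2_cases (i : ZMod 2) : i = 0 ∨ i = 1 := by revert i; decide

@[simp] theorem sgn_zero : sgn 0 = 1 := by simp [sgn]

@[simp] theorem sgn_one : sgn 1 = -1 := by simp [sgn]

theorem sgn_mul_self (i : ZMod 2) : sgn i * sgn i = 1 := by
  rcases zmod2_cases i with rfl | rfl <;> simp

/-! ### The grade involution -/

section Invol

variable {A : Type*} [Ring A] [Algebra ℝ A]

/-- The grade involution of a `ℤ/2`-graded algebra, `s ↦ s₀ - s₁`. -/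
noncomputable def gradeInvol (𝒜 : ZMod 2 → Submodule ℝ A) [GradedAlgebra 𝒜] : A →ₐ[ℝ] A := by
  refine AlgHom.ofLinearMap
    (GradedAlgebra.proj 𝒜 0 - GradedAlgebra.proj 𝒜 1 : A →ₗ[ℝ] A) ?_ ?_
  · have h := SetLike.one_mem_graded 𝒜
    rw [LinearMap.sub_apply, GradedAlgebra.proj_apply, GradedAlgebra.proj_apply,
      DirectSum.decompose_of_mem_same 𝒜 h,
      DirectSum.decompose_of_mem_ne 𝒜 h (show (0 : ZMod 2) ≠ 1 by decide), sub_zero]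
  · have key : ∀ (i : ZMod 2) (s : A), s ∈ 𝒜 i →
        (GradedAlgebra.proj 𝒜 0 - GradedAlgebra.proj 𝒜 1 : A →ₗ[ℝ] A) s = sgn i • s := by
      intro i s hs
      rcases zmod2_cases i with rfl | rfl
      · simp [GradedAlgebra.proj_apply, DirectSum.decompose_of_mem_same 𝒜 hs,
          DirectSum.decompose_of_mem_ne 𝒜 hs (show (0 : ZMod 2) ≠ 1 by decide)]
      · simp [GradedAlgebra.proj_apply, DirectSum.decompose_of_mem_same 𝒜 hs,
          DirectSum.decompose_of_mem_ne 𝒜 hs (show (1 : ZMod 2) ≠ 0 by decide)]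
    intro x y
    induction x using DirectSum.Decomposition.inductionOn 𝒜 with
    | zero => simp only [zero_mul, map_zero]
    | add a b ha hb => rw [add_mul, map_add, map_add, ha, hb, add_mul]
    | @homogeneous i a =>
      induction y using DirectSum.Decomposition.inductionOn 𝒜 with
      | zero => simp only [mul_zero, map_zero]
      | add c d hc hd => rw [mul_add, map_add, map_add, hc, hd, mul_add]
      | @homogeneous j c =>
        rw [key _ _ (SetLike.mul_mem_graded a.2 c.2), key _ _ a.2, key _ _ c.2, sgn_add,
          smul_mul_smul_comm]

theorem gradeInvol_of_mem (𝒜 : ZMod 2 → Submodule ℝ A) [GradedAlgebra 𝒜] {i : ZMod 2} {s : A}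
    (hs : s ∈ 𝒜 i) : gradeInvol 𝒜 s = sgn i • s := by
  change (GradedAlgebra.proj 𝒜 0 - GradedAlgebra.proj 𝒜 1 : A →ₗ[ℝ] A) s = sgn i • s
  rcases zmod2_cases i with rfl | rfl
  · simp [GradedAlgebra.proj_apply, DirectSum.decompose_of_mem_same 𝒜 hs,
      DirectSum.decompose_of_mem_ne 𝒜 hs (show (0 : ZMod 2) ≠ 1 by decide)]
  · simp [GradedAlgebra.proj_apply, DirectSum.decompose_of_mem_same 𝒜 hs,
      DirectSum.decompose_of_mem_ne 𝒜 hs (show (1 : ZMod 2) ≠ 0 by decide)]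

theorem exists_add_of_graded (𝒜 : ZMod 2 → Submodule ℝ A) [GradedAlgebra 𝒜] (s : A) :
    ∃ a ∈ 𝒜 0, ∃ b ∈ 𝒜 1, s = a + b := by
  classical
  induction s using DirectSum.Decomposition.inductionOn 𝒜 with
  | zero => exact ⟨0, zero_mem _, 0, zero_mem _, by simp⟩
  | @homogeneous i a =>
    rcases zmod2_cases i with rfl | rfl
    · exact ⟨a, a.2, 0, zero_mem _, by simp⟩
    · exact ⟨0, zero_mem _, a, a.2, by simp⟩
  | add x y hx hy =>
    obtain ⟨a, ha, b, hb, rfl⟩ := hx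
    obtain ⟨c, hc, d, hd, rfl⟩ := hy
    exact ⟨a + c, add_mem ha hc, b + d, add_mem hb hd, by abel⟩

theorem gradeInvol_gradeInvol (𝒜 : ZMod 2 → Submodule ℝ A) [GradedAlgebra 𝒜] (s : A) :
    gradeInvol 𝒜 (gradeInvol 𝒜 s) = s := by
  obtain ⟨a, ha, b, hb, rfl⟩ := exists_add_of_graded 𝒜 s
  simp [gradeInvol_of_mem 𝒜 ha, gradeInvol_of_mem 𝒜 hb]

/-- Since 2 is invertible, the component with the wrong sign must vanish. Directness of the sum is
not assumed, so that this applies to `modelParity`, for which no grading has been established. -/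
theorem mem_iff_of_eigen {𝒜 : ZMod 2 → Submodule ℝ A} {σ : A →ₐ[ℝ] A}
    (h𝒜 : ∀ s, ∃ a ∈ 𝒜 0, ∃ b ∈ 𝒜 1, s = a + b)
    (hσ : ∀ (i : ZMod 2) (s : A), s ∈ 𝒜 i → σ s = sgn i • s) {i : ZMod 2} {s : A} :
    s ∈ 𝒜 i ↔ σ s = sgn i • s := by
  refine ⟨hσ i s, fun h => ?_⟩
  obtain ⟨a, ha, b, hb, rfl⟩ := h𝒜 s
  rw [map_add, hσ _ _ ha, hσ _ _ hb] at h
  rcases zmod2_cases i with rfl | rfl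
  · have : (2 : ℝ) • b = 0 := by
      simp at h
      rw [two_smul]; nth_rewrite 1 [← h]; simp
    have hb0 : b = 0 := by simpa using this
    simpa [hb0] using ha
  · have : (2 : ℝ) • a = 0 := by
      simp at h
      rw [two_smul]; nth_rewrite 1 [h]; simp
    have ha0 : a = 0 := by simpa using this
    simpa [ha0] using hb

theorem mem_iff_gradeInvol (𝒜 : ZMod 2 → Submodule ℝ A) [GradedAlgebra 𝒜] {i : ZMod 2} {s : A} :
    s ∈ 𝒜 i ↔ gradeInvol 𝒜 s = sgn i • s :=
  mem_iff_of_eigen (exists_add_of_graded 𝒜) (fun _ _ => gradeInvol_of_mem 𝒜)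

/-- The eigenspaces of an endomorphism for the eigenvalues `sgn i`. -/
noncomputable def eigenParity (σ : A →ₐ[ℝ] A) (i : ZMod 2) : Submodule ℝ A :=
  LinearMap.eqLocus σ.toLinearMap (sgn i • LinearMap.id)

theorem mem_eigenParity {σ : A →ₐ[ℝ] A} {i : ZMod 2} {s : A} :
    s ∈ eigenParity σ i ↔ σ s = sgn i • s := by
  simp [eigenParity, LinearMap.mem_eqLocus]

/-- An involutive automorphism of an algebra is the same as a `ℤ/2`-grading. -/
@[reducible] noncomputable def eigenGradedAlgebra (σ : A →ₐ[ℝ] A) (hσ : ∀ s, σ (σ s) = s) :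
    GradedAlgebra (eigenParity σ) where
  one_mem := by simp [mem_eigenParity]
  mul_mem i j s t hs ht := by
    rw [mem_eigenParity] at *
    rw [map_mul, hs, ht, sgn_add, smul_mul_smul_comm]
  toDecomposition := DirectSum.Decomposition.ofLinearMap _
    ((DirectSum.lof ℝ (ZMod 2) (fun i => eigenParity σ i) 0).comp
        (LinearMap.codRestrict (eigenParity σ 0)
          ((2⁻¹ : ℝ) • (LinearMap.id + σ.toLinearMap)) (fun s => by
            simp [mem_eigenParity, hσ, add_comm])) +
      (DirectSum.lof ℝ (ZMod 2) (fun i => eigenParity σ i) 1).comp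
        (LinearMap.codRestrict (eigenParity σ 1)
          ((2⁻¹ : ℝ) • (LinearMap.id - σ.toLinearMap)) (fun s => by
            simp only [mem_eigenParity, sgn_one, LinearMap.smul_apply, LinearMap.sub_apply,
              LinearMap.id_apply, AlgHom.toLinearMap_apply, map_smul, map_sub, hσ]
            module)))
    (by
      ext s
      simp only [LinearMap.comp_apply, LinearMap.add_apply, map_add, LinearMap.id_apply,
        DirectSum.coeLinearMap_lof, LinearMap.codRestrict_apply, LinearMap.smul_apply,
        LinearMap.sub_apply, AlgHom.toLinearMap_apply]
      module)
    (by
      ext i s : 2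
      have hs := mem_eigenParity.mp s.2
      rcases zmod2_cases i with rfl | rfl
      · simp only [sgn_zero, one_smul] at hs
        simp only [LinearMap.comp_apply, LinearMap.add_apply, LinearMap.id_apply,
          DirectSum.coeLinearMap_lof]
        have e1 : LinearMap.codRestrict (eigenParity σ 0)
          ((2⁻¹ : ℝ) • (LinearMap.id + σ.toLinearMap)) (fun s => by
            simp [mem_eigenParity, hσ, add_comm]) (s : A) = s := by
          apply Subtype.ext
          simp only [LinearMap.codRestrict_apply, LinearMap.smul_apply,
            LinearMap.add_apply, AlgHom.toLinearMap_apply, LinearMap.id_apply, hs]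
          module
        have e2 : LinearMap.codRestrict (eigenParity σ 1)
          ((2⁻¹ : ℝ) • (LinearMap.id - σ.toLinearMap)) (fun s => by
            simp only [mem_eigenParity, sgn_one, LinearMap.smul_apply, LinearMap.sub_apply,
              LinearMap.id_apply, AlgHom.toLinearMap_apply, map_smul, map_sub, hσ]
            module) (s : A) = 0 := by
          apply Subtype.ext
          simp [LinearMap.codRestrict_apply, hs]
        rw [e1, e2, map_zero, add_zero]
      · simp only [sgn_one, neg_smul, one_smul] at hs
        simp only [LinearMap.comp_apply, LinearMap.add_apply, LinearMap.id_apply,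
          DirectSum.coeLinearMap_lof]
        have e1 : LinearMap.codRestrict (eigenParity σ 0)
          ((2⁻¹ : ℝ) • (LinearMap.id + σ.toLinearMap)) (fun s => by
            simp [mem_eigenParity, hσ, add_comm]) (s : A) = 0 := by
          apply Subtype.ext
          simp [LinearMap.codRestrict_apply, hs]
        have e2 : LinearMap.codRestrict (eigenParity σ 1)
          ((2⁻¹ : ℝ) • (LinearMap.id - σ.toLinearMap)) (fun s => by
            simp only [mem_eigenParity, sgn_one, LinearMap.smul_apply, LinearMap.sub_apply,
              LinearMap.id_apply, AlgHom.toLinearMap_apply, map_smul, map_sub, hσ]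
            module) (s : A) = s := by
          apply Subtype.ext
          simp only [LinearMap.codRestrict_apply, LinearMap.smul_apply,
            LinearMap.sub_apply, AlgHom.toLinearMap_apply, LinearMap.id_apply, hs]
          module
        rw [e1, e2, map_zero, zero_add])

end Invol

/-! ### Square-zero odd extensions -/

/-- The algebra `A[ε]` with an odd variable `ε`: pairs `(a, b)`, standing for `a + ε b`, where
`a ε = ε σ(a)` for a given endomorphism `σ`. -/
structure OddExt {A : Type*} [Ring A] [Algebra ℝ A] (σ : A →ₐ[ℝ] A) where
  fst : A
  snd : A

namespace OddExt

variable {A : Type*} [Ring A] [Algebra ℝ A] {σ : A →ₐ[ℝ] A}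

attribute [ext] OddExt

instance : Zero (OddExt σ) := ⟨⟨0, 0⟩⟩
instance : One (OddExt σ) := ⟨⟨1, 0⟩⟩
instance : Add (OddExt σ) := ⟨fun x y => ⟨x.fst + y.fst, x.snd + y.snd⟩⟩
instance : Neg (OddExt σ) := ⟨fun x => ⟨-x.fst, -x.snd⟩⟩
-- The product of `a + ε b` and `c + ε d` is forced by `a ε = ε σ(a)` and `ε² = 0`.
instance : Mul (OddExt σ) := ⟨fun x y => ⟨x.fst * y.fst, x.snd * y.fst + σ x.fst * y.snd⟩⟩
instance : SMul ℝ (OddExt σ) := ⟨fun c x => ⟨c • x.fst, c • x.snd⟩⟩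

@[simp] theorem fst_zero : (0 : OddExt σ).fst = 0 := rfl
@[simp] theorem snd_zero : (0 : OddExt σ).snd = 0 := rfl
@[simp] theorem fst_one : (1 : OddExt σ).fst = 1 := rfl
@[simp] theorem snd_one : (1 : OddExt σ).snd = 0 := rfl
@[simp] theorem fst_add (x y : OddExt σ) : (x + y).fst = x.fst + y.fst := rfl
@[simp] theorem snd_add (x y : OddExt σ) : (x + y).snd = x.snd + y.snd := rfl
@[simp] theorem fst_neg (x : OddExt σ) : (-x).fst = -x.fst := rfl
@[simp] theorem snd_neg (x : OddExt σ) : (-x).snd = -x.snd := rfl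
@[simp] theorem fst_mul (x y : OddExt σ) : (x * y).fst = x.fst * y.fst := rfl
@[simp] theorem snd_mul (x y : OddExt σ) :
    (x * y).snd = x.snd * y.fst + σ x.fst * y.snd := rfl
@[simp] theorem fst_smul (c : ℝ) (x : OddExt σ) : (c • x).fst = c • x.fst := rfl
@[simp] theorem snd_smul (c : ℝ) (x : OddExt σ) : (c • x).snd = c • x.snd := rfl

instance : AddCommGroup (OddExt σ) where
  add_assoc _ _ _ := by ext <;> simp [add_assoc]
  zero_add _ := by ext <;> simp
  add_zero _ := by ext <;> simp
  add_comm _ _ := by ext <;> simp [add_comm]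
  neg_add_cancel _ := by ext <;> simp
  nsmul := nsmulRec
  zsmul := zsmulRec

instance : Ring (OddExt σ) where
  left_distrib _ _ _ := by ext <;> simp [mul_add]; abel
  right_distrib _ _ _ := by ext <;> simp [add_mul]; abel
  zero_mul _ := by ext <;> simp
  mul_zero _ := by ext <;> simp
  mul_assoc _ _ _ := by ext <;> simp [mul_assoc, add_mul, mul_add]; abel
  one_mul _ := by ext <;> simp
  mul_one _ := by ext <;> simp
  zsmul := zsmulRec
  neg_add_cancel _ := by ext <;> simp

instance : Module ℝ (OddExt σ) where
  one_smul _ := by ext <;> simp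
  mul_smul _ _ _ := by ext <;> simp [mul_smul]
  smul_zero _ := by ext <;> simp
  smul_add _ _ _ := by ext <;> simp
  add_smul _ _ _ := by ext <;> simp [add_smul]
  zero_smul _ := by ext <;> simp

instance : Algebra ℝ (OddExt σ) := Algebra.ofModule
  (fun _ _ _ => by ext <;> simp) (fun _ _ _ => by ext <;> simp)

/-- The projection `ε ↦ 0`. -/
def fstHom (σ : A →ₐ[ℝ] A) : OddExt σ →ₐ[ℝ] A :=
  AlgHom.ofLinearMap { toFun := fst, map_add' := fst_add, map_smul' := fst_smul } rfl fst_mul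

/-- The coefficient of `ε`. -/
def sndLin (σ : A →ₐ[ℝ] A) : OddExt σ →ₗ[ℝ] A where
  toFun := snd
  map_add' := snd_add
  map_smul' := snd_smul

/-- The inclusion of the constants. -/
def inl (σ : A →ₐ[ℝ] A) : A →ₐ[ℝ] OddExt σ :=
  AlgHom.ofLinearMap
    { toFun := fun a => ⟨a, 0⟩
      map_add' := fun _ _ => by ext <;> simp
      map_smul' := fun _ _ => by ext <;> simp }
    rfl (fun _ _ => by ext <;> simp)

@[simp] theorem fst_inl (a : A) : (inl σ a).fst = a := rfl
@[simp] theorem snd_inl (a : A) : (inl σ a).snd = 0 := rfl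

variable {B : Type*} [Ring B] [Algebra ℝ B] {τ : B →ₐ[ℝ] B}

/-- Functoriality of `A[ε]`. -/
def map (φ : A →ₐ[ℝ] B) (h : ∀ a, φ (σ a) = τ (φ a)) : OddExt σ →ₐ[ℝ] OddExt τ :=
  AlgHom.ofLinearMap
    { toFun := fun x => ⟨φ x.fst, φ x.snd⟩
      map_add' := fun _ _ => by ext <;> simp
      map_smul' := fun _ _ => by ext <;> simp }
    (by ext <;> simp) (fun _ _ => by ext <;> simp [h])

@[simp] theorem fst_map (φ : A →ₐ[ℝ] B) (h : ∀ a, φ (σ a) = τ (φ a)) (x : OddExt σ) :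
    (map φ h x).fst = φ x.fst := rfl
@[simp] theorem snd_map (φ : A →ₐ[ℝ] B) (h : ∀ a, φ (σ a) = τ (φ a)) (x : OddExt σ) :
    (map φ h x).snd = φ x.snd := rfl

/-- The grade involution of `A[ε]`. -/
def invol (σ : A →ₐ[ℝ] A) : OddExt σ →ₐ[ℝ] OddExt σ :=
  AlgHom.ofLinearMap
    { toFun := fun x => ⟨σ x.fst, -σ x.snd⟩
      map_add' := fun _ _ => by ext <;> simp; abel
      map_smul' := fun _ _ => by ext <;> simp }
    (by ext <;> simp) (fun _ _ => by ext <;> simp; abel)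

@[simp] theorem fst_invol (x : OddExt σ) : (invol σ x).fst = σ x.fst := rfl
@[simp] theorem snd_invol (x : OddExt σ) : (invol σ x).snd = -σ x.snd := rfl

end OddExt

/-! ### Units modulo a square-zero ideal -/

/-- If `y` lifts the inverse of `f x`, then `x y` and `y x` are 1 plus a square-zero element, hence
units. So `x` has a right and a left inverse, and these coincide. Commutativity is not available, as
this is applied to matrices. -/
theorem isUnit_of_isUnit_map {R S : Type*} [Ring R] [Ring S] (f : R →+* S)
    (hf : Function.Surjective f) (hk : ∀ a b, f a = 0 → f b = 0 → a * b = 0) {x : R}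
    (hx : IsUnit (f x)) : IsUnit x := by
  have key : ∀ a : R, f a = 1 → IsUnit a := by
    intro a ha
    have h0 : f (a - 1) = 0 := by simp [ha]
    have : IsNilpotent (a - 1) := ⟨2, by rw [pow_two]; exact hk _ _ h0 h0⟩
    simpa using this.isUnit_one_add
  obtain ⟨v, hv⟩ := hx
  obtain ⟨y, hy⟩ := hf ↑v⁻¹
  obtain ⟨a, ha⟩ := key (x * y) (by rw [map_mul, hy, ← hv]; simp)
  obtain ⟨b, hb⟩ := key (y * x) (by rw [map_mul, hy, ← hv]; simp)
  have h1 : x * (y * ↑a⁻¹) = 1 := by rw [← mul_assoc, ← ha]; simp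
  have h2 : (↑b⁻¹ * y) * x = 1 := by rw [mul_assoc, ← hb]; simp
  exact ⟨⟨x, y * ↑a⁻¹, h1, by rw [← left_inv_eq_right_inv h2 h1, h2]⟩, rfl⟩

namespace SuperSpace

/-! ### Sections of superspaces -/

theorem eq_of_locally_eq (X : SuperSpace.{u}) {U : Opens X.carrier} (s t : X.Sec U)
    (h : ∀ x ∈ U, ∃ V : Opens X.carrier, x ∈ V ∧ ∃ hV : V ≤ U, X.res hV s = X.res hV t) :
    s = t := by
  choose V hxV hV hst using h
  refine X.sheaf.eq_of_locally_eq' (fun x : U => V x x.2) U (fun x => homOfLE (hV x x.2))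
    (fun x hx => ?_) s t (fun x => hst x x.2)
  exact Opens.mem_iSup.mpr ⟨⟨x, hx⟩, hxV x hx⟩

theorem exists_glue (X : SuperSpace.{u}) {ι : Type*} (V : Opens X.carrier)
    (U : ι → Opens X.carrier) (hU : ∀ i, U i ≤ V) (hV : ∀ x ∈ V, ∃ i, x ∈ U i)
    (sf : ∀ i, X.Sec (U i))
    (h : ∀ i j, X.res (inf_le_left : U i ⊓ U j ≤ U i) (sf i) =
      X.res (inf_le_right : U i ⊓ U j ≤ U j) (sf j)) :
    ∃ s : X.Sec V, ∀ i, X.res (hU i) s = sf i := by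
  obtain ⟨s, hs, -⟩ := X.sheaf.existsUnique_gluing' U V (fun i => homOfLE (hU i))
    (fun x hx => Opens.mem_iSup.mpr (hV x hx)) sf h
  exact ⟨s, hs⟩

/-- The sheaf condition for the empty cover. It disposes of open sets missing the image of a
constant morphism. -/
theorem subsingleton_sec (X : SuperSpace.{u}) {U : Opens X.carrier} (hU : ∀ x, x ∉ U) :
    Subsingleton (X.Sec U) :=
  ⟨fun s t => X.eq_of_locally_eq s t fun x hx => (hU x hx).elim⟩

/-- The grade involution of the structure sheaf. -/
noncomputable def invol (X : SuperSpace.{u}) (U : Opens X.carrier) : X.Sec U →ₐ[ℝ] X.Sec U :=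
  gradeInvol (X.parity U)

theorem invol_of_mem (X : SuperSpace.{u}) {U : Opens X.carrier} {i : ZMod 2} {s : X.Sec U}
    (hs : s ∈ X.parity U i) : X.invol U s = sgn i • s := gradeInvol_of_mem _ hs

theorem mem_parity_iff (X : SuperSpace.{u}) {U : Opens X.carrier} {i : ZMod 2} {s : X.Sec U} :
    s ∈ X.parity U i ↔ X.invol U s = sgn i • s := mem_iff_gradeInvol _

theorem invol_invol (X : SuperSpace.{u}) {U : Opens X.carrier} (s : X.Sec U) :
    X.invol U (X.invol U s) = s := gradeInvol_gradeInvol _ s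

theorem exists_even_odd (X : SuperSpace.{u}) {U : Opens X.carrier} (s : X.Sec U) :
    ∃ a ∈ X.parity U 0, ∃ b ∈ X.parity U 1, s = a + b := exists_add_of_graded _ s

theorem res_invol (X : SuperSpace.{u}) {U V : Opens X.carrier} (h : V ≤ U) (s : X.Sec U) :
    X.res h (X.invol U s) = X.invol V (X.res h s) := by
  obtain ⟨a, ha, b, hb, rfl⟩ := X.exists_even_odd s
  have ha' : X.res h a ∈ X.parity V 0 := X.res_parity h 0 a ha
  have hb' : X.res h b ∈ X.parity V 1 := X.res_parity h 1 b hb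
  simp only [map_add, X.invol_of_mem ha, X.invol_of_mem hb, X.invol_of_mem ha',
    X.invol_of_mem hb', map_smul]

namespace Hom

variable {X Y : SuperSpace.{u}}

theorem pullback_invol (f : Hom X Y) {V : Opens Y.carrier} (s : Y.Sec V) :
    f.pullback V (Y.invol V s) = X.invol _ (f.pullback V s) := by
  obtain ⟨a, ha, b, hb, rfl⟩ := Y.exists_even_odd s
  simp only [map_add, Y.invol_of_mem ha, Y.invol_of_mem hb,
    X.invol_of_mem (f.pullback_parity V 0 a ha), X.invol_of_mem (f.pullback_parity V 1 b hb),
    map_smul]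

/-- The two pullbacks live over preimages under `f.base` and `g.base`, which are different
expressions. Restricting to a common open set avoids transport along the equality of base maps. -/
theorem res_pullback_congr {f g : Hom X Y} (h : f = g) {V : Opens Y.carrier} {W : Opens X.carrier}
    (hf : W ≤ Opens.comap f.base V) (hg : W ≤ Opens.comap g.base V) (s : Y.Sec V) :
    X.res hf (f.pullback V s) = X.res hg (g.pullback V s) := by
  subst h; rfl

theorem ext_of_res {f g : Hom X Y} (hb : f.base = g.base)
    (h : ∀ (V : Opens Y.carrier) (s : Y.Sec V),
      X.res (le_of_eq (by rw [hb])) (f.pullback V s) = g.pullback V s) : f = g := by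
  obtain ⟨fb, fp, h1, h2⟩ := f
  obtain ⟨gb, gp, h3, h4⟩ := g
  obtain rfl : fb = gb := hb
  congr
  funext V
  ext s
  rw [← h V s, res_self]

end Hom

/-! ### Adjoining an odd variable -/

/-- The presheaf `O_X[ε]`. -/
noncomputable def thickPresheaf (X : SuperSpace.{u}) : TopCat.Presheaf (AlgCat.{u} ℝ) X.carrier where
  obj U := AlgCat.of ℝ (OddExt (X.invol U.unop))
  map f := AlgCat.ofHom (OddExt.map (X.res f.unop.le) (X.res_invol f.unop.le))
  map_id U := by
    ext s
    · exact X.res_self _ _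
    · exact X.res_self _ _
  map_comp f g := by
    ext s
    · exact (X.res_res _ _ _).symm
    · exact (X.res_res _ _ _).symm

/-- As a presheaf of sets this is two copies of `O_X`, so both coefficients are glued separately. -/
theorem thickPresheaf_isSheaf (X : SuperSpace.{u}) : X.thickPresheaf.IsSheaf := by
  rw [TopCat.Presheaf.isSheaf_iff_isSheafUniqueGluing]
  intro ι U sf hsf
  have hcov : ∀ x ∈ iSup U, ∃ i, x ∈ U i := fun x hx => Opens.mem_iSup.mp hx
  obtain ⟨a, ha⟩ := X.exists_glue (iSup U) U (le_iSup U) hcov (fun i => (sf i).fst)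
    (fun i j => congrArg OddExt.fst (hsf i j))
  obtain ⟨b, hb⟩ := X.exists_glue (iSup U) U (le_iSup U) hcov (fun i => (sf i).snd)
    (fun i j => congrArg OddExt.snd (hsf i j))
  refine ⟨(⟨a, b⟩ : OddExt _), fun i => OddExt.ext (ha i) (hb i), fun t ht => ?_⟩
  refine OddExt.ext (X.eq_of_locally_eq _ _ fun x hx => ?_) (X.eq_of_locally_eq _ _ fun x hx => ?_)
  · obtain ⟨i, hi⟩ := hcov x hx
    exact ⟨U i, hi, le_iSup U i, (congrArg OddExt.fst (ht i)).trans (ha i).symm⟩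
  · obtain ⟨i, hi⟩ := hcov x hx
    exact ⟨U i, hi, le_iSup U i, (congrArg OddExt.snd (ht i)).trans (hb i).symm⟩

theorem oddExt_invol_invol (X : SuperSpace.{u}) (U : Opens X.carrier) (s : OddExt (X.invol U)) :
    OddExt.invol _ (OddExt.invol _ s) = s := by
  ext <;> simp [X.invol_invol]

/-- The variable `ε` is odd, so its coefficient has the opposite parity. -/
theorem mem_eigenParity_oddExt (X : SuperSpace.{u}) {U : Opens X.carrier} {i : ZMod 2}
    {s : OddExt (X.invol U)} : s ∈ eigenParity (OddExt.invol (X.invol U)) i ↔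
      s.fst ∈ X.parity U i ∧ s.snd ∈ X.parity U (i + 1) := by
  rw [mem_eigenParity, OddExt.ext_iff, X.mem_parity_iff, X.mem_parity_iff, sgn_add]
  simp [neg_eq_iff_eq_neg]

/-- The superspace `X × ℝ^{0|1}`. -/
noncomputable def thick (X : SuperSpace.{u}) : SuperSpace.{u} where
  carrier := X.carrier
  sheaf := ⟨X.thickPresheaf, X.thickPresheaf_isSheaf⟩
  parity U := eigenParity (OddExt.invol (X.invol U))
  graded U := eigenGradedAlgebra _ (X.oddExt_invol_invol U)
  res_parity {U V} h i s hs := by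
    have hs' := X.mem_eigenParity_oddExt.mp hs
    exact X.mem_eigenParity_oddExt.mpr ⟨X.res_parity h _ _ hs'.1, X.res_parity h _ _ hs'.2⟩
  supercomm U i j s t hs ht := by
    obtain ⟨hs1, hs2⟩ := X.mem_eigenParity_oddExt.mp hs
    obtain ⟨ht1, ht2⟩ := X.mem_eigenParity_oddExt.mp ht
    refine OddExt.ext (X.supercomm U i j _ _ hs1 ht1) ?_
    change s.snd * t.fst + X.invol U s.fst * t.snd =
      sgn (i * j) • (t.snd * s.fst + X.invol U t.fst * s.snd)
    -- The sign `sgn j` in `sgn ((i + 1) * j)` matches the one from `σ t.fst`; the sign `sgn i` from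
    -- `σ s.fst` cancels the extra one in `sgn (i * (j + 1))`.
    rw [X.invol_of_mem hs1, X.invol_of_mem ht1, X.supercomm U (i + 1) j _ _ hs2 ht1,
      smul_mul_assoc, X.supercomm U i (j + 1) _ _ hs1 ht2, add_mul, mul_add, sgn_add, sgn_add,
      smul_add, smul_mul_assoc, smul_smul, smul_smul, one_mul, mul_one, add_comm,
      mul_left_comm, sgn_mul_self, mul_one]

/-- Needed to iterate the thickening: the second odd variable is twisted by the grade involution of
the first extension. -/
theorem thick_invol (X : SuperSpace.{u}) (U : Opens X.carrier) (s : OddExt (X.invol U)) :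
    X.thick.invol U s = OddExt.invol (X.invol U) s := by
  obtain ⟨a, ha, b, hb, rfl⟩ := X.thick.exists_even_odd (U := U) s
  rw [map_add, X.thick.invol_of_mem ha, X.thick.invol_of_mem hb]
  exact (((OddExt.invol (X.invol U)).map_add a b).trans
    (congrArg₂ (· + ·) (mem_eigenParity.mp ha) (mem_eigenParity.mp hb))).symm

/-- The pair of coefficients as a section of `O_X[ε]`. -/
abbrev thickMk (X : SuperSpace.{u}) {U : Opens X.carrier} (a b : X.Sec U) : X.thick.Sec U :=
  (⟨a, b⟩ : OddExt (X.invol U))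

/-- The projection `X × ℝ^{0|1} → X`. -/
noncomputable def thickProj (X : SuperSpace.{u}) : Hom X.thick X where
  base := ContinuousMap.id _
  pullback V := OddExt.inl (X.invol V)
  pullback_res h _ := OddExt.ext rfl (map_zero (X.res h)).symm
  pullback_parity _ _ _ hs := X.mem_eigenParity_oddExt.mpr ⟨hs, zero_mem _⟩

/-- The inclusion `X → X × ℝ^{0|1}`. -/
noncomputable def thickIncl (X : SuperSpace.{u}) : Hom X X.thick where
  base := ContinuousMap.id _
  pullback V := OddExt.fstHom (X.invol V)
  pullback_res _ _ := rfl
  pullback_parity _ _ _ hs := (X.mem_eigenParity_oddExt.mp hs).1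

/-- Functoriality of `X × ℝ^{0|1}`. -/
noncomputable def Hom.thick {X Y : SuperSpace.{u}} (f : Hom X Y) : Hom X.thick Y.thick where
  base := f.base
  pullback V := OddExt.map (f.pullback V) (fun s => f.pullback_invol s)
  pullback_res h s := OddExt.ext (f.pullback_res h _) (f.pullback_res h _)
  pullback_parity V i s hs := by
    have hs' := Y.mem_eigenParity_oddExt.mp hs
    exact X.mem_eigenParity_oddExt.mpr
      ⟨f.pullback_parity _ _ _ hs'.1, f.pullback_parity _ _ _ hs'.2⟩

end SuperSpace

/-! ### The model algebras -/

section Model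

variable (n m : ℕ) (W : Opens (EuclideanSpace ℝ (Fin n)))

/-- The grade involution of `C^∞(W) ⊗ Λ`. -/
noncomputable def modelInvol : ModelSec n m W →ₐ[ℝ] ModelSec n m W :=
  Algebra.TensorProduct.map (AlgHom.id ℝ _) CliffordAlgebra.involute

variable {n m W}

@[simp] theorem modelInvol_tmul (f : C^∞⟮𝓘(ℝ, EuclideanSpace ℝ (Fin n)), W; 𝓘(ℝ, ℝ), ℝ⟯)
    (η : ExteriorAlgebra ℝ (Fin m → ℝ)) :
    modelInvol n m W (f ⊗ₜ η) = f ⊗ₜ CliffordAlgebra.involute η := rfl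

theorem exterior_involute_ι {k : ℕ} (v : Fin k → ℝ) :
    CliffordAlgebra.involute (ExteriorAlgebra.ι ℝ v) = - ExteriorAlgebra.ι ℝ v :=
  CliffordAlgebra.involute_ι v

theorem exists_add_of_modelParity (s : ModelSec n m W) :
    ∃ a ∈ modelParity n m W 0, ∃ b ∈ modelParity n m W 1, s = a + b := by
  induction s using TensorProduct.induction_on with
  | zero => exact ⟨0, zero_mem _, 0, zero_mem _, by simp⟩
  | add x y hx hy =>
    obtain ⟨a, ha, b, hb, rfl⟩ := hx
    obtain ⟨c, hc, d, hd, rfl⟩ := hy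
    exact ⟨a + c, add_mem ha hc, b + d, add_mem hb hd, by abel⟩
  | tmul f η =>
    obtain ⟨a, ha, b, hb, rfl⟩ := exists_add_of_graded
      (CliffordAlgebra.evenOdd (0 : QuadraticForm ℝ (Fin m → ℝ))) η
    exact ⟨f ⊗ₜ a, ⟨f ⊗ₜ ⟨a, ha⟩, rfl⟩, f ⊗ₜ b, ⟨f ⊗ₜ ⟨b, hb⟩, rfl⟩, TensorProduct.tmul_add _ _ _⟩

theorem mem_modelParity_iff {i : ZMod 2} {s : ModelSec n m W} :
    s ∈ modelParity n m W i ↔ modelInvol n m W s = sgn i • s := by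
  refine mem_iff_of_eigen exists_add_of_modelParity (fun i s hs => ?_)
  · obtain ⟨t, rfl⟩ := hs
    induction t using TensorProduct.induction_on with
    | zero => simp
    | add x y hx hy => rw [map_add, map_add, hx, hy, smul_add]
    | tmul f η =>
      have h : CliffordAlgebra.involute (η : CliffordAlgebra (0 : QuadraticForm ℝ (Fin m → ℝ)))
          = sgn i • (η : CliffordAlgebra (0 : QuadraticForm ℝ (Fin m → ℝ))) := by
        rcases zmod2_cases i with rfl | rfl
        · rw [CliffordAlgebra.involute_eq_of_mem_even η.2, sgn_zero, one_smul]
        · rw [CliffordAlgebra.involute_eq_of_mem_odd η.2, sgn_one, neg_one_smul]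
      simp only [modelInvol, LinearMap.lTensor_tmul, Submodule.subtype_apply,
        Algebra.TensorProduct.map_tmul, AlgHom.id_apply]
      rw [h, TensorProduct.tmul_smul]

/-- The inclusion of odd coordinates `(ξ¹, …, ξᵐ) ↦ (ξ², …, ξᵐ⁺¹)`. -/
def consZero (m : ℕ) : (Fin m → ℝ) →ₗ[ℝ] (Fin (m + 1) → ℝ) where
  toFun v := Fin.cons 0 v
  map_add' v w := by ext i; refine Fin.cases ?_ (fun i => ?_) i <;> simp
  map_smul' c v := by ext i; refine Fin.cases ?_ (fun i => ?_) i <;> simp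

theorem consZero_apply (m : ℕ) (v : Fin m → ℝ) : consZero m v = Fin.cons 0 v := rfl

variable (n m W)

/-- `C^∞(W) ⊗ Λ(ξ², …, ξᵐ⁺¹)` inside `C^∞(W) ⊗ Λ(ξ¹, …, ξᵐ⁺¹)`. -/
noncomputable def modelIncl : ModelSec n m W →ₐ[ℝ] ModelSec n (m + 1) W :=
  Algebra.TensorProduct.map (AlgHom.id ℝ _) (ExteriorAlgebra.map (consZero m))

/-- The generator `ξ¹`. -/
noncomputable def modelXi : ModelSec n (m + 1) W :=
  1 ⊗ₜ ExteriorAlgebra.ι ℝ (Pi.single 0 1)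

variable {n m W}

theorem tmul_one_mul_comm (f : C^∞⟮𝓘(ℝ, EuclideanSpace ℝ (Fin n)), W; 𝓘(ℝ, ℝ), ℝ⟯)
    (s : ModelSec n m W) : (f ⊗ₜ 1) * s = s * (f ⊗ₜ 1 : ModelSec n m W) := by
  induction s using TensorProduct.induction_on with
  | zero => simp
  | add x y hx hy => rw [mul_add, add_mul, hx, hy]
  | tmul g η => simp [mul_comm f g]

/-- Generators anticommute, and the rule is multiplicative in `η`. -/
theorem ι_mul_eq_involute_mul (v : Fin m → ℝ) (η : ExteriorAlgebra ℝ (Fin m → ℝ)) :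
    η * ExteriorAlgebra.ι ℝ v = ExteriorAlgebra.ι ℝ v * CliffordAlgebra.involute η := by
  induction η using ExteriorAlgebra.induction with
  | algebraMap r => rw [AlgHom.commutes, Algebra.commutes]
  | ι w =>
    have h : ExteriorAlgebra.ι ℝ w * ExteriorAlgebra.ι ℝ v
        + ExteriorAlgebra.ι ℝ v * ExteriorAlgebra.ι ℝ w = 0 :=
      ExteriorAlgebra.ι_add_mul_swap w v
    rw [exterior_involute_ι, mul_neg]
    exact eq_neg_of_add_eq_zero_left h
  | mul a b ha hb => rw [mul_assoc, hb, ← mul_assoc, ha, map_mul, mul_assoc]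
  | add a b ha hb => rw [add_mul, ha, hb, map_add, mul_add]

theorem modelXi_mul_self : modelXi n m W * modelXi n m W = 0 := by
  simp [modelXi]

/-- This is the relation `a ε = ε σ(a)` with `ξ¹` in the role of `ε`; it makes `a + ε b ↦ a + ξ¹ b`
multiplicative. -/
theorem modelIncl_mul_modelXi (s : ModelSec n m W) :
    modelIncl n m W s * modelXi n m W = modelXi n m W * modelIncl n m W (modelInvol n m W s) := by
  induction s using TensorProduct.induction_on with
  | zero => simp
  | add x y hx hy => simp only [map_add, add_mul, mul_add, hx, hy]
  | tmul f η =>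
    simp only [modelIncl, modelXi, modelInvol, Algebra.TensorProduct.map_tmul, AlgHom.id_apply,
      Algebra.TensorProduct.tmul_mul_tmul, one_mul, mul_one]
    rw [ι_mul_eq_involute_mul]
    congr 2
    have : (CliffordAlgebra.involute (Q := (0 : QuadraticForm ℝ (Fin (m + 1) → ℝ)))).comp
          (ExteriorAlgebra.map (consZero m)) =
        (ExteriorAlgebra.map (consZero m)).comp
          (CliffordAlgebra.involute (Q := (0 : QuadraticForm ℝ (Fin m → ℝ)))) := by
      refine ExteriorAlgebra.hom_ext (LinearMap.ext fun v => ?_)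
      simp only [LinearMap.comp_apply, AlgHom.toLinearMap_apply, AlgHom.comp_apply,
        ExteriorAlgebra.map_apply_ι]
      rw [exterior_involute_ι, exterior_involute_ι, map_neg, ExteriorAlgebra.map_apply_ι]
    exact DFunLike.congr_fun this η

variable (n m W)

/-- `a + ε b ↦ a + ξ¹ b`. -/
noncomputable def ofOddExt : OddExt (modelInvol n m W) →ₐ[ℝ] ModelSec n (m + 1) W :=
  AlgHom.ofLinearMap
    { toFun := fun x => modelIncl n m W x.fst + modelXi n m W * modelIncl n m W x.snd
      map_add' := fun x y => by simp only [OddExt.fst_add, OddExt.snd_add, map_add, mul_add]; abel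
      map_smul' := fun c x => by
        simp only [OddExt.fst_smul, OddExt.snd_smul, map_smul, mul_smul_comm, smul_add,
          RingHom.id_apply] }
    (by simp)
    (fun x y => by
      change modelIncl n m W (x * y).fst + modelXi n m W * modelIncl n m W (x * y).snd =
        (modelIncl n m W x.fst + modelXi n m W * modelIncl n m W x.snd) *
        (modelIncl n m W y.fst + modelXi n m W * modelIncl n m W y.snd)
      have h1 : modelXi n m W * modelIncl n m W x.snd *
          (modelXi n m W * modelIncl n m W y.snd) = 0 := by
        rw [← mul_assoc, mul_assoc (modelXi n m W) _ (modelXi n m W), modelIncl_mul_modelXi,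
          ← mul_assoc, modelXi_mul_self, zero_mul, zero_mul]
      have h2 : modelIncl n m W x.fst * (modelXi n m W * modelIncl n m W y.snd) =
          modelXi n m W * modelIncl n m W (modelInvol n m W x.fst) * modelIncl n m W y.snd := by
        rw [← mul_assoc, modelIncl_mul_modelXi]
      rw [mul_add, add_mul, add_mul, h1, h2]
      simp only [OddExt.fst_mul, OddExt.snd_mul, map_add, map_mul, mul_add, mul_assoc]
      abel)

theorem ofOddExt_apply (x : OddExt (modelInvol n m W)) :
    ofOddExt n m W x = modelIncl n m W x.fst + modelXi n m W * modelIncl n m W x.snd := rfl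

/-- The forgetful map `(v₁, …, vₘ₊₁) ↦ (v₂, …, vₘ₊₁)`. -/
def tailLin (m : ℕ) : (Fin (m + 1) → ℝ) →ₗ[ℝ] (Fin m → ℝ) where
  toFun v := Fin.tail v
  map_add' _ _ := rfl
  map_smul' _ _ := rfl

/-- The linear map `ξ¹ ↦ ε`, `ξʲ⁺¹ ↦ ξʲ`. -/
noncomputable def toOddExtAux : (Fin (m + 1) → ℝ) →ₗ[ℝ] OddExt (modelInvol n m W) where
  toFun v := ⟨1 ⊗ₜ ExteriorAlgebra.ι ℝ (tailLin m v), v 0 • 1⟩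
  map_add' v w := by
    ext
    · simp [TensorProduct.tmul_add]
    · simp [add_smul]
  map_smul' c v := by
    ext
    · simp
    · simp [mul_smul]

@[simp] theorem fst_toOddExtAux (v : Fin (m + 1) → ℝ) :
    (toOddExtAux n m W v).fst = 1 ⊗ₜ ExteriorAlgebra.ι ℝ (Fin.tail v) := rfl

@[simp] theorem snd_toOddExtAux (v : Fin (m + 1) → ℝ) :
    (toOddExtAux n m W v).snd = v 0 • 1 := rfl

theorem toOddExtAux_mul_self (v : Fin (m + 1) → ℝ) :
    toOddExtAux n m W v * toOddExtAux n m W v = 0 := by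
  ext
  · simp
  · simp only [OddExt.snd_mul, fst_toOddExtAux, snd_toOddExtAux, modelInvol_tmul,
      exterior_involute_ι, OddExt.snd_zero, smul_mul_assoc, one_mul, mul_smul_comm, mul_one]
    rw [TensorProduct.tmul_neg, smul_neg, add_neg_cancel]

/-- The inverse of `ofOddExt`. -/
noncomputable def toOddExt : ModelSec n (m + 1) W →ₐ[ℝ] OddExt (modelInvol n m W) :=
  Algebra.TensorProduct.lift
    ((OddExt.inl (modelInvol n m W)).comp Algebra.TensorProduct.includeLeft)
    (ExteriorAlgebra.lift ℝ ⟨toOddExtAux n m W, toOddExtAux_mul_self n m W⟩)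
    (fun f η => by
      change _ * _ = _ * _
      ext
      · exact tmul_one_mul_comm _ _
      · have : modelInvol n m W (f ⊗ₜ 1) = f ⊗ₜ 1 := by simp [modelInvol]
        simp [this, tmul_one_mul_comm])

theorem toOddExt_modelIncl (s : ModelSec n m W) :
    toOddExt n m W (modelIncl n m W s) = OddExt.inl _ s := by
  have : (toOddExt n m W).comp (modelIncl n m W) = OddExt.inl _ := by
    refine Algebra.TensorProduct.ext ?_ (ExteriorAlgebra.hom_ext (LinearMap.ext fun v => ?_))
    · ext f <;> simp [toOddExt, modelIncl]
    · ext
      · simp [toOddExt, modelIncl, consZero_apply]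
      · simp [toOddExt, modelIncl, consZero_apply]
  exact DFunLike.congr_fun this s

theorem toOddExt_modelXi : toOddExt n m W (modelXi n m W) = ⟨0, 1⟩ := by
  have h : Fin.tail (Pi.single 0 1 : Fin (m + 1) → ℝ) = 0 := by ext i; simp [Fin.tail_def]
  ext
  · simp [toOddExt, modelXi, h]
  · simp [toOddExt, modelXi, ← Algebra.TensorProduct.one_def]

theorem toOddExt_ofOddExt (x : OddExt (modelInvol n m W)) :
    toOddExt n m W (ofOddExt n m W x) = x := by
  rw [ofOddExt_apply, map_add, map_mul, toOddExt_modelIncl, toOddExt_modelIncl, toOddExt_modelXi]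
  ext <;> simp

theorem ofOddExt_toOddExt (s : ModelSec n (m + 1) W) :
    ofOddExt n m W (toOddExt n m W s) = s := by
  have : (ofOddExt n m W).comp (toOddExt n m W) = AlgHom.id ℝ _ := by
    refine Algebra.TensorProduct.ext ?_ (ExteriorAlgebra.hom_ext (LinearMap.ext fun v => ?_))
    · ext f
      simp [toOddExt, modelIncl, ofOddExt_apply]
    · have hv : consZero m (Fin.tail v) + v 0 • Pi.single 0 1 = v := by
        ext i
        refine Fin.cases ?_ (fun i => ?_) i <;> simp [consZero_apply, Fin.tail_def]
      simp [toOddExt, ofOddExt_apply, ← Algebra.TensorProduct.one_def]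
      nth_rewrite 3 [← hv]
      simp [modelIncl, modelXi, TensorProduct.tmul_add]
  exact DFunLike.congr_fun this s

/-- `C^∞(W) ⊗ Λ(ξ¹, …, ξᵐ⁺¹) = (C^∞(W) ⊗ Λ(ξ¹, …, ξᵐ))[ε]`. -/
noncomputable def modelEquiv : OddExt (modelInvol n m W) ≃ₐ[ℝ] ModelSec n (m + 1) W :=
  AlgEquiv.ofAlgHom (ofOddExt n m W) (toOddExt n m W)
    (AlgHom.ext (ofOddExt_toOddExt n m W)) (AlgHom.ext (toOddExt_ofOddExt n m W))

variable {n m W}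

theorem toOddExt_modelInvol (s : ModelSec n (m + 1) W) :
    toOddExt n m W (modelInvol n (m + 1) W s) = OddExt.invol _ (toOddExt n m W s) := by
  have : (toOddExt n m W).comp (modelInvol n (m + 1) W) =
      (OddExt.invol _).comp (toOddExt n m W) := by
    refine Algebra.TensorProduct.ext ?_ (ExteriorAlgebra.hom_ext (LinearMap.ext fun v => ?_))
    · ext f <;> simp [toOddExt]
    · ext
      · simp [toOddExt, exterior_involute_ι, TensorProduct.tmul_neg, -CliffordAlgebra.involute_ι,
          ← Algebra.TensorProduct.one_def]
      · simp [toOddExt, TensorProduct.tmul_neg, ← Algebra.TensorProduct.one_def]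
  exact DFunLike.congr_fun this s

theorem modelRes_modelInvol {W' : Opens (EuclideanSpace ℝ (Fin n))} (h : W' ≤ W)
    (s : ModelSec n m W) :
    modelRes n m h (modelInvol n m W s) = modelInvol n m W' (modelRes n m h s) := by
  induction s using TensorProduct.induction_on with
  | zero => simp
  | add x y hx hy => simp only [map_add, hx, hy]
  | tmul f η => simp [modelRes, modelInvol]

theorem modelRes_ofOddExt {W' : Opens (EuclideanSpace ℝ (Fin n))} (h : W' ≤ W)
    (x : OddExt (modelInvol n m W)) :
    modelRes n (m + 1) h (ofOddExt n m W x) =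
      ofOddExt n m W' (OddExt.map (modelRes n m h) (modelRes_modelInvol h) x) := by
  have h1 : ∀ s : ModelSec n m W, modelRes n (m + 1) h (modelIncl n m W s) =
      modelIncl n m W' (modelRes n m h s) := by
    intro s
    induction s using TensorProduct.induction_on with
    | zero => simp
    | add x y hx hy => simp only [map_add, hx, hy]
    | tmul f η => simp [modelRes, modelIncl]
  have h2 : modelRes n (m + 1) h (modelXi n m W) = modelXi n m W' := by
    simp [modelRes, modelXi]
  simp [ofOddExt_apply, h1, h2]

end Model

/-- Functoriality of `A[ε]` for isomorphisms. -/
def OddExt.mapEquiv {A B : Type*} [Ring A] [Algebra ℝ A] [Ring B] [Algebra ℝ B]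
    {σ : A →ₐ[ℝ] A} {τ : B →ₐ[ℝ] B} (φ : A ≃ₐ[ℝ] B) (h : ∀ a, φ (σ a) = τ (φ a)) :
    OddExt σ ≃ₐ[ℝ] OddExt τ :=
  AlgEquiv.ofAlgHom (OddExt.map φ.toAlgHom h)
    (OddExt.map φ.symm.toAlgHom (fun b => by
      change φ.symm (τ b) = σ (φ.symm b)
      rw [AlgEquiv.symm_apply_eq, h, AlgEquiv.apply_symm_apply]))
    (AlgHom.ext fun x => OddExt.ext (φ.apply_symm_apply _) (φ.apply_symm_apply _))
    (AlgHom.ext fun x => OddExt.ext (φ.symm_apply_apply _) (φ.symm_apply_apply _))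

theorem modelInvol_ofOddExt {n m : ℕ} {W : Opens (EuclideanSpace ℝ (Fin n))}
    (x : OddExt (modelInvol n m W)) :
    modelInvol n (m + 1) W (ofOddExt n m W x) = ofOddExt n m W (OddExt.invol _ x) := by
  rw [← ofOddExt_toOddExt n m W (modelInvol _ _ _ _), toOddExt_modelInvol, toOddExt_ofOddExt]

theorem eigen_iff_of_equiv {A B : Type*} [Ring A] [Algebra ℝ A] [Ring B] [Algebra ℝ B]
    {σ : A →ₐ[ℝ] A} {τ : B →ₐ[ℝ] B} (φ : A ≃ₐ[ℝ] B) {a : A} (h : τ (φ a) = φ (σ a))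
    {i : ZMod 2} : τ (φ a) = sgn i • φ a ↔ σ a = sgn i • a := by
  rw [h, ← map_smul, φ.injective.eq_iff]

namespace SuperSpace

variable {X : SuperSpace.{u}} {n m : ℕ}

/-- The domain of a chart over an open subset of the model space. -/
abbrev Chart.piece (c : X.Chart n m) (W : Opens (EuclideanSpace ℝ (Fin n))) : Opens X.carrier :=
  ⟨c.coord.source ∩ c.coord ⁻¹' W, c.coord.isOpen_inter_preimage W.isOpen⟩

theorem Chart.iso_invol (c : X.Chart n m) (W : Opens (EuclideanSpace ℝ (Fin n)))
    (hW : (W : Set _) ⊆ c.coord.target) (s : X.Sec (c.piece W)) :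
    c.iso W hW (X.invol _ s) = modelInvol n m W (c.iso W hW s) := by
  obtain ⟨a, ha, b, hb, rfl⟩ := X.exists_even_odd s
  rw [map_add, map_add, map_add, map_add, X.invol_of_mem ha, X.invol_of_mem hb,
    mem_modelParity_iff.mp ((c.iso_parity W hW 0 a).mpr ha),
    mem_modelParity_iff.mp ((c.iso_parity W hW 1 b).mpr hb), map_smul, map_smul]

/-- The chart of `X × ℝ^{0|1}` induced by a chart of `X`. -/
noncomputable def Chart.thick (c : X.Chart n m) : X.thick.Chart n (m + 1) where
  coord := c.coord
  iso W hW := (OddExt.mapEquiv (c.iso W hW) (c.iso_invol W hW)).trans (modelEquiv n m W)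
  iso_res W W' hW hW' h s := by
    refine Eq.trans ?_ (modelRes_ofOddExt h (OddExt.mapEquiv (c.iso W hW) (c.iso_invol W hW) s)).symm
    exact congrArg (ofOddExt n m W')
      (OddExt.ext (c.iso_res W W' hW hW' h s.fst) (c.iso_res W W' hW hW' h s.snd))
  iso_parity W hW i s := by
    have key : modelInvol n (m + 1) W (((OddExt.mapEquiv (c.iso W hW) (c.iso_invol W hW)).trans
          (modelEquiv n m W)) s) = ((OddExt.mapEquiv (c.iso W hW) (c.iso_invol W hW)).trans
          (modelEquiv n m W)) (OddExt.invol (X.invol _) s) := by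
      refine (modelInvol_ofOddExt _).trans (congrArg (ofOddExt n m W) (OddExt.ext ?_ ?_))
      · exact (c.iso_invol W hW s.fst).symm
      · exact (congrArg Neg.neg (c.iso_invol W hW s.snd).symm).trans (map_neg (c.iso W hW) _).symm
    exact mem_modelParity_iff.trans ((eigen_iff_of_equiv _ key).trans mem_eigenParity.symm)

/-- The group axioms quantify over supermanifolds only, so the thickenings have to be supermanifolds
before they can serve as test objects. -/
theorem IsSupermanifold.thick (h : X.IsSupermanifold n m) : X.thick.IsSupermanifold n (m + 1) where
  t2 := h.t2
  secondCountable := h.secondCountable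
  exists_chart x := by
    obtain ⟨c, hc⟩ := h.exists_chart x
    exact ⟨c.thick, hc⟩

end SuperSpace

/-! ### Hadamard's lemma -/

section Hadamard

/-- The integral is the value at `0` of the convolution of the indicator of `(0, 1]` with `s ↦ χ(s)
G(-s, x)`. The cutoff `χ` gives this family compact support in `s`, uniformly in `x`, so that
smoothness of convolutions with parameters applies. -/
theorem contDiff_integral_param {E : Type*} [NormedAddCommGroup E] [NormedSpace ℝ E]
    {G : ℝ × E → ℝ} (hG : ContDiff ℝ ∞ G) :
    ContDiff ℝ ∞ (fun x => ∫ t in (0 : ℝ)..1, G (t, x)) := by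
  -- Inner radius 1, so that `χ (-t) = 1` for every `t` in the interval of integration.
  let χ : ContDiffBump (0 : ℝ) := ⟨1, 2, one_pos, one_lt_two⟩
  let g : E → ℝ → ℝ := fun x s => χ s * G (-s, x)
  let f : ℝ → ℝ := Set.indicator (Set.Ioc 0 1) 1
  have hf : MeasureTheory.LocallyIntegrable f MeasureTheory.volume :=
    (MeasureTheory.locallyIntegrable_const (1 : ℝ)).indicator measurableSet_Ioc
  have hg : ContDiffOn ℝ ((⊤ : ℕ∞) : WithTop ℕ∞) (↿g) (Set.univ ×ˢ Set.univ) := by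
    apply ContDiff.contDiffOn
    have h1 : ContDiff ℝ ∞ (fun q : E × ℝ => χ q.2) := χ.contDiff.comp contDiff_snd
    have h2 : ContDiff ℝ ∞ (fun q : E × ℝ => G (-q.2, q.1)) :=
      hG.comp (contDiff_snd.neg.prodMk contDiff_fst)
    exact h1.mul h2
  have key := MeasureTheory.contDiffOn_convolution_right_with_param (μ := MeasureTheory.volume)
    (ContinuousLinearMap.mul ℝ ℝ) isOpen_univ (isCompact_closedBall (0 : ℝ) 2)
    (fun (x : E) s _ hs => by
      have : χ s = 0 := by
        apply χ.zero_of_le_dist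
        rw [Metric.mem_closedBall, not_le] at hs
        exact hs.le
      simp [g, this]) hf hg
  have key2 : ContDiff ℝ ∞ (fun x : E =>
      MeasureTheory.convolution f (g x) (ContinuousLinearMap.mul ℝ ℝ) MeasureTheory.volume 0) := by
    rw [← contDiffOn_univ]
    exact key.comp (contDiff_id.prodMk contDiff_const).contDiffOn (fun x _ => by simp)
  convert key2 using 2 with x
  rw [MeasureTheory.convolution, intervalIntegral.integral_of_le zero_le_one,
    ← MeasureTheory.integral_indicator measurableSet_Ioc]
  congr 1
  funext t
  by_cases ht : t ∈ Set.Ioc (0 : ℝ) 1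
  · have : χ (-t) = 1 := χ.one_of_mem_closedBall (by
      simp only [Metric.mem_closedBall, dist_zero_right, norm_neg, Real.norm_eq_abs]
      rw [abs_of_pos ht.1]; exact ht.2)
    simp [f, g, ht, this]
  · simp [f, ht]

variable {n : ℕ}

/-- The fundamental theorem of calculus along the segment from `p` to `x`; `g i x` is the mean of
the `i`-th partial derivative over that segment. -/
theorem exists_hadamard_global {F : EuclideanSpace ℝ (Fin n) → ℝ} (hF : ContDiff ℝ ∞ F)
    (p : EuclideanSpace ℝ (Fin n)) :
    ∃ g : Fin n → EuclideanSpace ℝ (Fin n) → ℝ, (∀ i, ContDiff ℝ ∞ (g i)) ∧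
      ∀ x, F x = F p + ∑ i, (x i - p i) * g i x := by
  have hDF : ContDiff ℝ ∞ (fderiv ℝ F) := hF.fderiv_right (by simp)
  have hG : ∀ v : EuclideanSpace ℝ (Fin n), ContDiff ℝ ∞
      (fun q : ℝ × EuclideanSpace ℝ (Fin n) => fderiv ℝ F (p + q.1 • (q.2 - p)) v) := by
    intro v
    refine ContDiff.clm_apply (hDF.comp ?_) contDiff_const
    exact contDiff_const.add (contDiff_fst.smul (contDiff_snd.sub contDiff_const))
  refine ⟨fun i x => ∫ t in (0 : ℝ)..1,
    fderiv ℝ F (p + t • (x - p)) (EuclideanSpace.single i 1),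
    fun i => contDiff_integral_param (hG _), fun x => ?_⟩
  have hint : ∀ v, IntervalIntegrable (fun t : ℝ => fderiv ℝ F (p + t • (x - p)) v)
      MeasureTheory.volume 0 1 := fun v =>
    (((hG v).comp (contDiff_id.prodMk contDiff_const)).continuous).intervalIntegrable _ _
  have hderiv : ∀ t : ℝ, HasDerivAt (fun t : ℝ => F (p + t • (x - p)))
      (fderiv ℝ F (p + t • (x - p)) (x - p)) t := by
    intro t
    have h1 := (hF.differentiable (by simp) (p + t • (x - p))).hasFDerivAt
    have h2 : HasDerivAt (fun t : ℝ => p + t • (x - p)) (x - p) t := by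
      simpa using ((hasDerivAt_id t).smul_const (x - p)).const_add p
    exact h1.comp_hasDerivAt t h2
  have h := intervalIntegral.integral_eq_sub_of_hasDerivAt (fun t _ => hderiv t) (hint (x - p))
  have hsum : x - p = ∑ i, (x i - p i) • EuclideanSpace.single i (1 : ℝ) := by
    ext j
    simp [Pi.single_apply]
  have h3 : ∀ t : ℝ, fderiv ℝ F (p + t • (x - p)) (x - p) =
      ∑ i, (x i - p i) * fderiv ℝ F (p + t • (x - p)) (EuclideanSpace.single i 1) := by
    intro t
    have := congrArg (fderiv ℝ F (p + t • (x - p))) hsum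
    rw [map_sum] at this
    simpa using this
  simp only [h3, one_smul, zero_smul, add_zero, add_sub_cancel] at h
  rw [intervalIntegral.integral_finsetSum (fun i _ => (hint _).const_mul _)] at h
  simp only [intervalIntegral.integral_const_mul] at h
  rw [h]; ring

/-- The restriction of a smooth function on `ℝⁿ` to an open subset. -/
noncomputable def smoothOf (W : Opens (EuclideanSpace ℝ (Fin n))) (F : EuclideanSpace ℝ (Fin n) → ℝ)
    (hF : ContDiff ℝ ∞ F) : C^∞⟮𝓘(ℝ, EuclideanSpace ℝ (Fin n)), W; 𝓘(ℝ, ℝ), ℝ⟯ :=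
  ⟨fun x => F x, hF.contMDiff.comp contMDiff_subtype_val⟩

@[simp] theorem smoothOf_apply (W : Opens (EuclideanSpace ℝ (Fin n)))
    (F : EuclideanSpace ℝ (Fin n) → ℝ) (hF : ContDiff ℝ ∞ F) (x : W) :
    smoothOf W F hF x = F x := rfl

@[simp] theorem smoothRes_apply {W W' : Opens (EuclideanSpace ℝ (Fin n))} (h : W' ≤ W)
    (f : C^∞⟮𝓘(ℝ, EuclideanSpace ℝ (Fin n)), W; 𝓘(ℝ, ℝ), ℝ⟯) (x : W') :
    smoothRes n h f x = f ⟨x, h x.2⟩ := rfl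

/-- Evaluation of smooth functions at a point. -/
noncomputable def smoothEval (W : Opens (EuclideanSpace ℝ (Fin n))) (x : W) :
    C^∞⟮𝓘(ℝ, EuclideanSpace ℝ (Fin n)), W; 𝓘(ℝ, ℝ), ℝ⟯ →ₐ[ℝ] ℝ :=
  { (ContMDiffMap.evalRingHom x :
      C^∞⟮𝓘(ℝ, EuclideanSpace ℝ (Fin n)), W; 𝓘(ℝ, ℝ), ℝ⟯ →+* ℝ) with
    commutes' := fun _ => rfl }

@[simp] theorem smoothEval_apply (W : Opens (EuclideanSpace ℝ (Fin n))) (x : W)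
    (f : C^∞⟮𝓘(ℝ, EuclideanSpace ℝ (Fin n)), W; 𝓘(ℝ, ℝ), ℝ⟯) : smoothEval W x f = f x := rfl

/-- Extension by zero. -/
noncomputable def zeroExt {W : Opens (EuclideanSpace ℝ (Fin n))}
    (f : C^∞⟮𝓘(ℝ, EuclideanSpace ℝ (Fin n)), W; 𝓘(ℝ, ℝ), ℝ⟯)
    (x : EuclideanSpace ℝ (Fin n)) : ℝ := by
  classical exact if h : x ∈ W then f ⟨x, h⟩ else 0

theorem zeroExt_of_mem {W : Opens (EuclideanSpace ℝ (Fin n))}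
    (f : C^∞⟮𝓘(ℝ, EuclideanSpace ℝ (Fin n)), W; 𝓘(ℝ, ℝ), ℝ⟯)
    {x : EuclideanSpace ℝ (Fin n)} (h : x ∈ W) : zeroExt f x = f ⟨x, h⟩ := dif_pos h

theorem contDiffAt_zeroExt {W : Opens (EuclideanSpace ℝ (Fin n))}
    (f : C^∞⟮𝓘(ℝ, EuclideanSpace ℝ (Fin n)), W; 𝓘(ℝ, ℝ), ℝ⟯)
    {x : EuclideanSpace ℝ (Fin n)} (h : x ∈ W) : ContDiffAt ℝ ∞ (zeroExt f) x := by
  rw [← contMDiffAt_iff_contDiffAt]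
  refine (contMDiffAt_subtype_iff (U := W) (x := ⟨x, h⟩)).mp ?_
  have : (fun y : W => zeroExt f y) = f := funext fun y => zeroExt_of_mem f y.2
  rw [this]
  exact f.contMDiff _

/-- Smooth functions extend to `ℝⁿ` after shrinking the domain. -/
theorem exists_extension {W : Opens (EuclideanSpace ℝ (Fin n))}
    (f : C^∞⟮𝓘(ℝ, EuclideanSpace ℝ (Fin n)), W; 𝓘(ℝ, ℝ), ℝ⟯)
    {p : EuclideanSpace ℝ (Fin n)} (hp : p ∈ W) :
    ∃ (W' : Opens (EuclideanSpace ℝ (Fin n))) (h : W' ≤ W) (_ : p ∈ W')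
      (F : EuclideanSpace ℝ (Fin n) → ℝ) (hF : ContDiff ℝ ∞ F),
      smoothRes n h f = smoothOf W' F hF := by
  obtain ⟨r, hr, hball⟩ := Metric.isOpen_iff.mp W.isOpen p hp
  -- The function is unchanged on the ball of radius `r / 4`, which becomes `W'`; the support, of
  -- radius `r / 2`, stays inside `W`.
  let χ : ContDiffBump p := ⟨r / 4, r / 2, by linarith, by linarith⟩
  have hF : ContDiff ℝ ∞ (fun x => χ x * zeroExt f x) := by
    rw [contDiff_iff_contDiffAt]
    intro x
    by_cases hx : x ∈ W
    · exact χ.contDiff.contDiffAt.mul (contDiffAt_zeroExt f hx)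
    · have hx' : x ∉ tsupport χ := by
        rw [χ.tsupport_eq]
        intro h
        refine hx (hball ?_)
        have h2 : dist x p ≤ r / 2 := h
        exact Metric.mem_ball.mpr (by linarith)
      have : (fun x => χ x * zeroExt f x) =ᶠ[nhds x] fun _ => 0 := by
        filter_upwards [notMem_tsupport_iff_eventuallyEq.mp hx'] with y hy
        rw [hy]; simp
      exact contDiffAt_const.congr_of_eventuallyEq this
  refine ⟨⟨Metric.ball p (r / 4), Metric.isOpen_ball⟩,
    fun x hx => hball (Metric.ball_subset_ball (by linarith) hx),
    Metric.mem_ball_self (by linarith), _, hF, ?_⟩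
  ext x
  have hx : χ x = 1 := χ.one_of_mem_closedBall (Metric.ball_subset_closedBall x.2)
  simp only [smoothRes_apply, smoothOf_apply, hx, one_mul]
  rw [zeroExt_of_mem]

/-- The coordinate functions. -/
noncomputable def coordFun (W : Opens (EuclideanSpace ℝ (Fin n))) (i : Fin n) :
    C^∞⟮𝓘(ℝ, EuclideanSpace ℝ (Fin n)), W; 𝓘(ℝ, ℝ), ℝ⟯ :=
  smoothOf W (fun x => x i) (contDiff_piLp_apply (p := 2))

/-- Shrinking around `p` replaces `f` by a function on all of `ℝⁿ`, where segments to `p` never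
leave the domain. -/
theorem exists_hadamard {W : Opens (EuclideanSpace ℝ (Fin n))}
    (f : C^∞⟮𝓘(ℝ, EuclideanSpace ℝ (Fin n)), W; 𝓘(ℝ, ℝ), ℝ⟯)
    {p : EuclideanSpace ℝ (Fin n)} (hp : p ∈ W) :
    ∃ (W' : Opens (EuclideanSpace ℝ (Fin n))) (h : W' ≤ W) (_ : p ∈ W')
      (g : Fin n → C^∞⟮𝓘(ℝ, EuclideanSpace ℝ (Fin n)), W'; 𝓘(ℝ, ℝ), ℝ⟯),
      smoothRes n h f = algebraMap ℝ _ (f ⟨p, hp⟩) +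
        ∑ i, (coordFun W' i - algebraMap ℝ _ (p i)) * g i := by
  obtain ⟨W', h, hpW, F, hF, hfF⟩ := exists_extension f hp
  obtain ⟨g, hg, hgF⟩ := exists_hadamard_global hF p
  refine ⟨W', h, hpW, fun i => smoothOf W' (g i) (hg i), ?_⟩
  have hfp : F p = f ⟨p, hp⟩ := (DFunLike.congr_fun hfF ⟨p, hpW⟩).symm
  rw [hfF]
  ext x
  rw [← smoothEval_apply, ← smoothEval_apply, map_add, map_sum]
  simp only [map_mul, map_sub, AlgHom.commutes, smoothEval_apply, coordFun, smoothOf_apply]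
  rw [hgF, hfp]
  rfl

end Hadamard

/-! ### Evaluation, units and derivations of the model algebras -/

section ModelDerivations

variable {n m : ℕ} {W : Opens (EuclideanSpace ℝ (Fin n))}

variable (n m W) in
/-- The reduction `C^∞(W) ⊗ Λ → C^∞(W)`. -/
noncomputable def modelBody :
    ModelSec n m W →ₐ[ℝ] C^∞⟮𝓘(ℝ, EuclideanSpace ℝ (Fin n)), W; 𝓘(ℝ, ℝ), ℝ⟯ :=
  Algebra.TensorProduct.lift (AlgHom.id ℝ _)
    ((Algebra.ofId ℝ _).comp ExteriorAlgebra.algebraMapInv) (fun _ _ => Commute.all _ _)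

@[simp] theorem modelBody_tmul (f : C^∞⟮𝓘(ℝ, EuclideanSpace ℝ (Fin n)), W; 𝓘(ℝ, ℝ), ℝ⟯)
    (η : ExteriorAlgebra ℝ (Fin m → ℝ)) :
    modelBody n m W (f ⊗ₜ η) = f * algebraMap ℝ _ (ExteriorAlgebra.algebraMapInv η) := rfl

variable (n m) in
/-- The value of a superfunction at a point. -/
noncomputable def modelEval (x : W) : ModelSec n m W →ₐ[ℝ] ℝ :=
  (smoothEval W x).comp (modelBody n m W)

@[simp] theorem modelEval_tmul (x : W) (f : C^∞⟮𝓘(ℝ, EuclideanSpace ℝ (Fin n)), W; 𝓘(ℝ, ℝ), ℝ⟯)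
    (η : ExteriorAlgebra ℝ (Fin m → ℝ)) :
    modelEval n m x (f ⊗ₜ η) = f x * ExteriorAlgebra.algebraMapInv η := rfl

theorem modelEval_modelRes {W' : Opens (EuclideanSpace ℝ (Fin n))} (h : W' ≤ W) (x : W')
    (s : ModelSec n m W) :
    modelEval n m x (modelRes n m h s) = modelEval n m ⟨x, h x.2⟩ s := by
  induction s using TensorProduct.induction_on with
  | zero => simp
  | add a b ha hb => rw [map_add, map_add, map_add, ha, hb]
  | tmul f η => simp [modelRes]

theorem algebraMapInv_ι {k : ℕ} (v : Fin k → ℝ) :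
    ExteriorAlgebra.algebraMapInv (ExteriorAlgebra.ι ℝ v) = 0 := by
  simp [ExteriorAlgebra.algebraMapInv]

theorem algebraMapInv_involute {k : ℕ} (η : ExteriorAlgebra ℝ (Fin k → ℝ)) :
    ExteriorAlgebra.algebraMapInv (CliffordAlgebra.involute η) =
      ExteriorAlgebra.algebraMapInv η := by
  have : (ExteriorAlgebra.algebraMapInv (R := ℝ) (M := Fin k → ℝ)).comp CliffordAlgebra.involute =
      ExteriorAlgebra.algebraMapInv := by
    refine ExteriorAlgebra.hom_ext (LinearMap.ext fun v => ?_)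
    simp only [LinearMap.comp_apply, AlgHom.toLinearMap_apply, AlgHom.comp_apply]
    rw [exterior_involute_ι, map_neg, algebraMapInv_ι, neg_zero]
  exact DFunLike.congr_fun this η

theorem algebraMapInv_map_consZero {k : ℕ} (η : ExteriorAlgebra ℝ (Fin k → ℝ)) :
    ExteriorAlgebra.algebraMapInv (ExteriorAlgebra.map (consZero k) η) =
      ExteriorAlgebra.algebraMapInv η := by
  have : (ExteriorAlgebra.algebraMapInv (R := ℝ)).comp (ExteriorAlgebra.map (consZero k)) =
      ExteriorAlgebra.algebraMapInv := by
    refine ExteriorAlgebra.hom_ext (LinearMap.ext fun v => ?_)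
    simp only [LinearMap.comp_apply, AlgHom.toLinearMap_apply, AlgHom.comp_apply,
      ExteriorAlgebra.map_apply_ι, algebraMapInv_ι]
  exact DFunLike.congr_fun this η

theorem modelBody_ofOddExt (x : OddExt (modelInvol n m W)) :
    modelBody n (m + 1) W (ofOddExt n m W x) = modelBody n m W x.fst := by
  have h1 : modelBody n (m + 1) W (modelXi n m W) = 0 := by simp [modelXi, algebraMapInv_ι]
  have h2 : ∀ s, modelBody n (m + 1) W (modelIncl n m W s) = modelBody n m W s := by
    intro s
    induction s using TensorProduct.induction_on with
    | zero => simp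
    | add a b ha hb => rw [map_add, map_add, map_add, ha, hb]
    | tmul f η => simp [modelIncl, algebraMapInv_map_consZero]
  rw [ofOddExt_apply, map_add, map_mul, h1, zero_mul, add_zero, h2]

theorem exterior_fin_zero (η : ExteriorAlgebra ℝ (Fin 0 → ℝ)) :
    η = algebraMap ℝ _ (ExteriorAlgebra.algebraMapInv η) := by
  induction η using ExteriorAlgebra.induction with
  | algebraMap r => rw [AlgHom.commutes]; rfl
  | ι v => rw [algebraMapInv_ι, map_zero, Subsingleton.elim v 0, map_zero]
  | mul a b ha hb => rw [map_mul, map_mul, ← ha, ← hb]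
  | add a b ha hb => rw [map_add, map_add, ← ha, ← hb]

theorem modelBody_zero_injective : Function.Injective (modelBody n 0 W) := by
  have : ∀ s : ModelSec n 0 W, modelBody n 0 W s ⊗ₜ 1 = s := by
    intro s
    induction s using TensorProduct.induction_on with
    | zero => simp
    | add a b ha hb => rw [map_add, TensorProduct.add_tmul, ha, hb]
    | tmul f η =>
      rw [modelBody_tmul]
      conv_rhs => rw [exterior_fin_zero η, Algebra.algebraMap_eq_smul_one,
        TensorProduct.tmul_smul, TensorProduct.smul_tmul']
      rw [Algebra.algebraMap_eq_smul_one, mul_smul_comm, mul_one]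
  intro s t hst
  rw [← this s, ← this t, hst]

theorem modelBody_surjective : Function.Surjective (modelBody n m W) := fun f =>
  ⟨f ⊗ₜ 1, by simp⟩

/-- Induction on the number of odd variables. Setting `ε = 0` in `A[ε]` has a kernel in which all
products vanish, and the same holds for matrices, so invertibility lifts one variable at a time.
Without odd variables the body map is injective. -/
theorem isUnit_matrix_of_body {ι : Type*} [Fintype ι] [DecidableEq ι]
    (A : Matrix ι ι (ModelSec n m W))
    (hA : IsUnit ((modelBody n m W).toRingHom.mapMatrix A)) : IsUnit A := by
  induction m with
  | zero =>
    refine isUnit_of_isUnit_map _ (fun B => ?_) (fun B C hB _ => ?_) hA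
    · choose b hb using fun i j => modelBody_surjective (m := 0) (B i j)
      exact ⟨Matrix.of b, by ext1 i j; exact hb i j⟩
    · have : B = 0 := by
        ext1 i j
        refine modelBody_zero_injective ?_
        rw [Matrix.zero_apply, map_zero]
        exact congrFun (congrFun hB i) j
      rw [this, zero_mul]
  | succ m ih =>
    let τ := (modelEquiv n m W).symm.toRingEquiv
    have h1 : IsUnit ((OddExt.fstHom (modelInvol n m W)).toRingHom.mapMatrix
        (τ.toRingHom.mapMatrix A)) := by
      apply ih
      convert hA using 1
      ext1 i j
      change modelBody n m W (toOddExt n m W (A i j)).fst = modelBody n (m + 1) W (A i j)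
      rw [← modelBody_ofOddExt, ofOddExt_toOddExt]
    have h2 : IsUnit (τ.toRingHom.mapMatrix A) := by
      refine isUnit_of_isUnit_map _ (fun B => ?_) (fun B C hB hC => ?_) h1
      · exact ⟨Matrix.of fun i j => OddExt.inl _ (B i j), by ext1 i j; rfl⟩
      · ext1 i j
        rw [Matrix.mul_apply, Matrix.zero_apply]
        refine Finset.sum_eq_zero fun k _ => ?_
        have e1 : (B i k).fst = 0 := congrFun (congrFun hB i) k
        have e2 : (C k j).fst = 0 := congrFun (congrFun hC k) j
        ext <;> simp [e1, e2]
    exact (MulEquiv.isUnit_map (τ.mapMatrix : Matrix ι ι _ ≃+* Matrix ι ι _)).mp h2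

theorem isUnit_smooth (f : C^∞⟮𝓘(ℝ, EuclideanSpace ℝ (Fin n)), W; 𝓘(ℝ, ℝ), ℝ⟯)
    (hf : ∀ x, f x ≠ 0) : IsUnit f := by
  have hg : ContMDiff 𝓘(ℝ, EuclideanSpace ℝ (Fin n)) 𝓘(ℝ, ℝ) ∞ (fun x => (f x)⁻¹) := by
    intro x
    exact (contDiffAt_inv ℝ (hf x)).contMDiffAt.comp x (f.contMDiff x)
  refine IsUnit.of_mul_eq_one ⟨_, hg⟩ ?_
  ext x
  exact mul_inv_cancel₀ (hf x)

/-- The body matrix has entries in the commutative ring of smooth functions. Its determinant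
vanishes nowhere, hence has a smooth reciprocal. -/
theorem isUnit_matrix_model {ι : Type*} [Fintype ι] [DecidableEq ι]
    (A : Matrix ι ι (ModelSec n m W))
    (hA : ∀ x, IsUnit ((modelEval n m x).toRingHom.mapMatrix A)) : IsUnit A := by
  apply isUnit_matrix_of_body
  rw [Matrix.isUnit_iff_isUnit_det]
  refine isUnit_smooth _ fun x => ?_
  have h := (Matrix.isUnit_iff_isUnit_det _).mp (hA x)
  have e : (smoothEval W x) ((modelBody n m W).toRingHom.mapMatrix A).det =
      ((modelEval n m x).toRingHom.mapMatrix A).det := by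
    rw [AlgHom.map_det]; rfl
  rw [smoothEval_apply] at e
  rw [e]
  exact h.ne_zero

variable (m W) in
/-- The coordinates `x¹, …, xⁿ, ξ¹, …, ξᵐ`. -/
noncomputable def modelCoord (a : Fin n ⊕ Fin m) : ModelSec n m W :=
  Sum.elim (fun i => coordFun W i ⊗ₜ 1)
    (fun j => 1 ⊗ₜ ExteriorAlgebra.ι ℝ (Pi.single j 1)) a

/-- The parity of a coordinate. -/
def idxParity {α β : Type*} (a : α ⊕ β) : ZMod 2 := Sum.elim (fun _ => 0) (fun _ => 1) a

theorem modelRes_modelCoord {W' : Opens (EuclideanSpace ℝ (Fin n))} (h : W' ≤ W)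
    (a : Fin n ⊕ Fin m) : modelRes n m h (modelCoord m W a) = modelCoord m W' a := by
  rcases a with i | j
  · rfl
  · simp [modelCoord, modelRes]

theorem modelCoord_mem (a : Fin n ⊕ Fin m) :
    modelCoord m W a ∈ modelParity n m W (idxParity a) := by
  rw [mem_modelParity_iff]
  rcases a with i | j
  · simp [modelCoord, idxParity]
  · simp [modelCoord, idxParity, exterior_involute_ι, -CliffordAlgebra.involute_ι,
      TensorProduct.tmul_neg]
    exact (neg_one_smul ℝ _).symm

theorem modelEval_modelInvol (x : W) (s : ModelSec n m W) :
    modelEval n m x (modelInvol n m W s) = modelEval n m x s := by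
  induction s using TensorProduct.induction_on with
  | zero => simp
  | add a b ha hb => rw [map_add, map_add, map_add, ha, hb]
  | tmul f η => simp [algebraMapInv_involute]

/-! #### Derivations which kill the coordinates -/

theorem linearMap_tmul_eq_zero {M : Type*} [AddCommGroup M] [Module ℝ M]
    (T : ModelSec n m W →ₗ[ℝ] M) (h1 : T 1 = 0)
    (hmul : ∀ s t, T s = 0 → T t = 0 → T (s * t) = 0)
    (hcoord : ∀ j, T (modelCoord m W (Sum.inr j)) = 0) (η : ExteriorAlgebra ℝ (Fin m → ℝ)) :
    T (1 ⊗ₜ η) = 0 := by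
  induction η using ExteriorAlgebra.induction with
  | algebraMap r =>
    rw [Algebra.algebraMap_eq_smul_one, TensorProduct.tmul_smul, map_smul,
      ← Algebra.TensorProduct.one_def, h1, smul_zero]
  | ι v =>
    have hv : v = ∑ j, v j • Pi.single j (1 : ℝ) := by
      ext k; simp [Pi.single_apply]
    rw [hv, map_sum, TensorProduct.tmul_sum, map_sum]
    refine Finset.sum_eq_zero fun j _ => ?_
    rw [map_smul, TensorProduct.tmul_smul, map_smul]
    exact (congrArg _ (hcoord j)).trans (smul_zero _)
  | mul a b ha hb =>
    have : (1 ⊗ₜ (a * b) : ModelSec n m W) = (1 ⊗ₜ a) * (1 ⊗ₜ b) := by simp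
    rw [this]
    exact hmul _ _ ha hb
  | add a b ha hb => rw [TensorProduct.tmul_add, map_add, ha, hb, add_zero]

/-- Only closure of the kernel under products is required instead of a Leibniz rule, so that point
derivations and signed derivations are covered alike. -/
theorem linearMap_eq_zero {M : Type*} [AddCommGroup M] [Module ℝ M]
    (T : ModelSec n m W →ₗ[ℝ] M) (h1 : T 1 = 0)
    (hmul : ∀ s t, T s = 0 → T t = 0 → T (s * t) = 0)
    (hcoord : ∀ j, T (modelCoord m W (Sum.inr j)) = 0)
    (hsmooth : ∀ f, T (f ⊗ₜ 1) = 0) (s : ModelSec n m W) : T s = 0 := by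
  induction s using TensorProduct.induction_on with
  | zero => simp
  | add a b ha hb => rw [map_add, ha, hb, add_zero]
  | tmul f η =>
    have : (f ⊗ₜ η : ModelSec n m W) = (f ⊗ₜ 1) * (1 ⊗ₜ η) := by simp
    rw [this]
    exact hmul _ _ (hsmooth f) (linearMap_tmul_eq_zero T h1 hmul hcoord η)

theorem exists_hadamard_model (f : C^∞⟮𝓘(ℝ, EuclideanSpace ℝ (Fin n)), W; 𝓘(ℝ, ℝ), ℝ⟯)
    {p : EuclideanSpace ℝ (Fin n)} (hp : p ∈ W) :
    ∃ (W' : Opens (EuclideanSpace ℝ (Fin n))) (h : W' ≤ W) (_ : p ∈ W')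
      (g : Fin n → ModelSec n m W'),
      modelRes n m h (f ⊗ₜ 1) = algebraMap ℝ _ (f ⟨p, hp⟩) +
        ∑ i, (modelCoord m W' (Sum.inl i) - algebraMap ℝ _ (p i)) * g i := by
  obtain ⟨W', h, hpW, g, hg⟩ := exists_hadamard f hp
  refine ⟨W', h, hpW, fun i => g i ⊗ₜ 1, ?_⟩
  let φ : C^∞⟮𝓘(ℝ, EuclideanSpace ℝ (Fin n)), W'; 𝓘(ℝ, ℝ), ℝ⟯ →ₐ[ℝ] ModelSec n m W' :=
    Algebra.TensorProduct.includeLeft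
  have := congrArg φ hg
  simp only [map_add, map_sum, map_mul, map_sub, AlgHom.commutes] at this
  exact this

/-- A compatible family of point derivations at `p` which kills the coordinates vanishes. -/
theorem pointDerivation_eq_zero {p : EuclideanSpace ℝ (Fin n)}
    (v : ∀ W' : Opens (EuclideanSpace ℝ (Fin n)), W' ≤ W → p ∈ W' → ModelSec n m W' →ₗ[ℝ] ℝ)
    (hres : ∀ (W' W'' : Opens (EuclideanSpace ℝ (Fin n))) (hW' : W' ≤ W) (h : W'' ≤ W')
      (hp' : p ∈ W') (hp : p ∈ W'') (s : ModelSec n m W'),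
      v W'' (h.trans hW') hp (modelRes n m h s) = v W' hW' hp' s)
    (hmul : ∀ (W' : Opens (EuclideanSpace ℝ (Fin n))) (hW' : W' ≤ W) (hp : p ∈ W')
      (s t : ModelSec n m W'), v W' hW' hp (s * t) =
        v W' hW' hp s * modelEval n m ⟨p, hp⟩ t + modelEval n m ⟨p, hp⟩ s * v W' hW' hp t)
    (hcoord : ∀ (W' : Opens (EuclideanSpace ℝ (Fin n))) (hW' : W' ≤ W) (hp : p ∈ W') a,
      v W' hW' hp (modelCoord m W' a) = 0)
    (W' : Opens (EuclideanSpace ℝ (Fin n))) (hW' : W' ≤ W) (hp : p ∈ W') (s : ModelSec n m W') :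
    v W' hW' hp s = 0 := by
  have h1 : ∀ W' hW' hp, v W' hW' hp 1 = 0 := fun W' hW' hp => by
    have := hmul W' hW' hp 1 1
    simpa using this
  refine linearMap_eq_zero (v W' hW' hp) (h1 _ _ _)
    (fun s t hs ht => by rw [hmul, hs, ht]; simp) (fun j => hcoord _ _ _ _) (fun f => ?_) s
  -- In `f = f(p) + ∑ (xⁱ - pⁱ) gᵢ` each factor `xⁱ - pⁱ` vanishes at `p` and is killed by `v`, so
  -- both Leibniz terms are zero.
  obtain ⟨W'', h, hpW, g, hg⟩ := exists_hadamard_model (m := m) f hp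
  rw [← hres W' W'' hW' h hp hpW, hg, map_add, map_sum, Algebra.algebraMap_eq_smul_one, map_smul,
    h1, smul_zero, zero_add]
  refine Finset.sum_eq_zero fun i _ => ?_
  rw [hmul, map_sub, hcoord, Algebra.algebraMap_eq_smul_one, map_smul, h1, map_sub, map_smul,
    map_one]
  simp [modelCoord, coordFun]

/-- The coefficient functions of a superfunction with respect to a linear form on `Λ`. -/
noncomputable def modelCoef (l : ExteriorAlgebra ℝ (Fin m → ℝ) →ₗ[ℝ] ℝ) :
    ModelSec n m W →ₗ[ℝ] C^∞⟮𝓘(ℝ, EuclideanSpace ℝ (Fin n)), W; 𝓘(ℝ, ℝ), ℝ⟯ :=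
  (TensorProduct.rid ℝ _).toLinearMap ∘ₗ LinearMap.lTensor _ l

@[simp] theorem modelCoef_tmul (l : ExteriorAlgebra ℝ (Fin m → ℝ) →ₗ[ℝ] ℝ)
    (f : C^∞⟮𝓘(ℝ, EuclideanSpace ℝ (Fin n)), W; 𝓘(ℝ, ℝ), ℝ⟯)
    (η : ExteriorAlgebra ℝ (Fin m → ℝ)) : modelCoef l (f ⊗ₜ η : ModelSec n m W) = l η • f := by
  simp [modelCoef]

/-- `Λ` is free over `ℝ`, so the coordinate forms of a basis detect zero. Vanishing of a
superfunction thereby becomes a pointwise question about smooth functions. -/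
theorem eq_zero_of_modelCoef (s : ModelSec n m W) (hs : ∀ l, modelCoef l s = 0) : s = 0 := by
  let B := Module.Free.chooseBasis ℝ (ExteriorAlgebra ℝ (Fin m → ℝ))
  apply (TensorProduct.equivFinsuppOfBasisRight (M :=
    C^∞⟮𝓘(ℝ, EuclideanSpace ℝ (Fin n)), W; 𝓘(ℝ, ℝ), ℝ⟯) B).injective
  rw [map_zero]
  ext1 i
  have : ∀ t : ModelSec n m W, TensorProduct.equivFinsuppOfBasisRight B t i =
      modelCoef (B.coord i) t := by
    intro t
    induction t using TensorProduct.induction_on with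
    | zero => simp
    | add a b ha hb => rw [map_add, map_add, Finsupp.add_apply, ha, hb]
    | tmul f η => simp
  rw [this, hs]
  rfl

theorem modelCoef_modelRes (l : ExteriorAlgebra ℝ (Fin m → ℝ) →ₗ[ℝ] ℝ)
    {W' : Opens (EuclideanSpace ℝ (Fin n))} (h : W' ≤ W) (s : ModelSec n m W) :
    modelCoef l (modelRes n m h s) = smoothRes n h (modelCoef l s) := by
  induction s using TensorProduct.induction_on with
  | zero => simp
  | add a b ha hb => simp only [map_add, ha, hb]
  | tmul f η => simp [modelRes]

theorem modelCoef_tmul_one_mul (l : ExteriorAlgebra ℝ (Fin m → ℝ) →ₗ[ℝ] ℝ)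
    (f : C^∞⟮𝓘(ℝ, EuclideanSpace ℝ (Fin n)), W; 𝓘(ℝ, ℝ), ℝ⟯) (s : ModelSec n m W) :
    modelCoef l ((f ⊗ₜ 1) * s) = f * modelCoef l s := by
  induction s using TensorProduct.induction_on with
  | zero => simp
  | add a b ha hb => rw [mul_add, map_add, map_add, ha, hb, mul_add]
  | tmul g η => simp

/-- A sheaf derivation which kills the coordinates vanishes. -/
theorem sheafDerivation_eq_zero (p : ZMod 2)
    (T : ∀ W' : Opens (EuclideanSpace ℝ (Fin n)), W' ≤ W → ModelSec n m W' →ₗ[ℝ] ModelSec n m W')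
    (hres : ∀ (W' W'' : Opens (EuclideanSpace ℝ (Fin n))) (hW' : W' ≤ W) (h : W'' ≤ W')
      (s : ModelSec n m W'), T W'' (h.trans hW') (modelRes n m h s) = modelRes n m h (T W' hW' s))
    (hmul : ∀ (W' : Opens (EuclideanSpace ℝ (Fin n))) (hW' : W' ≤ W) (i : ZMod 2)
      (s t : ModelSec n m W'), s ∈ modelParity n m W' i →
      T W' hW' (s * t) = T W' hW' s * t + sgn (p * i) • (s * T W' hW' t))
    (hcoord : ∀ (W' : Opens (EuclideanSpace ℝ (Fin n))) (hW' : W' ≤ W) a,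
      T W' hW' (modelCoord m W' a) = 0)
    (W' : Opens (EuclideanSpace ℝ (Fin n))) (hW' : W' ≤ W) (s : ModelSec n m W') :
    T W' hW' s = 0 := by
  have hone : ∀ W' : Opens (EuclideanSpace ℝ (Fin n)), (1 : ModelSec n m W') ∈
      modelParity n m W' 0 := fun W' => by rw [mem_modelParity_iff]; simp
  have h1 : ∀ W' hW', T W' hW' 1 = 0 := fun W' hW' => by
    have := hmul W' hW' 0 1 1 (hone W')
    simpa using this
  refine linearMap_eq_zero (T W' hW') (h1 _ _) (fun s t hs ht => ?_) (fun j => hcoord _ _ _)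
    (fun f => ?_) s
  · obtain ⟨a, ha, b, hb, rfl⟩ : ∃ a ∈ modelParity n m W' 0, ∃ b ∈ modelParity n m W' 1,
        s = a + b := exists_add_of_modelParity s
    rw [add_mul, map_add, hmul _ _ _ _ _ ha, hmul _ _ _ _ _ hb, ht, mul_zero, mul_zero, smul_zero,
      mul_zero, smul_zero, add_zero, add_zero, ← add_mul, ← map_add, hs, zero_mul]
  · refine eq_zero_of_modelCoef _ fun l => ?_
    ext ⟨p, hp⟩
    -- By Hadamard's lemma at `p`, `T f = ∑ (xⁱ - pⁱ) T gᵢ` near `p`. The factors `xⁱ - pⁱ` are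
    -- ordinary functions, so they multiply every coefficient and make it vanish at `p`. As `p` is
    -- arbitrary, `T f = 0`.
    obtain ⟨W'', h, hpW, g, hg⟩ := exists_hadamard_model (m := m) f hp
    have e : modelCoef l (T W' hW' (f ⊗ₜ 1)) ⟨p, hp⟩ =
        modelCoef l (T W'' (h.trans hW') (modelRes n m h (f ⊗ₜ 1))) ⟨p, hpW⟩ := by
      rw [hres, modelCoef_modelRes, smoothRes_apply]
    rw [e, hg, map_add, map_sum, Algebra.algebraMap_eq_smul_one, map_smul, h1, smul_zero, zero_add,
      map_sum, ← smoothEval_apply, map_sum]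
    refine (Finset.sum_eq_zero fun i _ => ?_).trans rfl
    have hpar : modelCoord m W'' (Sum.inl i) - algebraMap ℝ _ (p i) ∈ modelParity n m W'' 0 := by
      refine sub_mem (modelCoord_mem (Sum.inl i)) ?_
      rw [Algebra.algebraMap_eq_smul_one]
      exact Submodule.smul_mem _ _ (hone _)
    have hf : (modelCoord m W'' (Sum.inl i) - algebraMap ℝ _ (p i) : ModelSec n m W'') =
        (coordFun W'' i - algebraMap ℝ _ (p i)) ⊗ₜ 1 := by
      rw [TensorProduct.sub_tmul]; rfl
    rw [hmul _ _ _ _ _ hpar, map_sub, hcoord, Algebra.algebraMap_eq_smul_one, map_smul, h1,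
      ← Algebra.algebraMap_eq_smul_one, hf, smul_zero, sub_zero, zero_mul, zero_add, mul_zero,
      sgn_zero, one_smul, modelCoef_tmul_one_mul, map_mul, map_sub, AlgHom.commutes]
    simp [coordFun]

/-! #### Tangent vectors -/

theorem fderiv_zeroExt_mul {p : EuclideanSpace ℝ (Fin n)} (hp : p ∈ W)
    (f g : C^∞⟮𝓘(ℝ, EuclideanSpace ℝ (Fin n)), W; 𝓘(ℝ, ℝ), ℝ⟯) :
    fderiv ℝ (zeroExt (f * g)) p =
      f ⟨p, hp⟩ • fderiv ℝ (zeroExt g) p + g ⟨p, hp⟩ • fderiv ℝ (zeroExt f) p := by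
  have h : zeroExt (f * g) = zeroExt f * zeroExt g := by
    funext x
    by_cases hx : x ∈ W
    · simp only [Pi.mul_apply, zeroExt_of_mem _ hx]; rfl
    · simp [zeroExt, hx]
  rw [h, fderiv_mul ((contDiffAt_zeroExt f hp).differentiableAt (by simp))
    ((contDiffAt_zeroExt g hp).differentiableAt (by simp)), zeroExt_of_mem _ hp,
    zeroExt_of_mem _ hp]

/-- The first order Taylor expansion in the direction `u`. -/
noncomputable def smoothTangent (p : W) (u : EuclideanSpace ℝ (Fin n)) :
    C^∞⟮𝓘(ℝ, EuclideanSpace ℝ (Fin n)), W; 𝓘(ℝ, ℝ), ℝ⟯ →ₐ[ℝ] DualNumber ℝ :=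
  AlgHom.ofLinearMap
    { toFun := fun f => TrivSqZeroExt.inl (f p) + TrivSqZeroExt.inr (fderiv ℝ (zeroExt f) p u)
      map_add' := fun f g => by
        have h : zeroExt (f + g) = zeroExt f + zeroExt g := by
          funext x
          by_cases hx : x ∈ W
          · simp only [Pi.add_apply, zeroExt_of_mem _ hx]; rfl
          · simp [zeroExt, hx]
        rw [h, fderiv_add ((contDiffAt_zeroExt f p.2).differentiableAt (by simp))
          ((contDiffAt_zeroExt g p.2).differentiableAt (by simp))]
        ext
        · simp
        · simp
      map_smul' := fun c f => by
        have h : zeroExt (c • f) = c • zeroExt f := by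
          funext x
          by_cases hx : x ∈ W
          · simp only [Pi.smul_apply, zeroExt_of_mem _ hx]; rfl
          · simp [zeroExt, hx]
        rw [h, fderiv_const_smul ((contDiffAt_zeroExt f p.2).differentiableAt (by simp))]
        ext
        · simp
        · simp }
    (by
      have h := fderiv_zeroExt_mul p.2 (1 : C^∞⟮𝓘(ℝ, EuclideanSpace ℝ (Fin n)), W; 𝓘(ℝ, ℝ), ℝ⟯) 1
      have h0 : fderiv ℝ (zeroExt (1 : C^∞⟮𝓘(ℝ, EuclideanSpace ℝ (Fin n)), W; 𝓘(ℝ, ℝ), ℝ⟯)) p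
          = 0 := by simpa using h
      ext <;> simp [h0])
    (fun f g => by
      ext
      · simp
      · simp [fderiv_zeroExt_mul p.2 f g, mul_comm, add_comm])

theorem fst_smoothTangent (p : W) (u : EuclideanSpace ℝ (Fin n))
    (f : C^∞⟮𝓘(ℝ, EuclideanSpace ℝ (Fin n)), W; 𝓘(ℝ, ℝ), ℝ⟯) :
    (smoothTangent p u f).fst = f p := by simp [smoothTangent]

theorem snd_smoothTangent (p : W) (u : EuclideanSpace ℝ (Fin n))
    (f : C^∞⟮𝓘(ℝ, EuclideanSpace ℝ (Fin n)), W; 𝓘(ℝ, ℝ), ℝ⟯) :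
    (smoothTangent p u f).snd = fderiv ℝ (zeroExt f) p u := by simp [smoothTangent]

/-- The morphism from `Λ` to the dual numbers which extends a linear form. -/
noncomputable def exteriorTangent (l : (Fin m → ℝ) →ₗ[ℝ] ℝ) :
    ExteriorAlgebra ℝ (Fin m → ℝ) →ₐ[ℝ] DualNumber ℝ :=
  ExteriorAlgebra.lift ℝ ⟨(TrivSqZeroExt.inrHom ℝ ℝ).comp l, fun _ =>
    TrivSqZeroExt.inr_mul_inr ℝ _ _⟩

@[simp] theorem exteriorTangent_ι (l : (Fin m → ℝ) →ₗ[ℝ] ℝ) (v : Fin m → ℝ) :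
    exteriorTangent l (ExteriorAlgebra.ι ℝ v) = TrivSqZeroExt.inr (l v) :=
  ExteriorAlgebra.lift_ι_apply ℝ _ _ v

/-- The tangent vector of `ℝ^{n|m}` at `p` with components `u` and `w`, as an algebra morphism to
the dual numbers. -/
noncomputable def modelTangent (p : W) (u : EuclideanSpace ℝ (Fin n)) (w : Fin m → ℝ) :
    ModelSec n m W →ₐ[ℝ] DualNumber ℝ :=
  Algebra.TensorProduct.lift (smoothTangent p u)
    (exteriorTangent (∑ j, w j • LinearMap.proj (R := ℝ) (φ := fun _ : Fin m => ℝ) j))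
    (fun _ _ => Commute.all _ _)

theorem fst_exteriorTangent (l : (Fin m → ℝ) →ₗ[ℝ] ℝ) (η : ExteriorAlgebra ℝ (Fin m → ℝ)) :
    (exteriorTangent l η).fst = ExteriorAlgebra.algebraMapInv η := by
  have : (TrivSqZeroExt.fstHom ℝ ℝ ℝ).comp (exteriorTangent l) =
      ExteriorAlgebra.algebraMapInv := by
    refine ExteriorAlgebra.hom_ext (LinearMap.ext fun v => ?_)
    simp [algebraMapInv_ι, -DualNumber.inr_eq_smul_eps]
  exact DFunLike.congr_fun this η

/-- The constant term is evaluation at `p`, hence the dual-number part of this algebra morphism is a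
derivation at `p`. -/
theorem fst_modelTangent (p : W) (u : EuclideanSpace ℝ (Fin n)) (w : Fin m → ℝ)
    (s : ModelSec n m W) : (modelTangent p u w s).fst = modelEval n m p s := by
  induction s using TensorProduct.induction_on with
  | zero => simp
  | add a b ha hb => rw [map_add, map_add, TrivSqZeroExt.fst_add, ha, hb]
  | tmul f η =>
    rw [modelTangent, Algebra.TensorProduct.lift_tmul, TrivSqZeroExt.fst_mul, fst_smoothTangent,
      fst_exteriorTangent, modelEval_tmul]

theorem modelTangent_modelRes {W' : Opens (EuclideanSpace ℝ (Fin n))} (h : W' ≤ W) (p : W')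
    (u : EuclideanSpace ℝ (Fin n)) (w : Fin m → ℝ) (s : ModelSec n m W) :
    modelTangent p u w (modelRes n m h s) = modelTangent ⟨p, h p.2⟩ u w s := by
  induction s using TensorProduct.induction_on with
  | zero => simp
  | add a b ha hb => rw [map_add, map_add, map_add, ha, hb]
  | tmul f η =>
    simp only [modelTangent, modelRes, Algebra.TensorProduct.lift_tmul,
      Algebra.TensorProduct.map_tmul, AlgHom.id_apply]
    congr 1
    ext
    · simp only [fst_smoothTangent, smoothRes_apply]
    · simp only [snd_smoothTangent]
      congr 1
      apply Filter.EventuallyEq.fderiv_eq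
      filter_upwards [W'.isOpen.mem_nhds p.2] with x hx
      rw [zeroExt_of_mem _ hx, zeroExt_of_mem _ (h hx), smoothRes_apply]

theorem snd_modelTangent_modelCoord (p : W) (u : EuclideanSpace ℝ (Fin n)) (w : Fin m → ℝ)
    (a : Fin n ⊕ Fin m) :
    (modelTangent p u w (modelCoord m W a)).snd = Sum.elim (fun i => u i) w a := by
  rcases a with i | j
  · simp only [modelTangent, modelCoord, Sum.elim_inl, Algebra.TensorProduct.lift_tmul, map_one,
      mul_one, snd_smoothTangent]
    have h : zeroExt (coordFun W i) =ᶠ[nhds p.1] (EuclideanSpace.proj i :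
        EuclideanSpace ℝ (Fin n) →L[ℝ] ℝ) := by
      filter_upwards [W.isOpen.mem_nhds p.2] with x hx
      rw [zeroExt_of_mem _ hx]
      rfl
    rw [h.fderiv_eq, ContinuousLinearMap.fderiv]
    rfl
  · simp only [modelTangent, modelCoord, Sum.elim_inr, Algebra.TensorProduct.lift_tmul, map_one,
      one_mul, exteriorTangent_ι, TrivSqZeroExt.snd_inr]
    simp [Pi.single_apply]

end ModelDerivations

/-- The body stays nonzero near `p`; there the invertibility criterion applies to a 1 × 1 matrix. -/
theorem exists_isUnit_modelRes {n m : ℕ} {W : Opens (EuclideanSpace ℝ (Fin n))}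
    (s : ModelSec n m W) (p : W) (hs : modelEval n m p s ≠ 0) :
    ∃ (W' : Opens (EuclideanSpace ℝ (Fin n))) (h : W' ≤ W), p.1 ∈ W' ∧
      IsUnit (modelRes n m h s) := by
  have hc : Continuous (modelBody n m W s) := (modelBody n m W s).contMDiff.continuous
  have ho : IsOpen {x : W | modelBody n m W s x ≠ 0} := isOpen_ne_fun hc continuous_const
  let W' : Opens (EuclideanSpace ℝ (Fin n)) :=
    ⟨Subtype.val '' {x : W | modelBody n m W s x ≠ 0}, W.isOpen.isOpenMap_subtype_val _ ho⟩
  have h : W' ≤ W := by rintro _ ⟨x, -, rfl⟩; exact x.2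
  refine ⟨W', h, ⟨p, hs, rfl⟩, ?_⟩
  have hu : IsUnit (Matrix.of fun _ _ : Unit => modelRes n m h s) := by
    apply isUnit_matrix_model
    rintro ⟨_, ⟨x, hx, rfl⟩⟩
    rw [Matrix.isUnit_iff_isUnit_det, Matrix.det_unique]
    refine IsUnit.mk0 _ ?_
    change modelEval n m _ (modelRes n m h s) ≠ 0
    rw [modelEval_modelRes]
    exact hx
  exact (MulEquiv.isUnit_map (Matrix.uniqueRingEquiv : Matrix Unit Unit _ ≃+* _)).mpr hu

namespace SuperSpace

variable {X : SuperSpace.{u}} {n m : ℕ}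

namespace Chart

variable (c : X.Chart n m)

/-- The image of an open set under a chart. -/
def img (U : Opens X.carrier) : Opens (EuclideanSpace ℝ (Fin n)) :=
  ⟨c.coord.target ∩ c.coord.symm ⁻¹' U, c.coord.symm.isOpen_inter_preimage U.isOpen⟩

theorem img_subset (U : Opens X.carrier) : (c.img U : Set _) ⊆ c.coord.target :=
  Set.inter_subset_left

theorem img_mono {U V : Opens X.carrier} (h : V ≤ U) : c.img V ≤ c.img U :=
  Set.inter_subset_inter_right _ (Set.preimage_mono h)

theorem piece_img_le (U : Opens X.carrier) : c.piece (c.img U) ≤ U := by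
  rintro x ⟨hx, hx'⟩
  have : c.coord.symm (c.coord x) ∈ U := hx'.2
  rwa [c.coord.left_inv hx] at this

theorem mem_img {U : Opens X.carrier} {p : X.carrier} (hp : p ∈ c.coord.source) (hU : p ∈ U) :
    c.coord p ∈ c.img U := by
  refine ⟨c.coord.map_source hp, ?_⟩
  change c.coord.symm (c.coord p) ∈ U
  rwa [c.coord.left_inv hp]

theorem piece_mono {W W' : Opens (EuclideanSpace ℝ (Fin n))} (h : W' ≤ W) :
    c.piece W' ≤ c.piece W := Set.inter_subset_inter_right _ (Set.preimage_mono h)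

theorem iso_res_res {W W' : Opens (EuclideanSpace ℝ (Fin n))} (hW : (W : Set _) ⊆ c.coord.target)
    (hW' : (W' : Set _) ⊆ c.coord.target) (h : W' ≤ W) {U : Opens X.carrier}
    (hU : c.piece W ≤ U) (hU' : c.piece W' ≤ U) (s : X.Sec U) :
    c.iso W' hW' (X.res hU' s) = modelRes n m h (c.iso W hW (X.res hU s)) := by
  rw [← c.iso_res W W' hW hW' h]
  exact congrArg _ (X.res_res hU (c.piece_mono h) s).symm

theorem res_iso_symm {W W' : Opens (EuclideanSpace ℝ (Fin n))} (hW : (W : Set _) ⊆ c.coord.target)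
    (hW' : (W' : Set _) ⊆ c.coord.target) (h : W' ≤ W) (s : ModelSec n m W) :
    X.res (c.piece_mono h) ((c.iso W hW).symm s) = (c.iso W' hW').symm (modelRes n m h s) := by
  rw [AlgEquiv.eq_symm_apply, c.iso_res W W' hW hW' h, AlgEquiv.apply_symm_apply]

end Chart

/-! ### Values of superfunctions at points -/

/-- The value of a section at a point: the number `l` such that `s - l` is not invertible near
the point. -/
noncomputable def valueAt (X : SuperSpace.{u}) (p : X.carrier) {U : Opens X.carrier}
    (s : X.Sec U) : ℝ :=
  Classical.epsilon fun l : ℝ => ∀ (V : Opens X.carrier) (hV : V ≤ U), p ∈ V →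
    ¬ IsUnit (X.res hV (s - algebraMap ℝ _ l))

/-- With `l` the value read in the chart, `s - l` evaluates to 0 near `p` and so is never a unit
there. For any other `l` the value is nonzero and `s - l` is a unit on a smaller neighbourhood. So
the invertibility condition singles out this number, whatever the chart. -/
theorem Chart.valueAt_eq (c : X.Chart n m) {p : X.carrier} (hp : p ∈ c.coord.source)
    {W : Opens (EuclideanSpace ℝ (Fin n))} (hW : (W : Set _) ⊆ c.coord.target)
    (hpW : c.coord p ∈ W) {U : Opens X.carrier} (hU : c.piece W ≤ U) (s : X.Sec U) :
    X.valueAt p s = modelEval n m ⟨c.coord p, hpW⟩ (c.iso W hW (X.res hU s)) := by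
  have h0 : ∀ (V : Opens X.carrier) (hV : V ≤ U), p ∈ V → ¬ IsUnit (X.res hV
      (s - algebraMap ℝ _ (modelEval n m ⟨c.coord p, hpW⟩ (c.iso W hW (X.res hU s))))) := by
    intro V hV hpV hu
    have hW' : ((W ⊓ c.img V : Opens _) : Set (EuclideanSpace ℝ (Fin n))) ⊆ c.coord.target :=
      Set.inter_subset_right.trans (c.img_subset V)
    have hle : c.piece (W ⊓ c.img V) ≤ V := (c.piece_mono inf_le_right).trans (c.piece_img_le V)
    have h1 := ((hu.map (X.res hle)).map (c.iso _ hW')).map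
      (modelEval n m (W := W ⊓ c.img V) ⟨c.coord p, ⟨hpW, c.mem_img hp hpV⟩⟩)
    rw [X.res_res, c.iso_res_res hW hW' inf_le_left hU, modelEval_modelRes, map_sub, map_sub,
      map_sub, AlgHom.commutes, AlgEquiv.commutes, AlgHom.commutes] at h1
    simp at h1
  have h2 := Classical.epsilon_spec (p := fun l : ℝ => ∀ (V : Opens X.carrier) (hV : V ≤ U), p ∈ V →
    ¬ IsUnit (X.res hV (s - algebraMap ℝ _ l))) ⟨_, h0⟩
  by_contra hne
  obtain ⟨W', hW', hpW', hu⟩ := exists_isUnit_modelRes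
    (c.iso W hW (X.res hU (s - algebraMap ℝ _ (X.valueAt p s)))) ⟨c.coord p, hpW⟩ (by
      rw [map_sub, map_sub, map_sub, AlgHom.commutes, AlgEquiv.commutes, AlgHom.commutes]
      exact sub_ne_zero.mpr (Ne.symm hne))
  have hW'' : (W' : Set (EuclideanSpace ℝ (Fin n))) ⊆ c.coord.target := subset_trans hW' hW
  refine h2 (c.piece W') ((c.piece_mono hW').trans hU) ⟨hp, hpW'⟩ ?_
  rw [← c.iso_res_res hW hW'' hW' hU ((c.piece_mono hW').trans hU)] at hu
  exact (MulEquiv.isUnit_map (c.iso W' hW'')).mp hu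

namespace IsSupermanifold

variable (hX : X.IsSupermanifold n m)

include hX

theorem exists_valueAt_eq {p : X.carrier} {U : Opens X.carrier} (hp : p ∈ U) :
    ∃ φ : X.Sec U →ₐ[ℝ] ℝ, ∀ s, X.valueAt p s = φ s := by
  obtain ⟨c, hc⟩ := hX.exists_chart p
  exact ⟨(modelEval n m ⟨c.coord p, c.mem_img hc hp⟩).comp
    (((c.iso (c.img U) (c.img_subset U)).toAlgHom).comp (X.res (c.piece_img_le U))),
    fun s => c.valueAt_eq hc _ _ _ s⟩

/-- Evaluation at a point as an algebra morphism. -/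
noncomputable def evalAt {p : X.carrier} {U : Opens X.carrier} (hp : p ∈ U) :
    X.Sec U →ₐ[ℝ] ℝ := (hX.exists_valueAt_eq hp).choose

theorem evalAt_apply {p : X.carrier} {U : Opens X.carrier} (hp : p ∈ U) (s : X.Sec U) :
    hX.evalAt hp s = X.valueAt p s := ((hX.exists_valueAt_eq hp).choose_spec s).symm

theorem valueAt_res {p : X.carrier} {U V : Opens X.carrier} (h : V ≤ U) (hp : p ∈ V)
    (s : X.Sec U) : X.valueAt p (X.res h s) = X.valueAt p s := by
  obtain ⟨c, hc⟩ := hX.exists_chart p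
  rw [c.valueAt_eq hc (c.img_subset V) (c.mem_img hc hp) (c.piece_img_le V),
    c.valueAt_eq hc (c.img_subset V) (c.mem_img hc hp) ((c.piece_img_le V).trans h), X.res_res]

theorem valueAt_invol {p : X.carrier} {U : Opens X.carrier} (hp : p ∈ U) (s : X.Sec U) :
    X.valueAt p (X.invol U s) = X.valueAt p s := by
  obtain ⟨c, hc⟩ := hX.exists_chart p
  rw [c.valueAt_eq hc (c.img_subset U) (c.mem_img hc hp) (c.piece_img_le U),
    c.valueAt_eq hc (c.img_subset U) (c.mem_img hc hp) (c.piece_img_le U), X.res_invol,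
    c.iso_invol, modelEval_modelInvol]

theorem exists_isUnit_res {p : X.carrier} {U : Opens X.carrier} (hp : p ∈ U) (s : X.Sec U)
    (hs : X.valueAt p s ≠ 0) :
    ∃ (V : Opens X.carrier) (hV : V ≤ U), p ∈ V ∧ IsUnit (X.res hV s) := by
  obtain ⟨c, hc⟩ := hX.exists_chart p
  rw [c.valueAt_eq hc (c.img_subset U) (c.mem_img hc hp) (c.piece_img_le U)] at hs
  obtain ⟨W', hW', hpW', hu⟩ := exists_isUnit_modelRes _ _ hs
  have hW'' : (W' : Set (EuclideanSpace ℝ (Fin n))) ⊆ c.coord.target :=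
    subset_trans hW' (c.img_subset U)
  have hle := (c.piece_mono hW').trans (c.piece_img_le U)
  refine ⟨c.piece W', hle, ⟨hc, hpW'⟩, ?_⟩
  rw [← c.iso_res_res (c.img_subset U) hW'' hW' (c.piece_img_le U) hle] at hu
  exact (MulEquiv.isUnit_map (c.iso W' hW'')).mp hu

/-- Compatibility with evaluation is automatic for morphisms of superringed spaces. If the values
differed, `s` minus its pulled-back value would be a unit near `f(p)`; its pullback would be a unit
near `p`, yet it has value 0 at `p`. -/
theorem valueAt_pullback {Y : SuperSpace.{u}} {k l : ℕ} (hY : Y.IsSupermanifold k l) (f : Hom X Y)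
    {p : X.carrier} {V : Opens Y.carrier} (hp : f.base p ∈ V) (s : Y.Sec V) :
    X.valueAt p (f.pullback V s) = Y.valueAt (f.base p) s := by
  have hp' : p ∈ Opens.comap f.base V := hp
  by_contra hne
  set t := s - algebraMap ℝ _ (X.valueAt p (f.pullback V s)) with ht
  have h1 : Y.valueAt (f.base p) t ≠ 0 := by
    rw [← hY.evalAt_apply hp, ht, map_sub, AlgHom.commutes, hY.evalAt_apply hp]
    exact sub_ne_zero.mpr (Ne.symm hne)
  obtain ⟨V', hV', hpV', hu⟩ := hY.exists_isUnit_res hp t h1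
  have hu2 := hu.map (f.pullback V')
  rw [f.pullback_res hV'] at hu2
  have hpV'' : p ∈ Opens.comap f.base V' := hpV'
  have hu3 := hu2.map (hX.evalAt hpV'')
  rw [hX.evalAt_apply, hX.valueAt_res _ hpV'', ht, map_sub, AlgHom.commutes,
    ← hX.evalAt_apply hp', map_sub, AlgHom.commutes, hX.evalAt_apply hp'] at hu3
  simp at hu3

end IsSupermanifold

/-! ### Tangent vectors -/

/-- Families of linear forms on the sections over the neighbourhoods of a point. -/
abbrev PointOp (X : SuperSpace.{u}) (p : X.carrier) : Type u :=
  ∀ U : {U : Opens X.carrier // p ∈ U}, X.Sec U.1 →ₗ[ℝ] ℝ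

/-- The tangent space at `p`: point derivations of the germs at `p`. -/
noncomputable def tangentSpace (X : SuperSpace.{u}) (p : X.carrier) :
    Submodule ℝ (X.PointOp p) where
  carrier := {v |
    (∀ (U V : Opens X.carrier) (h : V ≤ U) (hp : p ∈ V) (s : X.Sec U),
      v ⟨V, hp⟩ (X.res h s) = v ⟨U, h hp⟩ s) ∧
    (∀ (U : Opens X.carrier) (hp : p ∈ U) (s t : X.Sec U),
      v ⟨U, hp⟩ (s * t) = v ⟨U, hp⟩ s * X.valueAt p t + X.valueAt p s * v ⟨U, hp⟩ t)}
  zero_mem' := ⟨fun _ _ _ _ _ => rfl, fun _ _ _ _ => by simp⟩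
  add_mem' {v w} hv hw := ⟨fun U V h hp s => by simp [hv.1 U V h hp, hw.1 U V h hp],
    fun U hp s t => by simp [hv.2 U hp s t, hw.2 U hp s t]; ring⟩
  smul_mem' r v hv := ⟨fun U V h hp s => by simp [hv.1 U V h hp],
    fun U hp s t => by simp [hv.2 U hp s t]; ring⟩

/-- The push-forward of tangent vectors. -/
noncomputable def pushforward {X Y : SuperSpace.{u}} (f : Hom X Y) {p : X.carrier}
    (v : X.PointOp p) :
    Y.PointOp (f.base p) :=
  fun V => v ⟨Opens.comap f.base V.1, V.2⟩ ∘ₗ (f.pullback V.1).toLinearMap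

theorem pushforward_mem {X Y : SuperSpace.{u}} {k l : ℕ} (hX : X.IsSupermanifold n m)
    (hY : Y.IsSupermanifold k l) (f : Hom X Y) {p : X.carrier}
    {v : X.PointOp p} (hv : v ∈ X.tangentSpace p) :
    pushforward f v ∈ Y.tangentSpace (f.base p) := by
  refine ⟨fun U V h hp s => ?_, fun U hp s t => ?_⟩
  · change v ⟨_, hp⟩ (f.pullback V (Y.res h s)) = v ⟨_, _⟩ (f.pullback U s)
    rw [f.pullback_res]
    exact hv.1 _ _ _ _ _
  · change v ⟨_, hp⟩ (f.pullback U (s * t)) = v ⟨_, hp⟩ (f.pullback U s) * _ + _ * v ⟨_, hp⟩ (f.pullback U t)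
    rw [map_mul]
    refine (hv.2 _ _ _ _).trans ?_
    rw [hX.valueAt_pullback hY f hp, hX.valueAt_pullback hY f hp]

namespace Chart

variable (c : X.Chart n m)

/-- The image of a chart as an open set. -/
def full : Opens (EuclideanSpace ℝ (Fin n)) := ⟨c.coord.target, c.coord.open_target⟩

theorem full_subset : (c.full : Set _) ⊆ c.coord.target := subset_rfl

theorem mem_piece_full {p : X.carrier} (hp : p ∈ c.coord.source) : p ∈ c.piece c.full :=
  ⟨hp, c.coord.map_source hp⟩

/-- The coordinate functions of a chart. -/
noncomputable def coordSec (a : Fin n ⊕ Fin m) : X.Sec (c.piece c.full) :=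
  (c.iso c.full c.full_subset).symm (modelCoord m c.full a)

theorem coordSec_mem (a : Fin n ⊕ Fin m) : c.coordSec a ∈ X.parity _ (idxParity a) := by
  rw [← c.iso_parity c.full c.full_subset, coordSec, AlgEquiv.apply_symm_apply]
  exact modelCoord_mem a

theorem iso_res_coordSec {W : Opens (EuclideanSpace ℝ (Fin n))}
    (hW : (W : Set _) ⊆ c.coord.target) (h : c.piece W ≤ c.piece c.full) (a : Fin n ⊕ Fin m) :
    c.iso W hW (X.res h (c.coordSec a)) = modelCoord m W a := by
  have := c.iso_res c.full W c.full_subset hW hW (c.coordSec a)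
  rw [coordSec, AlgEquiv.apply_symm_apply] at this
  exact this.trans (modelRes_modelCoord _ a)

/-- Transported through the chart, `v` is a compatible family of point derivations of the model
killing the coordinates, so `pointDerivation_eq_zero` applies. -/
theorem tangent_eq_zero {p : X.carrier} (hp : p ∈ c.coord.source)
    {v : X.PointOp p} (hv : v ∈ X.tangentSpace p)
    (h : ∀ a, v ⟨_, c.mem_piece_full hp⟩ (c.coordSec a) = 0) : v = 0 := by
  have key := pointDerivation_eq_zero (m := m) (W := c.full) (p := c.coord p)
    (fun W' hW' hpW => v ⟨c.piece W', ⟨hp, hpW⟩⟩ ∘ₗ (c.iso W' hW').symm.toLinearMap)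
    (fun W' W'' hW' hle hp' hp'' s => by
      change v ⟨_, _⟩ ((c.iso W'' _).symm _) = v ⟨_, _⟩ ((c.iso W' _).symm s)
      rw [← c.res_iso_symm hW' (subset_trans hle hW') hle]
      exact hv.1 _ _ _ _ _)
    (fun W' hW' hp' s t => by
      change v ⟨_, _⟩ ((c.iso W' _).symm _) = v ⟨_, _⟩ ((c.iso W' _).symm s) * _ +
        _ * v ⟨_, _⟩ ((c.iso W' _).symm t)
      rw [map_mul]
      refine (hv.2 _ _ _ _).trans ?_
      rw [c.valueAt_eq hp hW' hp' le_rfl, c.valueAt_eq hp hW' hp' le_rfl,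
        X.res_self, X.res_self, AlgEquiv.apply_symm_apply, AlgEquiv.apply_symm_apply])
    (fun W' hW' hp' a => by
      change v ⟨_, _⟩ ((c.iso W' _).symm _) = 0
      rw [← c.iso_res_coordSec hW' (c.piece_mono hW') a, AlgEquiv.symm_apply_apply]
      exact (hv.1 _ _ _ _ _).trans (h a))
  funext ⟨U, hU⟩
  ext s
  have h1 := key (c.img U) (c.img_subset U) (c.mem_img hp hU)
    (c.iso _ (c.img_subset U) (X.res (c.piece_img_le U) s))
  change v ⟨_, _⟩ ((c.iso _ _).symm _) = 0 at h1
  rw [AlgEquiv.symm_apply_apply] at h1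
  exact (hv.1 _ _ _ _ _).symm.trans h1

/-- The coordinate tangent vector with components `u`, `w`. -/
noncomputable def tangentVec {p : X.carrier} (hp : p ∈ c.coord.source)
    (u : EuclideanSpace ℝ (Fin n)) (w : Fin m → ℝ) :
    X.PointOp p := fun U =>
  (TrivSqZeroExt.sndHom ℝ ℝ) ∘ₗ
    (modelTangent ⟨c.coord p, c.mem_img hp U.2⟩ u w).toLinearMap ∘ₗ
    (c.iso _ (c.img_subset U.1)).toLinearMap ∘ₗ (X.res (c.piece_img_le U.1)).toLinearMap

theorem tangentVec_apply {p : X.carrier} (hp : p ∈ c.coord.source)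
    (u : EuclideanSpace ℝ (Fin n)) (w : Fin m → ℝ) {U : Opens X.carrier} (hU : p ∈ U)
    (s : X.Sec U) : c.tangentVec hp u w ⟨U, hU⟩ s =
      (modelTangent ⟨c.coord p, c.mem_img hp hU⟩ u w
        (c.iso _ (c.img_subset U) (X.res (c.piece_img_le U) s))).snd := rfl

theorem tangentVec_mem {p : X.carrier} (hp : p ∈ c.coord.source)
    (u : EuclideanSpace ℝ (Fin n)) (w : Fin m → ℝ) :
    c.tangentVec hp u w ∈ X.tangentSpace p := by
  refine ⟨fun U V h hpV s => ?_, fun U hU s t => ?_⟩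
  · rw [tangentVec_apply, tangentVec_apply, X.res_res, c.iso_res_res (c.img_subset U)
      (c.img_subset V) (c.img_mono h) (c.piece_img_le U), modelTangent_modelRes]
  · rw [tangentVec_apply, tangentVec_apply, tangentVec_apply]
    rw [map_mul, map_mul, map_mul, TrivSqZeroExt.snd_mul, fst_modelTangent, fst_modelTangent,
      c.valueAt_eq hp (c.img_subset U) (c.mem_img hp hU) (c.piece_img_le U),
      c.valueAt_eq hp (c.img_subset U) (c.mem_img hp hU) (c.piece_img_le U)]
    simp only [smul_eq_mul, MulOpposite.smul_eq_mul_unop, MulOpposite.unop_op]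
    ring

theorem tangentVec_coordSec {p : X.carrier} (hp : p ∈ c.coord.source)
    (u : EuclideanSpace ℝ (Fin n)) (w : Fin m → ℝ) (a : Fin n ⊕ Fin m) :
    c.tangentVec hp u w ⟨_, c.mem_piece_full hp⟩ (c.coordSec a) =
      Sum.elim (fun i => u i) w a := by
  rw [tangentVec_apply, c.iso_res_coordSec, snd_modelTangent_modelCoord]

/-- The coordinate basis of the tangent space. -/
noncomputable def basisVec {p : X.carrier} (hp : p ∈ c.coord.source) (a : Fin n ⊕ Fin m) :
    X.PointOp p :=
  c.tangentVec hp (Sum.elim (fun i => EuclideanSpace.single i 1) (fun _ => 0) a)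
    (Sum.elim (fun _ => 0) (fun j => Pi.single j 1) a)

theorem basisVec_coordSec {p : X.carrier} (hp : p ∈ c.coord.source) (a b : Fin n ⊕ Fin m) :
    c.basisVec hp a ⟨_, c.mem_piece_full hp⟩ (c.coordSec b) = if a = b then 1 else 0 := by
  rw [basisVec, tangentVec_coordSec]
  rcases a with i | i <;> rcases b with j | j <;> simp [Pi.single_apply, eq_comm]

end Chart

/-- Odd functions have value 0, so `σ` does not change values and the unsigned Leibniz rule survives
composition with it. This gives a meaning to the parity of a tangent vector. -/
theorem comp_invol_mem (hX : X.IsSupermanifold n m) {p : X.carrier}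
    {v : X.PointOp p} (hv : v ∈ X.tangentSpace p) :
    (fun U => v U ∘ₗ (X.invol U.1).toLinearMap : X.PointOp p) ∈ X.tangentSpace p := by
  refine ⟨fun U V h hp s => ?_, fun U hp s t => ?_⟩
  · change v ⟨V, hp⟩ (X.invol V (X.res h s)) = v ⟨U, _⟩ (X.invol U s)
    rw [← X.res_invol, hv.1]
  · change v ⟨U, hp⟩ (X.invol U (s * t)) = v ⟨U, hp⟩ (X.invol U s) * _ + _ * v ⟨U, hp⟩ (X.invol U t)
    rw [map_mul, hv.2, hX.valueAt_invol hp, hX.valueAt_invol hp]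

/-- Both sides are point derivations, and they agree on the coordinates, which are homogeneous. -/
theorem Chart.basisVec_invol (hX : X.IsSupermanifold n m) (c : X.Chart n m) {p : X.carrier}
    (hp : p ∈ c.coord.source) (a : Fin n ⊕ Fin m) {U : Opens X.carrier} (hU : p ∈ U)
    (s : X.Sec U) : c.basisVec hp a ⟨U, hU⟩ (X.invol U s) =
      sgn (idxParity a) * c.basisVec hp a ⟨U, hU⟩ s := by
  have hmem : c.basisVec hp a ∈ X.tangentSpace p := c.tangentVec_mem hp _ _
  have h := c.tangent_eq_zero hp (sub_mem (comp_invol_mem hX hmem)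
    (Submodule.smul_mem _ (sgn (idxParity a)) hmem)) (fun b => by
      change c.basisVec hp a ⟨_, _⟩ (X.invol _ (c.coordSec b)) -
        sgn (idxParity a) * c.basisVec hp a ⟨_, _⟩ (c.coordSec b) = 0
      rw [X.invol_of_mem (c.coordSec_mem b), map_smul, basisVec_coordSec]
      by_cases hab : a = b
      · subst hab; simp
      · simp [hab])
  have h2 := LinearMap.congr_fun (congrFun h ⟨U, hU⟩) s
  exact sub_eq_zero.mp h2

/-! ### Infinitesimal constant morphisms -/

open Classical in
/-- The linear map underlying `tangentHom`. -/
noncomputable def tangentHomAux {S X : SuperSpace.{u}} (hX : X.IsSupermanifold n m) {p : X.carrier}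
    (v : X.PointOp p) (δ : S.Fun) (V : Opens X.carrier) :
    X.Sec V →ₗ[ℝ] S.Sec (Opens.comap (ContinuousMap.const S.carrier p) V) :=
  if h : p ∈ V then
    (LinearMap.toSpanSingleton ℝ _ 1) ∘ₗ (hX.evalAt h).toLinearMap +
      (LinearMap.toSpanSingleton ℝ _ (S.res le_top δ)) ∘ₗ v ⟨V, h⟩
  else 0

theorem tangentHomAux_apply {S X : SuperSpace.{u}} (hX : X.IsSupermanifold n m) {p : X.carrier}
    (v : X.PointOp p) (δ : S.Fun) {V : Opens X.carrier}
    (h : p ∈ V) (s : X.Sec V) : tangentHomAux hX v δ V s =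
      X.valueAt p s • 1 + v ⟨V, h⟩ s • S.res le_top δ := by
  rw [tangentHomAux, dif_pos h]
  simp [hX.evalAt_apply]

theorem subsingleton_comap_const (S : SuperSpace.{u}) {X : SuperSpace.{u}} {p : X.carrier}
    {V : Opens X.carrier} (h : p ∉ V) :
    Subsingleton (S.Sec (Opens.comap (ContinuousMap.const S.carrier p) V)) :=
  S.subsingleton_sec fun _ hx => h hx

/-- For a tangent vector `v` at `p` and a superfunction `δ` on `S` of square zero and of the same
parity as `v`, the morphism `S → X` given by `f ↦ f(p) + v(f) δ`. -/
noncomputable def tangentHom {S X : SuperSpace.{u}} (hX : X.IsSupermanifold n m) {p : X.carrier}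
    (v : X.PointOp p) (hv : v ∈ X.tangentSpace p) (k : ZMod 2)
    (hvk : ∀ (U : Opens X.carrier) (hU : p ∈ U) (s : X.Sec U),
      v ⟨U, hU⟩ (X.invol U s) = sgn k * v ⟨U, hU⟩ s) (δ : S.Fun) (hδ : δ * δ = 0)
    (hδk : δ ∈ S.parity ⊤ k) : Hom S X where
  base := ContinuousMap.const S.carrier p
  pullback V := AlgHom.ofLinearMap (tangentHomAux hX v δ V)
    (by
      by_cases h : p ∈ V
      · have h1 : v ⟨V, h⟩ 1 = 0 := by
          have := hv.2 V h 1 1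
          rw [← hX.evalAt_apply h, map_one (hX.evalAt h), mul_one] at this
          simpa using this
        rw [tangentHomAux_apply hX v δ h, h1, ← hX.evalAt_apply h, map_one]
        simp
      · exact @Subsingleton.elim _ (S.subsingleton_comap_const h) _ _)
    (fun s t => by
      by_cases h : p ∈ V
      -- Since `δ² = 0`, the term with `v(s) v(t)` drops out and multiplicativity reduces to the
      -- Leibniz rule of `v`.
      · have h2 : S.res (le_top : Opens.comap (ContinuousMap.const S.carrier p) V ≤ ⊤) δ *
          S.res le_top δ = 0 := by rw [← map_mul, hδ, map_zero]
        simp only [tangentHomAux_apply hX v δ h, hv.2, ← hX.evalAt_apply h, map_mul, add_mul,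
          mul_add, smul_mul_smul_comm, one_mul, mul_one, h2, smul_zero, add_zero]
        module
      · exact @Subsingleton.elim _ (S.subsingleton_comap_const h) _ _)
  pullback_res {U V} hle s := by
    change tangentHomAux hX v δ V (X.res hle s) = S.res _ (tangentHomAux hX v δ U s)
    by_cases h : p ∈ V
    · rw [tangentHomAux_apply hX v δ h, tangentHomAux_apply hX v δ (hle h), hX.valueAt_res hle h,
        hv.1 U V hle h, map_add, map_smul, map_smul, map_one, S.res_res]
    · exact @Subsingleton.elim _ (S.subsingleton_comap_const h) _ _
  pullback_parity V i s hs := by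
    change tangentHomAux hX v δ V s ∈ _
    by_cases h : p ∈ V
    · have hδ' : S.res le_top δ ∈ S.parity (Opens.comap (ContinuousMap.const S.carrier p) V) k :=
        S.res_parity le_top k δ hδk
      rw [tangentHomAux_apply hX v δ h, S.mem_parity_iff, map_add, map_smul, map_smul, map_one,
        S.invol_of_mem hδ', smul_add]
      have e1 := hX.valueAt_invol h s
      have e2 := hvk V h s
      rw [X.invol_of_mem hs, ← hX.evalAt_apply h, map_smul, smul_eq_mul, hX.evalAt_apply h] at e1
      rw [X.invol_of_mem hs, map_smul, smul_eq_mul] at e2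
      rw [smul_smul (sgn i), e1, smul_smul, mul_comm (v ⟨V, h⟩ s), ← e2, ← smul_smul]
    · have := S.subsingleton_comap_const (p := p) h
      rw [Subsingleton.elim (tangentHomAux hX v δ V s) 0]
      exact zero_mem _

theorem tangentHom_pullback {S X : SuperSpace.{u}} (hX : X.IsSupermanifold n m) {p : X.carrier}
    {v : X.PointOp p} (hv : v ∈ X.tangentSpace p) {k : ZMod 2}
    (hvk : ∀ (U : Opens X.carrier) (hU : p ∈ U) (s : X.Sec U),
      v ⟨U, hU⟩ (X.invol U s) = sgn k * v ⟨U, hU⟩ s) {δ : S.Fun} (hδ : δ * δ = 0)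
    (hδk : δ ∈ S.parity ⊤ k) {V : Opens X.carrier} (h : p ∈ V) (s : X.Sec V) :
    (tangentHom hX v hv k hvk δ hδ hδk).pullback V s =
      X.valueAt p s • 1 + v ⟨V, h⟩ s • S.res le_top δ := tangentHomAux_apply hX v δ h s

end SuperSpace

namespace SuperSpace

variable {n m : ℕ}

/-- A morphism with constant base map is determined by its effect near the point. -/
theorem eq_tangentHom {S X : SuperSpace.{u}} (hX : X.IsSupermanifold n m) {p : X.carrier}
    {v : X.PointOp p} (hv : v ∈ X.tangentSpace p) {k : ZMod 2}
    (hvk : ∀ (U : Opens X.carrier) (hU : p ∈ U) (s : X.Sec U),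
      v ⟨U, hU⟩ (X.invol U s) = sgn k * v ⟨U, hU⟩ s) {δ : S.Fun} (hδ : δ * δ = 0)
    (hδk : δ ∈ S.parity ⊤ k) (f : Hom S X) (hb : ∀ x, f.base x = p)
    (h : ∀ (V : Opens X.carrier) (hp : p ∈ V) (s : X.Sec V),
      f.pullback V s = X.valueAt p s • 1 + v ⟨V, hp⟩ s • S.res le_top δ) :
    f = tangentHom hX v hv k hvk δ hδ hδk := by
  have hb' : f.base = ContinuousMap.const S.carrier p := ContinuousMap.ext hb
  refine Hom.ext_of_res hb' fun V s => ?_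
  by_cases hp : p ∈ V
  · rw [h V hp, tangentHom_pullback hX hv hvk hδ hδk hp, map_add, map_smul, map_smul, map_one,
      S.res_res]
  · exact @Subsingleton.elim _ (S.subsingleton_comap_const hp) _ _

theorem zero_comp_invol {X : SuperSpace.{u}} {p : X.carrier} (U : Opens X.carrier) (hU : p ∈ U)
    (s : X.Sec U) : (0 : X.PointOp p) ⟨U, hU⟩ (X.invol U s) =
      sgn 0 * (0 : X.PointOp p) ⟨U, hU⟩ s := by simp

/-- The constant morphism. -/
noncomputable def constHom (S : SuperSpace.{u}) {X : SuperSpace.{u}} (hX : X.IsSupermanifold n m)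
    (p : X.carrier) : Hom S X :=
  tangentHom hX (p := p) 0 (zero_mem _) 0 zero_comp_invol 0 (mul_zero 0) (zero_mem _)

theorem constHom_pullback (S : SuperSpace.{u}) {X : SuperSpace.{u}} (hX : X.IsSupermanifold n m)
    {p : X.carrier} {V : Opens X.carrier} (hp : p ∈ V) (s : X.Sec V) :
    (constHom S hX p).pullback V s = X.valueAt p s • 1 := by
  rw [constHom, tangentHom_pullback hX _ _ _ _ hp]
  simp

theorem eq_constHom {S X : SuperSpace.{u}} (hX : X.IsSupermanifold n m) {p : X.carrier}
    (f : Hom S X) (hb : ∀ x, f.base x = p)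
    (h : ∀ (V : Opens X.carrier) (_ : p ∈ V) (s : X.Sec V),
      f.pullback V s = X.valueAt p s • 1) : f = constHom S hX p := by
  refine eq_tangentHom hX _ _ _ _ f hb fun V hp s => ?_
  rw [h V hp]
  simp

theorem constHom_comp (S : SuperSpace.{u}) {X Y : SuperSpace.{u}} {k l : ℕ}
    (hX : X.IsSupermanifold n m) (hY : Y.IsSupermanifold k l) (p : X.carrier) (f : Hom X Y) :
    (constHom S hX p).comp f = constHom S hY (f.base p) := by
  refine eq_constHom hY _ (fun x => rfl) fun V hp s => ?_
  refine (constHom_pullback S hX (V := Opens.comap f.base V) hp (f.pullback V s)).trans ?_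
  rw [hX.valueAt_pullback hY f hp]
  rfl

theorem comp_constHom {S T X : SuperSpace.{u}} (hX : X.IsSupermanifold n m) (p : X.carrier)
    (f : Hom S T) : f.comp (constHom T hX p) = constHom S hX p := by
  refine eq_constHom hX _ (fun x => rfl) fun V hp s => ?_
  change f.pullback _ ((constHom T hX p).pullback V s) = _
  rw [constHom_pullback T hX hp, map_smul, map_one]
  rfl

/-- A morphism that kills `δ` turns an infinitesimal morphism into a constant one. -/
theorem comp_tangentHom_of_eq_zero {S T X : SuperSpace.{u}} (hX : X.IsSupermanifold n m)
    {p : X.carrier} {v : X.PointOp p} (hv : v ∈ X.tangentSpace p) {k : ZMod 2}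
    (hvk : ∀ (U : Opens X.carrier) (hU : p ∈ U) (s : X.Sec U),
      v ⟨U, hU⟩ (X.invol U s) = sgn k * v ⟨U, hU⟩ s) {δ : S.Fun} (hδ : δ * δ = 0)
    (hδk : δ ∈ S.parity ⊤ k) (f : Hom T S) (hf : f.pullback ⊤ δ = 0) :
    f.comp (tangentHom hX v hv k hvk δ hδ hδk) = constHom T hX p := by
  refine eq_constHom hX _ (fun x => rfl) fun V hp s => ?_
  change f.pullback _ ((tangentHom hX v hv k hvk δ hδ hδk).pullback V s) = _
  rw [tangentHom_pullback hX hv hvk hδ hδk hp, map_add, map_smul, map_smul, map_one]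
  have h1 := f.pullback_res (le_top : Opens.comap (ContinuousMap.const S.carrier p) V ≤ ⊤) δ
  rw [hf, map_zero] at h1
  exact (congrArg _ ((congrArg _ h1).trans (smul_zero _))).trans (add_zero _)

/-- A morphism that fixes `δ` fixes the infinitesimal morphism. -/
theorem comp_tangentHom_of_eq {S X : SuperSpace.{u}} (hX : X.IsSupermanifold n m)
    {p : X.carrier} {v : X.PointOp p} (hv : v ∈ X.tangentSpace p) {k : ZMod 2}
    (hvk : ∀ (U : Opens X.carrier) (hU : p ∈ U) (s : X.Sec U),
      v ⟨U, hU⟩ (X.invol U s) = sgn k * v ⟨U, hU⟩ s) {δ : S.Fun} (hδ : δ * δ = 0)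
    (hδk : δ ∈ S.parity ⊤ k) (f : Hom S S) (hf : f.pullback ⊤ δ = δ) :
    f.comp (tangentHom hX v hv k hvk δ hδ hδk) = tangentHom hX v hv k hvk δ hδ hδk := by
  refine eq_tangentHom hX hv hvk hδ hδk _ (fun x => rfl) fun V hp s => ?_
  change f.pullback _ ((tangentHom hX v hv k hvk δ hδ hδk).pullback V s) = _
  rw [tangentHom_pullback hX hv hvk hδ hδk hp, map_add, map_smul, map_smul, map_one]
  have h1 := f.pullback_res (le_top : Opens.comap (ContinuousMap.const S.carrier p) V ≤ ⊤) δ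
  rw [hf] at h1
  exact congrArg _ (congrArg _ h1)

/-! ### Derivations from infinitesimal deformations of the identity -/

/-- Moving `s` past both odd variables applies `σ` twice, so no sign is left. The mixed terms
disappear because `x.fst` and `y.fst` have no `ε₁` part. -/
theorem _root_.SuperGeometry.OddExt.snd_snd_mul {A : Type*} [Ring A] [Algebra ℝ A]
    {σ : A →ₐ[ℝ] A} (hσ : ∀ a, σ (σ a) = a) {τ : OddExt σ →ₐ[ℝ] OddExt σ}
    (hτ : ∀ x, τ x = OddExt.invol σ x) (x y : OddExt τ) {s t : A} (hx : x.fst = OddExt.inl σ s)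
    (hy : y.fst = OddExt.inl σ t) : (x * y).snd.snd = x.snd.snd * t + s * y.snd.snd := by
  simp [hx, hy, hτ, hσ]

section Deformation

variable {X : SuperSpace.{u}}

theorem le_comap_of_eq_id {b : C(X.carrier, X.carrier)} (hb : ∀ x, b x = x)
    (V : Opens X.carrier) : V ≤ Opens.comap b V := fun x hx => by
  change b x ∈ V; rwa [hb x]

/-- The pullback along a morphism `X × ℝ^{0|1} → X` over the identity. -/
noncomputable def deform (f : Hom X.thick X) (hb : ∀ x, f.base x = x) (V : Opens X.carrier) :
    X.Sec V →ₐ[ℝ] OddExt (X.invol V) :=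
  (X.thick.res (le_comap_of_eq_id (b := f.base) hb V)).comp (f.pullback V)

theorem deform_res (f : Hom X.thick X) (hb : ∀ x, f.base x = x) {U V : Opens X.carrier}
    (h : V ≤ U) (s : X.Sec U) :
    deform f hb V (X.res h s) = OddExt.map (X.res h) (X.res_invol h) (deform f hb U s) := by
  change X.thick.res (le_comap_of_eq_id (b := f.base) hb V) (f.pullback V (X.res h s)) =
    X.thick.res h (X.thick.res (le_comap_of_eq_id (b := f.base) hb U) (f.pullback U s))
  exact (congrArg (X.thick.res _) (f.pullback_res h s)).trans
    ((X.thick.res_res _ _ _).trans (X.thick.res_res _ _ _).symm)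

theorem deform_parity (f : Hom X.thick X) (hb : ∀ x, f.base x = x) {V : Opens X.carrier}
    {i : ZMod 2} {s : X.Sec V} (hs : s ∈ X.parity V i) :
    (deform f hb V s).fst ∈ X.parity V i ∧ (deform f hb V s).snd ∈ X.parity V (i + 1) :=
  X.mem_eigenParity_oddExt.mp (X.thick.res_parity (le_comap_of_eq_id (b := f.base) hb V) i _
    (f.pullback_parity V i s hs))

/-- Writing the pullback as `s + ε D s`, multiplicativity gives `D(st) = D(s) t + σ(s) D(t)`, which
is the Leibniz rule of an odd derivation. -/
theorem deform_snd_mem (f : Hom X.thick X) (hb : ∀ x, f.base x = x)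
    (hf : ∀ (V : Opens X.carrier) (s : X.Sec V), (deform f hb V s).fst = s) :
    (fun V => OddExt.sndLin _ ∘ₗ (deform f hb V).toLinearMap : X.Operator) ∈ X.homVect 1 := by
  refine ⟨fun U V h s => ?_, fun U i s hs => ?_, fun U i s t hs => ?_⟩
  · exact congrArg OddExt.snd (deform_res f hb h s)
  · rw [add_comm]; exact (deform_parity f hb hs).2
  · change (deform f hb U (s * t)).snd = (deform f hb U s).snd * t +
      sgn (1 * i) • (s * (deform f hb U t).snd)
    rw [map_mul, OddExt.snd_mul, hf, hf, X.invol_of_mem hs, one_mul, smul_mul_assoc]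

/-- The pullback along a morphism `X × ℝ^{0|2} → X` over the identity. -/
noncomputable def deform₂ (f : Hom X.thick.thick X) (hb : ∀ x, f.base x = x)
    (V : Opens X.carrier) : X.Sec V →ₐ[ℝ] OddExt (X.thick.invol V) :=
  (X.thick.thick.res (le_comap_of_eq_id (b := f.base) hb V)).comp (f.pullback V)

theorem deform₂_res (f : Hom X.thick.thick X) (hb : ∀ x, f.base x = x) {U V : Opens X.carrier}
    (h : V ≤ U) (s : X.Sec U) : deform₂ f hb V (X.res h s) =
      OddExt.map (X.thick.res h) (X.thick.res_invol h) (deform₂ f hb U s) := by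
  change X.thick.thick.res (le_comap_of_eq_id (b := f.base) hb V) (f.pullback V (X.res h s)) =
    X.thick.thick.res h (X.thick.thick.res (le_comap_of_eq_id (b := f.base) hb U)
      (f.pullback U s))
  exact (congrArg (X.thick.thick.res _) (f.pullback_res h s)).trans
    ((X.thick.thick.res_res _ _ _).trans (X.thick.thick.res_res _ _ _).symm)

/-- The coefficient of `ε₂ ε₁`. -/
noncomputable def sndSnd (X : SuperSpace.{u}) (V : Opens X.carrier) :
    OddExt (X.thick.invol V) →ₗ[ℝ] X.Sec V :=
  (OddExt.sndLin (X.invol V) : OddExt (X.invol V) →ₗ[ℝ] X.Sec V) ∘ₗ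
    (OddExt.sndLin (X.thick.invol V) : OddExt (X.thick.invol V) →ₗ[ℝ] X.thick.Sec V)

/-- Two odd parameters replace an even infinitesimal one, since even dual numbers are not functions
on a supermanifold. The hypothesis says that modulo `ε₂` the morphism is the projection; so `ε₂ ε₁`
behaves as an even square-zero parameter. -/
theorem deform₂_snd_mem (f : Hom X.thick.thick X) (hb : ∀ x, f.base x = x)
    (hf : ∀ (V : Opens X.carrier) (s : X.Sec V),
      (deform₂ f hb V s).fst = OddExt.inl (X.invol V) s) :
    (fun V => sndSnd X V ∘ₗ (deform₂ f hb V).toLinearMap : X.Operator) ∈ X.homVect 0 := by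
  refine ⟨fun U V h s => ?_, fun U i s hs => ?_, fun U i s t hs => ?_⟩
  · exact congrArg (sndSnd X V) (deform₂_res f hb h s)
  · have h1 := (X.thick.mem_eigenParity_oddExt.mp
      (X.thick.thick.res_parity (le_comap_of_eq_id (b := f.base) hb U) i _
        (f.pullback_parity U i s hs))).2
    have h2 := (X.mem_eigenParity_oddExt.mp h1).2
    rw [add_assoc, show (1 : ZMod 2) + 1 = 0 from rfl, add_zero] at h2
    rw [zero_add]
    exact h2
  · have e : deform₂ f hb U (s * t) = deform₂ f hb U s * deform₂ f hb U t := map_mul _ _ _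
    rw [zero_mul, sgn_zero, one_smul]
    refine (congrArg (sndSnd X U) e).trans ?_
    exact OddExt.snd_snd_mul (σ := X.invol U) X.invol_invol (τ := X.thick.invol U)
      (X.thick_invol U) _ _ (hf U s) (hf U t)

end Deformation

end SuperSpace

namespace Supermanifold

/-- A morphism of supermanifolds as a morphism of superspaces. -/
abbrev toHom {S G : Supermanifold.{u}} (f : S ⟶ G) : SuperSpace.Hom S.obj G.obj := f.hom

/-- A morphism of superspaces between supermanifolds. -/
abbrev ofHom {S G : Supermanifold.{u}} (f : SuperSpace.Hom S.obj G.obj) : S ⟶ G :=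
  ObjectProperty.homMk f

theorem hom_ext {S G : Supermanifold.{u}} {f g : S ⟶ G} (h : toHom f = toHom g) : f = g :=
  ObjectProperty.hom_ext _ h

end Supermanifold

namespace SuperSpace

theorem thickMk_zero_mul_self (X : SuperSpace.{u}) {U : Opens X.carrier} (b : X.Sec U) :
    X.thickMk 0 b * X.thickMk 0 b = (0 : X.thick.Sec U) :=
  OddExt.ext (mul_zero _) (by change b * 0 + X.invol U 0 * b = 0; simp)

end SuperSpace

/-! ### Generalized points, left translations and invariant fields. -/

namespace LieSupergroup

open Supermanifold SuperSpace

variable {G : Supermanifold.{u}} (grp : LieSupergroup G)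

/-- The product of two generalized points. -/
def mulMor {S : Supermanifold.{u}} (a b : S ⟶ G) : S ⟶ G :=
  grp.isLimit.lift (BinaryFan.mk a b) ≫ grp.mul

theorem comp_mulMor {S T : Supermanifold.{u}} (f : T ⟶ S) (a b : S ⟶ G) :
    f ≫ grp.mulMor a b = grp.mulMor (f ≫ a) (f ≫ b) := by
  rw [mulMor, mulMor, ← Category.assoc]
  congr 1
  refine grp.isLimit.hom_ext fun j => ?_
  rw [Category.assoc, grp.isLimit.fac, grp.isLimit.fac]
  rcases j with ⟨_ | _⟩ <;> rfl

variable {n m : ℕ} (hG : G.obj.IsSupermanifold n m)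

/-- The constant morphism of supermanifolds. -/
noncomputable def const (S : Supermanifold.{u}) (p : G.obj.carrier) : S ⟶ G :=
  ofHom (constHom S.obj hG p)

theorem comp_const {S T : Supermanifold.{u}} (f : S ⟶ T) (p : G.obj.carrier) :
    f ≫ const hG T p = const hG S p :=
  hom_ext (comp_constHom hG p (toHom f))

theorem const_comp {S : Supermanifold.{u}} (p : G.obj.carrier) (f : G ⟶ G) :
    const hG S p ≫ f = const hG S ((toHom f).base p) :=
  hom_ext (constHom_comp S.obj hG hG p (toHom f))

theorem mulMor_assoc {S : Supermanifold.{u}} (a b c : S ⟶ G) :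
    grp.mulMor (grp.mulMor a b) c = grp.mulMor a (grp.mulMor b c) := grp.mul_assoc a b c

/-- Left translation. -/
noncomputable def leftMul (p : G.obj.carrier) : G ⟶ G := grp.mulMor (const hG G p) (𝟙 G)

theorem comp_leftMul {S : Supermanifold.{u}} (a : S ⟶ G) (p : G.obj.carrier) :
    a ≫ grp.leftMul hG p = grp.mulMor (const hG S p) a := by
  rw [leftMul, comp_mulMor, comp_const, Category.comp_id]

/-- `κ` freezes the factor `G` at `p` and leaves the odd parameters alone. On the frozen factor,
multiplying by `τ` is left translation of `τ` by `p`; this computes the invariant field at `p`. -/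
theorem mulMor_tangent_const {S : Supermanifold.{u}} (pr : S ⟶ G) (κ : S ⟶ S)
    {p : G.obj.carrier} (hκ : κ ≫ pr = const hG S p) (τ : S ⟶ G) (hτ : κ ≫ τ = τ) :
    κ ≫ grp.mulMor pr τ = τ ≫ grp.leftMul hG p := by
  rw [comp_mulMor, hκ, hτ, comp_leftMul]

/-- The unit as a point, for a nonempty Lie supergroup. -/
noncomputable def unit [Nonempty G.obj.carrier] : G.obj.carrier :=
  (toHom (grp.isTerminal.from G ≫ grp.one)).base (Classical.arbitrary _)

variable [Nonempty G.obj.carrier]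

/-- The terminal object need not be known: a constant morphism `S → G` followed by `G → point` is
the only morphism `S → point`. -/
theorem from_comp_one (S : Supermanifold.{u}) :
    grp.isTerminal.from S ≫ grp.one = const hG S grp.unit := by
  rw [unit, ← const_comp, ← Category.assoc]
  congr 1
  exact grp.isTerminal.hom_ext _ _

theorem mulMor_unit {S : Supermanifold.{u}} (a : S ⟶ G) :
    grp.mulMor a (const hG S grp.unit) = a := by
  rw [← from_comp_one]; exact grp.mul_one a

theorem unit_mulMor {S : Supermanifold.{u}} (a : S ⟶ G) :
    grp.mulMor (const hG S grp.unit) a = a := by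
  rw [← from_comp_one]; exact grp.one_mul a

/-- A constant morphism determines its point, so `p · e = p` for constant generalized points yields
the equality of points. -/
theorem leftMul_base_unit (p : G.obj.carrier) :
    (toHom (grp.leftMul hG p)).base grp.unit = p := by
  have h : const hG G ((toHom (grp.leftMul hG p)).base grp.unit) = const hG G p := by
    rw [← const_comp, comp_leftMul, mulMor_unit]
  exact congrArg (fun f : G ⟶ G => (toHom f).base (Classical.arbitrary _)) h

theorem leftMul_comp_leftMul_inv (p : G.obj.carrier) :
    grp.leftMul hG p ≫ grp.leftMul hG ((toHom grp.inv).base p) = 𝟙 G := by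
  rw [comp_leftMul, leftMul, ← mulMor_assoc, ← const_comp]
  have := grp.inv_mul (const hG G p)
  rw [from_comp_one grp hG] at this
  have h2 : grp.mulMor (const hG G p ≫ grp.inv) (const hG G p) = const hG G grp.unit := this
  rw [h2, unit_mulMor]

/-! ### Left-invariant vector fields -/

/-- `G × ℝ^{0|1}`. -/
noncomputable abbrev thick₁ : Supermanifold.{u} := ⟨G.obj.thick, n, m + 1, hG.thick⟩

/-- `G × ℝ^{0|2}`. -/
noncomputable abbrev thick₂ : Supermanifold.{u} := ⟨G.obj.thick.thick, n, m + 2, hG.thick.thick⟩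

/-- The tangent vector at `p` obtained by left translation. -/
noncomputable def translate (v : G.obj.PointOp grp.unit) (p : G.obj.carrier) :
    G.obj.PointOp ((toHom (grp.leftMul hG p)).base grp.unit) :=
  pushforward (toHom (grp.leftMul hG p)) v

/-- The field is the derivative at `ε = 0` of right multiplication by the infinitesimal point `τ`
with velocity `v` at `e`. The unit law makes this a deformation of the identity. Membership `hp'` is
a separate hypothesis because `L_p(e) = p` is not definitional. -/
theorem exists_odd_field {v : G.obj.PointOp grp.unit} (hv : v ∈ G.obj.tangentSpace grp.unit)
    (hvk : ∀ (U : Opens G.obj.carrier) (hU : grp.unit ∈ U)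
      (s : G.obj.Sec U), v ⟨U, hU⟩ (G.obj.invol U s) = sgn 1 * v ⟨U, hU⟩ s) :
    ∃ D ∈ G.obj.homVect 1, ∀ (p : G.obj.carrier) (V : Opens G.obj.carrier) (_ : p ∈ V)
      (hp' : (toHom (grp.leftMul hG p)).base grp.unit ∈ V) (s : G.obj.Sec V),
      G.obj.valueAt p (D V s) = grp.translate hG v p ⟨V, hp'⟩ s := by
  set X := G.obj
  let δ : X.thick.Fun := X.thickMk 0 1
  have hδ : δ * δ = 0 := X.thickMk_zero_mul_self _
  have hδk : δ ∈ X.thick.parity ⊤ 1 := X.mem_eigenParity_oddExt.mpr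
    ⟨zero_mem _, by rw [X.mem_parity_iff]; simp [show (1 : ZMod 2) + 1 = 0 from rfl, δ]⟩
  let S : Supermanifold.{u} := thick₁ hG
  let τ : S ⟶ G := ofHom (tangentHom hG v hv 1 hvk δ hδ hδk)
  let pr : S ⟶ G := ofHom X.thickProj
  let ι : G ⟶ S := ofHom X.thickIncl
  let μ : S ⟶ G := grp.mulMor pr τ
  have hι : ι ≫ μ = 𝟙 G := by
    have h1 : ι ≫ τ = const hG G grp.unit :=
      hom_ext (comp_tangentHom_of_eq_zero hG hv hvk hδ hδk X.thickIncl rfl)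
    rw [comp_mulMor, h1, mulMor_unit]
    rfl
  have hι' : X.thickIncl.comp (toHom μ) = SuperSpace.Hom.id X := congrArg toHom hι
  have hb : ∀ x : X.carrier, (toHom μ).base x = x := fun x =>
    congrArg (fun f : SuperSpace.Hom X X => f.base x) hι'
  refine ⟨_, deform_snd_mem (toHom μ) hb fun V s => ?_, fun p V hp hp' s => ?_⟩
  · have := SuperSpace.Hom.res_pullback_congr hι' (V := V) (W := V)
      (le_comap_of_eq_id (b := (toHom μ).base) hb V) le_rfl s
    exact this.trans (X.res_self _ _)
  -- The endomorphism `(x, ε) ↦ (p, ε)` of `G × ℝ^{0|1}`.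
  · let κ : S ⟶ S := ofHom (constHom X hG p).thick
    have hκ : κ ≫ pr = const hG S p := hom_ext (eq_constHom hG _ (fun _ => rfl)
      fun U hU t => OddExt.ext (constHom_pullback X hG hU t)
        ((map_zero _).trans (smul_zero _).symm))
    have hτ : κ ≫ τ = τ := hom_ext (comp_tangentHom_of_eq hG hv hvk hδ hδk
      (constHom X hG p).thick (OddExt.ext (map_zero _) (map_one _)))
    have key := congrArg toHom (grp.mulMor_tangent_const hG pr κ hκ τ hτ)
    have hpμ : p ∈ Opens.comap (toHom μ).base V := by
      change (toHom μ).base p ∈ V; rwa [hb]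
    -- Both morphisms have constant base map with value in `V`, so the pullbacks can be compared as
    -- global sections.
    have h := SuperSpace.Hom.res_pullback_congr key (V := V) (W := ⊤) (fun _ _ => hpμ)
      (fun _ _ => hp') s
    -- Coefficients of `ε`: on the left the value of `D s` at `p`, on the right the translated
    -- vector applied to `s`, each times the constant 1.
    have h2 := congrArg (OddExt.snd (σ := X.invol ⊤)) h
    have e1 := (congrArg (X.res (show ⊤ ≤ Opens.comap (constHom X hG p).base
      (Opens.comap (toHom μ).base V) from fun _ _ => hpμ)) (constHom_pullback X hG hpμ
        (OddExt.snd (σ := X.invol _) ((toHom μ).pullback V s)))).trans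
          ((map_smul _ _ _).trans (congrArg _ (map_one _)))
    have e2 := congrArg (fun t => OddExt.snd (σ := X.invol ⊤) (X.thick.res (show ⊤ ≤
      Opens.comap (toHom (τ ≫ grp.leftMul hG p)).base V from fun _ _ => hp') t))
      (tangentHom_pullback hG hv hvk hδ hδk
        (V := Opens.comap (toHom (grp.leftMul hG p)).base V) hp'
        ((toHom (grp.leftMul hG p)).pullback V s))
    have e3 : OddExt.snd (σ := X.invol ⊤) (X.thick.res (show ⊤ ≤
      Opens.comap (toHom (τ ≫ grp.leftMul hG p)).base V from fun _ _ => hp')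
        (X.valueAt grp.unit ((toHom (grp.leftMul hG p)).pullback V s) • 1 +
        grp.translate hG v p ⟨V, hp'⟩ s • X.thick.res le_top δ)) =
        grp.translate hG v p ⟨V, hp'⟩ s • (1 : X.Sec ⊤) := by
      rw [map_add, map_smul, map_smul, map_one, X.thick.res_res]
      refine (OddExt.snd_add (σ := X.invol ⊤) _ _).trans ?_
      refine (congrArg₂ (· + ·) (smul_zero _) (congrArg _ (map_one _))).trans (zero_add _)
    have e4 := e1.symm.trans (h2.trans (e2.trans e3))
    have e5 := congrArg (X.valueAt p) e4
    rw [← hG.evalAt_apply (Opens.mem_top p), ← hG.evalAt_apply (Opens.mem_top p), map_smul,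
      map_smul, map_one, smul_eq_mul, smul_eq_mul, _root_.mul_one, _root_.mul_one] at e5
    exact (hG.valueAt_res _ hp _).trans e5

/-- The argument of the odd case, with `δ = ε₂ ε₁` as even parameter. Setting `ε₂ = 0` kills `δ` and
leaves the projection from `G × ℝ^{0|1}`, as `deform₂_snd_mem` requires. -/
theorem exists_even_field {v : G.obj.PointOp grp.unit} (hv : v ∈ G.obj.tangentSpace grp.unit)
    (hvk : ∀ (U : Opens G.obj.carrier) (hU : grp.unit ∈ U)
      (s : G.obj.Sec U), v ⟨U, hU⟩ (G.obj.invol U s) = sgn 0 * v ⟨U, hU⟩ s) :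
    ∃ D ∈ G.obj.homVect 0, ∀ (p : G.obj.carrier) (V : Opens G.obj.carrier) (_ : p ∈ V)
      (hp' : (toHom (grp.leftMul hG p)).base grp.unit ∈ V) (s : G.obj.Sec V),
      G.obj.valueAt p (D V s) = grp.translate hG v p ⟨V, hp'⟩ s := by
  set X := G.obj
  let δ : X.thick.thick.Fun := X.thick.thickMk 0 (X.thickMk 0 1)
  have hδ : δ * δ = 0 := X.thick.thickMk_zero_mul_self _
  have hδk : δ ∈ X.thick.thick.parity ⊤ 0 := X.thick.mem_eigenParity_oddExt.mpr
    ⟨zero_mem _, X.mem_eigenParity_oddExt.mpr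
    ⟨zero_mem _, by
      rw [X.mem_parity_iff]; simp [show (1 : ZMod 2) + 1 = 0 from rfl, δ]⟩⟩
  let S : Supermanifold.{u} := thick₂ hG
  let S₁ : Supermanifold.{u} := thick₁ hG
  let τ : S ⟶ G := ofHom (tangentHom hG v hv 0 hvk δ hδ hδk)
  let pr₁ : S₁ ⟶ G := ofHom X.thickProj
  let pr₂ : S ⟶ S₁ := ofHom X.thick.thickProj
  let ι : S₁ ⟶ S := ofHom X.thick.thickIncl
  let μ : S ⟶ G := grp.mulMor (pr₂ ≫ pr₁) τ
  have hι : ι ≫ μ = pr₁ := by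
    have h1 : ι ≫ τ = const hG S₁ grp.unit :=
      hom_ext (comp_tangentHom_of_eq_zero hG hv hvk hδ hδk X.thick.thickIncl rfl)
    rw [comp_mulMor, h1, mulMor_unit]
    rfl
  have hι' : X.thick.thickIncl.comp (toHom μ) = X.thickProj := congrArg toHom hι
  have hb : ∀ x : X.carrier, (toHom μ).base x = x := fun x =>
    congrArg (fun f : SuperSpace.Hom X.thick X => f.base x) hι'
  refine ⟨_, deform₂_snd_mem (toHom μ) hb fun V s => ?_, fun p V hp hp' s => ?_⟩
  · have := SuperSpace.Hom.res_pullback_congr hι' (V := V) (W := V)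
      (le_comap_of_eq_id (b := (toHom μ).base) hb V) le_rfl s
    exact this.trans (X.thick.res_self _ _)
  · let κ : S ⟶ S := ofHom (constHom X hG p).thick.thick
    have hκ : κ ≫ pr₂ ≫ pr₁ = const hG S p := hom_ext (eq_constHom hG _ (fun _ => rfl)
      fun U hU t => OddExt.ext (OddExt.ext (constHom_pullback X hG hU t)
        ((map_zero _).trans (smul_zero _).symm)) ((map_zero _).trans (smul_zero _).symm))
    have hτ : κ ≫ τ = τ := hom_ext (comp_tangentHom_of_eq hG hv hvk hδ hδk
      (constHom X hG p).thick.thick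
      (OddExt.ext (map_zero _) (OddExt.ext (map_zero _) (map_one _))))
    have key := congrArg toHom (grp.mulMor_tangent_const hG (pr₂ ≫ pr₁) κ hκ τ hτ)
    have hpμ : p ∈ Opens.comap (toHom μ).base V := by
      change (toHom μ).base p ∈ V; rwa [hb]
    have h := SuperSpace.Hom.res_pullback_congr key (V := V) (W := ⊤) (fun _ _ => hpμ)
      (fun _ _ => hp') s
    have h2 := congrArg (sndSnd X ⊤) h
    have e1 := (congrArg (X.res (show ⊤ ≤ Opens.comap (constHom X hG p).base
      (Opens.comap (toHom μ).base V) from fun _ _ => hpμ)) (constHom_pullback X hG hpμ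
        (sndSnd X _ ((toHom μ).pullback V s)))).trans
          ((map_smul _ _ _).trans (congrArg _ (map_one _)))
    have e2 := congrArg (fun t => sndSnd X ⊤ (X.thick.thick.res (show ⊤ ≤
      Opens.comap (toHom (τ ≫ grp.leftMul hG p)).base V from fun _ _ => hp') t))
      (tangentHom_pullback hG hv hvk hδ hδk
        (V := Opens.comap (toHom (grp.leftMul hG p)).base V) hp'
        ((toHom (grp.leftMul hG p)).pullback V s))
    have e3 : sndSnd X ⊤ (X.thick.thick.res (show ⊤ ≤
      Opens.comap (toHom (τ ≫ grp.leftMul hG p)).base V from fun _ _ => hp')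
        (X.valueAt grp.unit ((toHom (grp.leftMul hG p)).pullback V s) • 1 +
        grp.translate hG v p ⟨V, hp'⟩ s • X.thick.thick.res le_top δ)) =
        grp.translate hG v p ⟨V, hp'⟩ s • (1 : X.Sec ⊤) := by
      rw [map_add, map_smul, map_smul, map_one, X.thick.thick.res_res]
      refine ((sndSnd X ⊤).map_add _ _).trans ?_
      have k1 : sndSnd X ⊤ (X.valueAt grp.unit ((toHom (grp.leftMul hG p)).pullback V s) •
          (1 : X.thick.thick.Sec ⊤)) = 0 :=
        by
        refine ((sndSnd X ⊤).map_smul _ _).trans ?_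
        exact smul_zero (A := X.Sec ⊤) (X.valueAt grp.unit ((toHom (grp.leftMul hG p)).pullback V s))
      have k2 : sndSnd X ⊤ (grp.translate hG v p ⟨V, hp'⟩ s •
          X.thick.thick.res (le_refl ⊤) δ) = grp.translate hG v p ⟨V, hp'⟩ s • (1 : X.Sec ⊤) :=
        ((sndSnd X ⊤).map_smul _ _).trans
          (congrArg (fun z => grp.translate hG v p ⟨V, hp'⟩ s • z) (map_one (X.res le_rfl)))
      exact (congrArg₂ (· + ·) k1 k2).trans (zero_add _)
    have e4 := e1.symm.trans (h2.trans (e2.trans e3))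
    have e5 := congrArg (X.valueAt p) e4
    rw [← hG.evalAt_apply (Opens.mem_top p), ← hG.evalAt_apply (Opens.mem_top p), map_smul,
      map_smul, map_one, smul_eq_mul, smul_eq_mul, _root_.mul_one, _root_.mul_one] at e5
    exact (hG.valueAt_res _ hp _).trans e5

/-- Left translation is injective on tangent vectors. -/
theorem eq_zero_of_translate_eq_zero {v : G.obj.PointOp grp.unit}
    (hv : v ∈ G.obj.tangentSpace grp.unit) (p : G.obj.carrier)
    (h : grp.translate hG v p = 0) : v = 0 := by
  have key : (toHom (grp.leftMul hG p)).comp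
      (toHom (grp.leftMul hG ((toHom grp.inv).base p))) = SuperSpace.Hom.id G.obj :=
    congrArg toHom (grp.leftMul_comp_leftMul_inv hG p)
  funext ⟨U, hU⟩
  ext s
  have hb : (toHom (grp.leftMul hG ((toHom grp.inv).base p))).base
      ((toHom (grp.leftMul hG p)).base grp.unit) = grp.unit :=
    congrArg (fun f : SuperSpace.Hom G.obj G.obj => f.base grp.unit) key
  have hU' : grp.unit ∈ Opens.comap (toHom (grp.leftMul hG p)).base
      (Opens.comap (toHom (grp.leftMul hG ((toHom grp.inv).base p))).base U) := by
    change (toHom (grp.leftMul hG ((toHom grp.inv).base p))).base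
      ((toHom (grp.leftMul hG p)).base grp.unit) ∈ U
    rwa [hb]
  have h1 := LinearMap.congr_fun (congrFun h ⟨Opens.comap
    (toHom (grp.leftMul hG ((toHom grp.inv).base p))).base U, hU'⟩)
    ((toHom (grp.leftMul hG ((toHom grp.inv).base p))).pullback U s)
  -- The vector is translated back by the inverse of `p`. The composite translation is the identity,
  -- but its pullback lives over another expression for `U`; the two are compared on the
  -- intersection, a neighbourhood of the unit.
  have h2 := SuperSpace.Hom.res_pullback_congr key (V := U) (W := U ⊓ Opens.comap
    (toHom (grp.leftMul hG p)).base
      (Opens.comap (toHom (grp.leftMul hG ((toHom grp.inv).base p))).base U))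
      inf_le_right inf_le_left s
  have h3 := congrArg (v ⟨U ⊓ Opens.comap (toHom (grp.leftMul hG p)).base
    (Opens.comap (toHom (grp.leftMul hG ((toHom grp.inv).base p))).base U), ⟨hU, hU'⟩⟩) h2
  have h4 := (hv.1 _ _ _ _ _).symm.trans (h3.trans (hv.1 _ _ _ _ _))
  exact h4.symm.trans h1

/-- A family of vector fields which is a basis of every tangent space. -/
theorem exists_frame (grp : LieSupergroup G) (hG : G.obj.IsSupermanifold n m) : ∃ E : Fin n ⊕ Fin m → G.obj.Operator,
    (∀ a, E a ∈ G.obj.homVect (idxParity a)) ∧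
    ∀ (p : G.obj.carrier) (c : G.obj.Chart n m) (_ : p ∈ c.coord.source),
      IsUnit (Matrix.of fun a b => G.obj.valueAt p (E a _ (c.coordSec b))) := by
  obtain ⟨c₀, hc₀⟩ := hG.exists_chart grp.unit
  have hmem : ∀ a, c₀.basisVec hc₀ a ∈ G.obj.tangentSpace grp.unit :=
    fun a => c₀.tangentVec_mem hc₀ _ _
  have hex : ∀ a, ∃ D ∈ G.obj.homVect (idxParity a),
      ∀ (p : G.obj.carrier) (V : Opens G.obj.carrier) (_ : p ∈ V)
      (hp' : (toHom (grp.leftMul hG p)).base grp.unit ∈ V) (s : G.obj.Sec V),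
      G.obj.valueAt p (D V s) = grp.translate hG (c₀.basisVec hc₀ a) p ⟨V, hp'⟩ s := by
    rintro (i | j)
    · exact grp.exists_even_field hG (hmem _) fun U hU s => c₀.basisVec_invol hG hc₀ _ hU s
    · exact grp.exists_odd_field hG (hmem _) fun U hU s => c₀.basisVec_invol hG hc₀ _ hU s
  choose E hE hval using hex
  refine ⟨E, hE, fun p c hp => ?_⟩
  rw [← Matrix.vecMul_injective_iff_isUnit]
  -- A row relation `t` says that the translate to `p` of `∑ t a • v a` kills all coordinates there.
  -- So this translate is zero, hence so is the vector at the unit, and `t = 0` because the `v a`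
  -- are dual to the coordinates of `c₀`.
  refine (injective_iff_map_eq_zero (Matrix.vecMulLinear _).toAddMonoidHom).mpr fun t ht => ?_
  have hpb := grp.leftMul_base_unit hG p
  have hp' : (toHom (grp.leftMul hG p)).base grp.unit ∈ c.coord.source := by rwa [hpb]
  have hsum : ∑ a, t a • c₀.basisVec hc₀ a ∈ G.obj.tangentSpace grp.unit :=
    sum_mem fun a _ => Submodule.smul_mem _ _ (hmem a)
  have happ : ∀ (U : {U : Opens G.obj.carrier // grp.unit ∈ U}) (s : G.obj.Sec U.1),
      (∑ a, t a • c₀.basisVec hc₀ a) U s = ∑ a, t a * c₀.basisVec hc₀ a U s := by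
    intro U s
    simp [Finset.sum_apply]
  have h0 : ∑ a, t a • c₀.basisVec hc₀ a = 0 := by
    refine grp.eq_zero_of_translate_eq_zero hG hsum p ?_
    refine c.tangent_eq_zero hp' (pushforward_mem hG hG _ hsum) fun b => ?_
    have hb := congrFun ht b
    refine (happ _ _).trans (Eq.trans ?_ hb)
    refine Finset.sum_congr rfl fun a _ => ?_
    exact congrArg _ (hval a p _ (c.mem_piece_full hp) (c.mem_piece_full hp') _).symm
  funext a
  have h1 := happ ⟨_, c₀.mem_piece_full hc₀⟩ (c₀.coordSec a)
  rw [h0] at h1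
  simpa [c₀.basisVec_coordSec hc₀] using h1.symm

end LieSupergroup

namespace SuperSpace

variable {X : SuperSpace.{u}} {n m : ℕ}

/-! ### Frames -/

/-- A derivation on the domain of a chart which kills the coordinates vanishes. -/
theorem Chart.derivation_eq_zero (c : X.Chart n m) (q : ZMod 2)
    (T : ∀ V : Opens X.carrier, V ≤ c.piece c.full → X.Sec V →ₗ[ℝ] X.Sec V)
    (hres : ∀ (V V' : Opens X.carrier) (hV : V ≤ c.piece c.full) (h : V' ≤ V) (s : X.Sec V),
      T V' (h.trans hV) (X.res h s) = X.res h (T V hV s))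
    (hmul : ∀ (V : Opens X.carrier) (hV : V ≤ c.piece c.full) (i : ZMod 2) (s t : X.Sec V),
      s ∈ X.parity V i → T V hV (s * t) = T V hV s * t + sgn (q * i) • (s * T V hV t))
    (hcoord : ∀ a, T _ le_rfl (c.coordSec a) = 0)
    (V : Opens X.carrier) (hV : V ≤ c.piece c.full) (s : X.Sec V) : T V hV s = 0 := by
  have key := sheafDerivation_eq_zero (m := m) (W := c.full) q
    (fun W' hW' => (c.iso W' hW').toLinearMap ∘ₗ T (c.piece W') (c.piece_mono hW') ∘ₗ
      (c.iso W' hW').symm.toLinearMap)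
    (fun W' W'' hW' h s => by
      change c.iso W'' _ (T _ _ ((c.iso W'' _).symm _)) = modelRes n m h (c.iso W' _ (T _ _ _))
      rw [← c.res_iso_symm hW' (subset_trans h hW') h, ← c.iso_res W' W'' hW' (subset_trans h hW')]
      exact congrArg _ (hres _ _ _ (c.piece_mono h) _))
    (fun W' hW' i s t hs => by
      change c.iso W' _ (T _ _ ((c.iso W' _).symm _)) = c.iso W' _ (T _ _ ((c.iso W' _).symm s)) * _
        + _ • (_ * c.iso W' _ (T _ _ ((c.iso W' _).symm t)))
      have hs' : (c.iso W' hW').symm s ∈ X.parity _ i := by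
        rw [← c.iso_parity W' hW', AlgEquiv.apply_symm_apply]; exact hs
      rw [map_mul]
      refine (congrArg _ (hmul _ _ i _ _ hs')).trans ?_
      rw [map_add, map_smul, map_mul, map_mul, AlgEquiv.apply_symm_apply,
        AlgEquiv.apply_symm_apply])
    (fun W' hW' a => by
      change c.iso W' _ (T _ _ ((c.iso W' _).symm _)) = 0
      rw [← c.iso_res_coordSec hW' (c.piece_mono hW') a, AlgEquiv.symm_apply_apply]
      refine (congrArg _ ((hres _ _ le_rfl (c.piece_mono hW') _).trans
        (congrArg _ (hcoord a)))).trans ?_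
      rw [map_zero, map_zero])
  -- The model statement concerns sections over `c.piece W'`; a general `V` is reduced to `c.piece
  -- (c.img V)`.
  refine X.eq_of_locally_eq _ _ fun x hx => ⟨c.piece (c.img V), ⟨(hV hx).1, c.mem_img (hV hx).1 hx⟩,
    c.piece_img_le V, ?_⟩
  have h1 := key (c.img V) (c.img_subset V)
    (c.iso _ (c.img_subset V) (X.res (c.piece_img_le V) s))
  change c.iso _ _ (T _ _ ((c.iso _ _).symm _)) = 0 at h1
  rw [AlgEquiv.symm_apply_apply] at h1
  have h2 := (map_eq_zero_iff _ (c.iso _ (c.img_subset V)).injective).mp h1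
  rw [map_zero]
  exact (hres _ _ hV _ _).symm.trans h2

/-- A homogeneous frame: vector fields which form a basis of every tangent space. -/
structure IsFrame (n m : ℕ) (E : Fin n ⊕ Fin m → X.Operator) : Prop where
  mem : ∀ a, E a ∈ X.homVect (idxParity a)
  isUnit : ∀ (p : X.carrier) (c : X.Chart n m) (_ : p ∈ c.coord.source),
    IsUnit (Matrix.of fun a b => X.valueAt p (E a _ (c.coordSec b)))

namespace IsFrame

variable {E : Fin n ⊕ Fin m → X.Operator}

/-- Frames are defined pointwise; `isUnit_matrix_model` turns this into invertibility over
superfunctions. -/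
theorem isUnit_matrix (hE : IsFrame n m E) (c : X.Chart n m) :
    IsUnit (Matrix.of fun a b => E a _ (c.coordSec b)) := by
  let e := (c.iso c.full c.full_subset).toRingEquiv
  refine (MulEquiv.isUnit_map (RingEquiv.mapMatrix (m := Fin n ⊕ Fin m) e)).mp ?_
  refine isUnit_matrix_model _ fun x => ?_
  have hx : c.coord.symm x.1 ∈ c.coord.source := c.coord.map_target x.2
  convert hE.isUnit _ c hx using 1
  ext a b
  have hx' : c.coord (c.coord.symm x.1) ∈ c.full := by
    rw [c.coord.right_inv x.2]; exact x.2
  refine Eq.trans ?_ (c.valueAt_eq hx c.full_subset hx' le_rfl _).symm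
  rw [X.res_self]
  have : x = ⟨c.coord (c.coord.symm x.1), hx'⟩ := Subtype.ext (c.coord.right_inv x.2).symm
  exact congrArg (fun y => modelEval n m y (c.iso _ c.full_subset (E a _ (c.coordSec b)))) this

theorem isUnit_matrix_res (hE : IsFrame n m E) (c : X.Chart n m) {V : Opens X.carrier}
    (hV : V ≤ c.piece c.full) :
    IsUnit (Matrix.of fun a b => E a V (X.res hV (c.coordSec b))) := by
  convert (hE.isUnit_matrix c).map (X.res hV).toRingHom.mapMatrix using 1
  ext a b
  exact (hE.mem a).1 _ _ _ _

/-- Stated over every open subset of the chart domain, as gluing needs uniqueness of components on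
overlaps. -/
theorem eq_of_sum_eq (hE : IsFrame n m E) (c : X.Chart n m) {V : Opens X.carrier}
    (hV : V ≤ c.piece c.full) {f g : Fin n ⊕ Fin m → X.Sec V}
    (h : ∀ b, ∑ a, f a * E a V (X.res hV (c.coordSec b)) =
      ∑ a, g a * E a V (X.res hV (c.coordSec b))) : f = g := by
  obtain ⟨u, hu⟩ := hE.isUnit_matrix_res c hV
  have h1 : Matrix.vecMul f u.1 = Matrix.vecMul g u.1 := by
    rw [hu]; funext b; exact h b
  have h2 := congrArg (fun w => Matrix.vecMul w u⁻¹.1) h1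
  simpa [Matrix.vecMul_vecMul] using h2

/-- Local components of a homogeneous vector field. -/
theorem exists_coef (hE : IsFrame n m E) (c : X.Chart n m) {q : ZMod 2} {D : X.Operator}
    (hD : D ∈ X.homVect q) : ∃ f : Fin n ⊕ Fin m → X.Sec (c.piece c.full),
      (∀ a, f a ∈ X.parity _ (q + idxParity a)) ∧
      ∀ (V : Opens X.carrier) (hV : V ≤ c.piece c.full) (s : X.Sec V),
        D V s = ∑ a, X.res hV (f a) * E a V s := by
  obtain ⟨u, hu⟩ := hE.isUnit_matrix c
  let d : Fin n ⊕ Fin m → X.Sec (c.piece c.full) := fun b => D _ (c.coordSec b)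
  -- The only candidate: evaluating `D = ∑ f a • E a` on the coordinates gives a linear system with
  -- the unknowns as a row vector on the left.
  let f := Matrix.vecMul d u⁻¹.1
  have hf : ∀ b, ∑ a, f a * E a _ (c.coordSec b) = d b := by
    intro b
    have : Matrix.vecMul f u.1 = d := by simp [f, Matrix.vecMul_vecMul]
    rw [hu] at this
    exact congrFun this b
  have hA : ∀ a b, E a _ (c.coordSec b) ∈ X.parity _ (idxParity a + idxParity b) :=
    fun a b => (hE.mem a).2.1 _ _ _ (c.coordSec_mem b)
  have hd : ∀ b, d b ∈ X.parity _ (q + idxParity b) := fun b => hD.2.1 _ _ _ (c.coordSec_mem b)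
  have hpar : ∀ a, f a ∈ X.parity _ (q + idxParity a) := by
    -- Applying `σ` to the system, whose entries are homogeneous, shows that the sign-twisted family
    -- solves it too; uniqueness then forces the parity of each `f a`.
    have h1 : (fun a => sgn (q + idxParity a) • X.invol _ (f a)) = f := by
      refine hE.eq_of_sum_eq c le_rfl fun b => ?_
      simp only [X.res_self]
      rw [hf b]
      have h2 := congrArg (fun z => sgn (q + idxParity b) • X.invol _ z) (hf b)
      simp only [map_sum, map_mul, X.invol_of_mem (hA _ b), X.invol_of_mem (hd b), smul_smul,
        sgn_mul_self, one_smul, Finset.smul_sum, mul_smul_comm] at h2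
      rw [← h2]
      refine Finset.sum_congr rfl fun a _ => ?_
      rw [smul_mul_assoc, ← sgn_add]
      congr 2
      rw [show q + idxParity b + (idxParity a + idxParity b) =
        q + idxParity a + (idxParity b + idxParity b) by ring, CharTwo.add_self_eq_zero, add_zero]
    intro a
    rw [X.mem_parity_iff]
    have h2 := congrArg (fun z => sgn (q + idxParity a) • z) (congrFun h1 a)
    simpa only [smul_smul, sgn_mul_self, one_smul] using h2
  refine ⟨f, hpar, fun V hV s => sub_eq_zero.mp ?_⟩
  have hEm : ∀ a, (∀ (V V' : Opens X.carrier) (h : V' ≤ V) (s : X.Sec V),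
      E a V' (X.res h s) = X.res h (E a V s)) := fun a V V' h s => (hE.mem a).1 V V' h s
  -- By the parities of the `f a`, the difference `D - ∑ f a • E a` is a derivation of parity `q`;
  -- it kills the coordinates by the choice of `f`.
  refine c.derivation_eq_zero q
    (fun V hV => D V - ∑ a, LinearMap.mulLeft ℝ (X.res hV (f a)) ∘ₗ E a V) ?_ ?_ ?_ V hV s |>.symm.trans ?_ |>.symm
  · intro V V' hV h s
    simp [LinearMap.sum_apply, hD.1 V V' h, hEm, X.res_res]
  · intro V hV i s t hs
    have h3 : ∀ a, X.res hV (f a) * E a V (s * t) = X.res hV (f a) * E a V s * t +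
        sgn (q * i) • (s * (X.res hV (f a) * E a V t)) := by
      intro a
      have hfs : X.res hV (f a) * s = sgn ((q + idxParity a) * i) • (s * X.res hV (f a)) :=
        X.supercomm V _ i _ s (X.res_parity hV _ _ (hpar a)) hs
      rw [(hE.mem a).2.2 V i s t hs, mul_add, mul_smul_comm, ← mul_assoc, ← mul_assoc, hfs,
        smul_mul_assoc, smul_smul, ← sgn_add, mul_assoc s]
      congr 3
      rw [show idxParity a * i + (q + idxParity a) * i =
        q * i + (idxParity a * i + idxParity a * i) by ring, CharTwo.add_self_eq_zero, add_zero]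
    simp only [LinearMap.sub_apply, LinearMap.sum_apply, LinearMap.comp_apply,
      LinearMap.mulLeft_apply, hD.2.2 V i s t hs, h3, Finset.sum_add_distrib, sub_mul, mul_sub,
      Finset.sum_mul, Finset.mul_sum, smul_sub, Finset.smul_sum]
    abel
  · intro b
    simp only [LinearMap.sub_apply, LinearMap.sum_apply, LinearMap.comp_apply,
      LinearMap.mulLeft_apply, X.res_self, hf b]
    exact sub_self _
  · simp [LinearMap.sum_apply]

theorem eq_of_sum_funMul_eq (hX : X.IsSupermanifold n m) (hE : IsFrame n m E)
    {f g : Fin n ⊕ Fin m → X.Fun}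
    (h : ∑ a, X.funMul (f a) (E a) = ∑ a, X.funMul (g a) (E a)) : f = g := by
  funext a
  refine X.eq_of_locally_eq _ _ fun x _ => ?_
  obtain ⟨c, hc⟩ := hX.exists_chart x
  refine ⟨c.piece c.full, c.mem_piece_full hc, le_top, ?_⟩
  refine congrFun (hE.eq_of_sum_eq c le_rfl (f := fun a => X.res le_top (f a))
    (g := fun a => X.res le_top (g a)) fun b => ?_) a
  have h1 := LinearMap.congr_fun (congrFun h (c.piece c.full)) (c.coordSec b)
  simpa [Finset.sum_apply, LinearMap.sum_apply, funMul_apply, X.res_self] using h1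

/-- Components of a homogeneous vector field. -/
theorem exists_eq_sum (hX : X.IsSupermanifold n m) (hE : IsFrame n m E) {q : ZMod 2}
    {D : X.Operator} (hD : D ∈ X.homVect q) :
    ∃ f : Fin n ⊕ Fin m → X.Fun, (∀ a, f a ∈ X.parity _ (q + idxParity a)) ∧
      D = ∑ a, X.funMul (f a) (E a) := by
  choose c hc using hX.exists_chart
  choose f hf hDf using fun x => hE.exists_coef (c x) hD
  have hglue : ∀ a, ∃ g : X.Fun, ∀ x, X.res le_top g = f x a := by
    intro a
    refine X.exists_glue ⊤ (fun x => (c x).piece (c x).full) (fun _ => le_top)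
      (fun x _ => ⟨x, (c x).mem_piece_full (hc x)⟩) (fun x => f x a) fun x y => ?_
    -- On the overlap both families express `D` applied to the coordinates of the single chart `c
    -- x`, so they agree.
    refine congrFun (hE.eq_of_sum_eq (c x) inf_le_left
      (f := fun a => X.res inf_le_left (f x a)) (g := fun a => X.res inf_le_right (f y a))
      fun b => ?_) a
    rw [← hDf x, ← hDf y]
  choose g hg using hglue
  refine ⟨g, fun a => ?_, ?_⟩
  · rw [X.mem_parity_iff]
    refine X.eq_of_locally_eq _ _ fun x _ => ⟨_, (c x).mem_piece_full (hc x), le_top, ?_⟩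
    rw [X.res_invol, map_smul, hg]
    exact X.mem_parity_iff.mp (hf x a)
  · funext V
    ext s
    refine X.eq_of_locally_eq _ _ fun x hx =>
      ⟨V ⊓ (c x).piece (c x).full, ⟨hx, (c x).mem_piece_full (hc x)⟩, inf_le_left, ?_⟩
    rw [← hD.1, hDf x _ inf_le_right]
    simp only [Finset.sum_apply, LinearMap.sum_apply, funMul_apply, map_sum, map_mul, X.res_res]
    refine Finset.sum_congr rfl fun a _ => ?_
    rw [← (hE.mem a).1, ← hg a x, X.res_res]

/-- A member of the frame as a vector field. -/
def field (hE : IsFrame n m E) (a : Fin n ⊕ Fin m) : X.vect :=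
  ⟨E a, X.homVect_le_vect _ (hE.mem a)⟩

theorem coe_sum_smul (hE : IsFrame n m E) (f : Fin n ⊕ Fin m → X.Fun) :
    ((∑ a, f a • hE.field a : X.vect) : X.Operator) = ∑ a, X.funMul (f a) (E a) := by
  rw [Submodule.coe_sum]; rfl

theorem exists_sum_smul_eq (hX : X.IsSupermanifold n m) (hE : IsFrame n m E) (D : X.vect) :
    ∃ f : Fin n ⊕ Fin m → X.Fun, ∑ a, f a • hE.field a = D := by
  obtain ⟨D₀, h₀, D₁, h₁, h⟩ := Submodule.mem_sup.mp D.2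
  obtain ⟨f, -, hf⟩ := hE.exists_eq_sum hX h₀
  obtain ⟨g, -, hg⟩ := hE.exists_eq_sum hX h₁
  refine ⟨fun a => f a + g a, Subtype.ext ?_⟩
  rw [coe_sum_smul, ← h, hf, hg, ← Finset.sum_add_distrib]
  exact Finset.sum_congr rfl fun a _ => X.add_funMul _ _ _

theorem eq_of_sum_smul_eq (hX : X.IsSupermanifold n m) (hE : IsFrame n m E)
    {f g : Fin n ⊕ Fin m → X.Fun}
    (h : ∑ a, f a • hE.field a = ∑ a, g a • hE.field a) : f = g := by
  refine hE.eq_of_sum_funMul_eq hX ?_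
  rw [← hE.coe_sum_smul, ← hE.coe_sum_smul, h]

/-- The components of a vector field with respect to a frame. -/
noncomputable def coefFun (hX : X.IsSupermanifold n m) (hE : IsFrame n m E) (D : X.vect) :
    Fin n ⊕ Fin m → X.Fun := (hE.exists_sum_smul_eq hX D).choose

theorem sum_coefFun_smul (hX : X.IsSupermanifold n m) (hE : IsFrame n m E) (D : X.vect) :
    ∑ a, hE.coefFun hX D a • hE.field a = D := (hE.exists_sum_smul_eq hX D).choose_spec

theorem coefFun_sum (hX : X.IsSupermanifold n m) (hE : IsFrame n m E)
    (f : Fin n ⊕ Fin m → X.Fun) : hE.coefFun hX (∑ b, f b • hE.field b) = f :=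
  hE.eq_of_sum_smul_eq hX (hE.sum_coefFun_smul hX _)

theorem real_smul_smul (r : ℝ) (f : X.Fun) (D : X.vect) : r • (f • D) = (r • f) • D :=
  Subtype.ext <| by
    funext U; ext s
    change r • (X.res le_top f * D.1 U s) = X.res le_top (r • f) * D.1 U s
    rw [map_smul, smul_mul_assoc]

/-- A component of vector fields as a linear map. -/
noncomputable def coef (hX : X.IsSupermanifold n m) (hE : IsFrame n m E) (a : Fin n ⊕ Fin m) :
    X.vect →ₗ[ℝ] X.Fun where
  toFun D := hE.coefFun hX D a
  map_add' D D' := by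
    have h : D + D' = ∑ a, (hE.coefFun hX D a + hE.coefFun hX D' a) • hE.field a := by
      simp only [add_smul, Finset.sum_add_distrib, sum_coefFun_smul]
    exact (congrArg (fun z => hE.coefFun hX z a) h).trans (congrFun (hE.coefFun_sum hX _) a)
  map_smul' r D := by
    have h : r • D = ∑ a, (r • hE.coefFun hX D a) • hE.field a := by
      simp only [← real_smul_smul, ← Finset.smul_sum, sum_coefFun_smul]
    exact (congrArg (fun z => hE.coefFun hX z a) h).trans (congrFun (hE.coefFun_sum hX _) a)

theorem sum_coef_smul (hX : X.IsSupermanifold n m) (hE : IsFrame n m E) (D : X.vect) :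
    ∑ a, hE.coef hX a D • hE.field a = D := hE.sum_coefFun_smul hX D

theorem coef_sum (hX : X.IsSupermanifold n m) (hE : IsFrame n m E)
    (f : Fin n ⊕ Fin m → X.Fun) (a : Fin n ⊕ Fin m) :
    hE.coef hX a (∑ b, f b • hE.field b) = f a := congrFun (hE.coefFun_sum hX f) a

theorem coef_smul (hX : X.IsSupermanifold n m) (hE : IsFrame n m E) (a : Fin n ⊕ Fin m)
    (f : X.Fun) (D : X.vect) : hE.coef hX a (f • D) = f * hE.coef hX a D := by
  have h : f • D = ∑ a, (f * hE.coef hX a D) • hE.field a := by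
    simp only [mul_smul, ← Finset.smul_sum, sum_coef_smul]
  rw [h, coef_sum]

/-- Components are unique, so the homogeneous ones from `exists_eq_sum` are the chosen ones. -/
theorem coef_mem (hX : X.IsSupermanifold n m) (hE : IsFrame n m E) {q : ZMod 2} {D : X.vect}
    (hD : X.HasParity D q) (a : Fin n ⊕ Fin m) :
    hE.coef hX a D ∈ X.parity _ (q + idxParity a) := by
  obtain ⟨f, hf, hDf⟩ := hE.exists_eq_sum hX hD
  have : D = ∑ a, f a • hE.field a := Subtype.ext (hDf.trans (hE.coe_sum_smul f).symm)
  rw [this, coef_sum]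
  exact hf a

end IsFrame

end SuperSpace

namespace SuperSpace

variable {X : SuperSpace.{u}}

/-! ### The odd connection of a frame -/

/-- Multiplication of a fixed vector field by functions. -/
noncomputable def smulField (D : X.vect) : X.Fun →ₗ[ℝ] X.vect where
  toFun f := f • D
  map_add' f g := add_smul f g D
  map_smul' r f := (IsFrame.real_smul_smul r f D).symm

/-- The action of vector fields on functions as a bilinear map. -/
noncomputable def actLinear (X : SuperSpace.{u}) : X.vect →ₗ[ℝ] X.Fun →ₗ[ℝ] X.Fun where
  toFun D := D.1 ⊤
  map_add' _ _ := rfl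
  map_smul' _ _ := rfl

theorem act_smul (f : X.Fun) (D : X.vect) (g : X.Fun) : X.act (f • D) g = f * X.act D g := by
  change X.res le_top f * D.1 ⊤ g = f * D.1 ⊤ g
  rw [X.res_self]

theorem smul_mem_homVect {i q r : ZMod 2} {f : X.Fun} {D : X.vect} (hf : f ∈ X.parity ⊤ i)
    (hD : X.HasParity D q) (h : i + q = r) : X.HasParity (f • D) r :=
  h ▸ X.funMul_mem_homVect hf hD

theorem hasParity_sum {ι : Type*} (s : Finset ι) {q : ZMod 2} {D : ι → X.vect}
    (hD : ∀ a ∈ s, X.HasParity (D a) q) : X.HasParity (∑ a ∈ s, D a) q := by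
  change ((∑ a ∈ s, D a : X.vect) : X.Operator) ∈ X.homVect q
  rw [Submodule.coe_sum]
  exact sum_mem hD

theorem invol_mem {i : ZMod 2} {U : Opens X.carrier} {f : X.Sec U} (hf : f ∈ X.parity U i) :
    X.invol U f ∈ X.parity U i := by
  rw [X.invol_of_mem hf]; exact Submodule.smul_mem _ _ hf

namespace IsFrame

variable {n : ℕ} {E : Fin n ⊕ Fin n → X.Operator}

theorem idxParity_swap (a : Fin n ⊕ Fin n) : idxParity a.swap = idxParity a + 1 := by
  rcases a with a | a <;> rfl

/-- The odd involution which exchanges the even and the odd members of a frame. -/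
noncomputable def flip (hX : X.IsSupermanifold n n) (hE : IsFrame n n E) : X.vect →ₗ[ℝ] X.vect :=
  ∑ a, smulField (hE.field a.swap) ∘ₗ (X.invol ⊤).toLinearMap ∘ₗ hE.coef hX a

theorem flip_apply (hX : X.IsSupermanifold n n) (hE : IsFrame n n E) (D : X.vect) :
    hE.flip hX D = ∑ a, X.invol ⊤ (hE.coef hX a D) • hE.field a.swap := by
  rw [flip, LinearMap.sum_apply]; rfl

theorem coef_flip (hX : X.IsSupermanifold n n) (hE : IsFrame n n E) (D : X.vect)
    (a : Fin n ⊕ Fin n) : hE.coef hX a (hE.flip hX D) = X.invol ⊤ (hE.coef hX a.swap D) := by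
  rw [flip_apply, ← Equiv.sum_comp (Equiv.sumComm _ _)]
  simp only [Equiv.sumComm_apply, Sum.swap_swap]
  exact hE.coef_sum hX (fun b => X.invol ⊤ (hE.coef hX b.swap D)) a

/-- Both the swap of indices and the grade involution of the components square to the identity. -/
theorem flip_flip (hX : X.IsSupermanifold n n) (hE : IsFrame n n E) (D : X.vect) :
    hE.flip hX (hE.flip hX D) = D := by
  refine Eq.trans ?_ (hE.sum_coef_smul hX D)
  rw [flip_apply, ← Equiv.sum_comp (Equiv.sumComm _ _)]
  simp only [Equiv.sumComm_apply, Sum.swap_swap, coef_flip, X.invol_invol]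

theorem flip_parity (hX : X.IsSupermanifold n n) (hE : IsFrame n n E) {q : ZMod 2} {D : X.vect}
    (hD : X.HasParity D q) : X.HasParity (hE.flip hX D) (q + 1) := by
  rw [flip_apply]
  refine hasParity_sum _ fun a _ => smul_mem_homVect (invol_mem (hE.coef_mem hX hD a))
    (hE.mem a.swap) ?_
  rw [idxParity_swap, add_assoc, ← add_assoc (idxParity a), CharTwo.add_self_eq_zero, zero_add]

/-- The sign comes from the grade involution applied to the components `f * coef a D`. -/
theorem flip_smul (hX : X.IsSupermanifold n n) (hE : IsFrame n n E) {i : ZMod 2} {f : X.Fun}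
    (hf : f ∈ X.parity ⊤ i) (D : X.vect) : hE.flip hX (f • D) = sgn i • (f • hE.flip hX D) := by
  rw [flip_apply, flip_apply, Finset.smul_sum, Finset.smul_sum]
  refine Finset.sum_congr rfl fun a _ => ?_
  rw [coef_smul, map_mul, X.invol_of_mem hf, smul_mul_assoc, ← real_smul_smul, mul_smul]

/-- The connection along `flip` for which the members of a frame are parallel. -/
noncomputable def nabla (hX : X.IsSupermanifold n n) (hE : IsFrame n n E) :
    X.vect →ₗ[ℝ] X.vect →ₗ[ℝ] X.vect :=
  ∑ a, ((X.actLinear ∘ₗ hE.flip hX).compl₂ (hE.coef hX a)).compr₂ (smulField (hE.field a))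

theorem nabla_apply (hX : X.IsSupermanifold n n) (hE : IsFrame n n E) (D D' : X.vect) :
    hE.nabla hX D D' = ∑ a, X.act (hE.flip hX D) (hE.coef hX a D') • hE.field a := by
  rw [nabla, LinearMap.sum_apply, LinearMap.sum_apply]; rfl

/-- The odd connection for which the members of a frame are parallel. -/
noncomputable def oddConnection (hX : X.IsSupermanifold n n) (hE : IsFrame n n E) :
    X.OddConnection where
  nabla := hE.nabla hX
  rho := hE.flip hX
  rho_parity _ _ hD := hE.flip_parity hX hD
  rho_smul _ _ D hf := hE.flip_smul hX hf D
  nabla_parity p q D D' hD hD' := by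
    rw [nabla_apply]
    refine hasParity_sum _ fun a _ => smul_mem_homVect
      ((hE.flip_parity hX hD).2.1 ⊤ _ _ (hE.coef_mem hX hD' a)) (hE.mem a) ?_
    rw [show p + 1 + (q + idxParity a) + idxParity a = p + q + 1 + (idxParity a + idxParity a) by
      ring, CharTwo.add_self_eq_zero, add_zero]
  nabla_smul_left i f D D' hf := by
    rw [nabla_apply, nabla_apply, Finset.smul_sum, Finset.smul_sum, hE.flip_smul hX hf]
    refine Finset.sum_congr rfl fun a _ => ?_
    rw [← mul_smul, ← act_smul]
    exact (real_smul_smul (sgn i) _ (hE.field a)).symm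
  nabla_smul_right i p f D D' hf hD := by
    rw [nabla_apply, nabla_apply, Finset.smul_sum, Finset.smul_sum]
    conv_rhs => rw [← hE.sum_coef_smul hX D']
    rw [Finset.smul_sum, ← Finset.sum_add_distrib]
    refine Finset.sum_congr rfl fun a _ => ?_
    rw [coef_smul, sum_coef_smul, ← mul_smul, ← mul_smul, real_smul_smul, ← add_smul]
    -- Componentwise this is the Leibniz rule of `ρ(D)` on functions. Its parity `p + 1` accounts
    -- for the sign.
    exact congrArg (fun z : X.Fun => z • hE.field a)
      ((hE.flip_parity hX hD).2.2 ⊤ i f (hE.coef hX a D') hf)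
  rho_rho := hE.flip_flip hX

end IsFrame

end SuperSpace

end SuperGeometry

/-! ### The theorem. -/

theorem mainTheorem5 (n : ℕ) (G : SuperGeometry.Supermanifold.{u})
    (hG : G.obj.IsSupermanifold n n) (grp : SuperGeometry.LieSupergroup G) :
    Nonempty G.obj.OddConnection := by
  by_cases hne : Nonempty G.obj.carrier
  · obtain ⟨E, hE, hunit⟩ := SuperGeometry.LieSupergroup.exists_frame grp hG
    exact ⟨SuperGeometry.SuperSpace.IsFrame.oddConnection hG ⟨hE, hunit⟩⟩
  -- No unit point can be chosen if the space is empty. All section algebras are then zero, and zero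
  -- maps form a connection.
  · have hs : ∀ U, Subsingleton (G.obj.Sec U) := fun U =>
      G.obj.subsingleton_sec fun x => (hne ⟨x⟩).elim
    have hv : Subsingleton G.obj.vect := ⟨fun D D' => Subtype.ext <| by
      funext U; ext s; exact Subsingleton.elim _ _⟩
    have hp : ∀ (D : G.obj.vect) (p : ZMod 2), G.obj.HasParity D p := fun D p => by
      rw [Subsingleton.elim D 0]; exact zero_mem _
    exact ⟨{ nabla := 0, rho := 0
             rho_parity := fun _ _ _ => hp _ _
             rho_smul := fun _ _ _ _ => Subsingleton.elim _ _
             nabla_parity := fun _ _ _ _ _ _ => hp _ _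
             nabla_smul_left := fun _ _ _ _ _ => Subsingleton.elim _ _
             nabla_smul_right := fun _ _ _ _ _ _ _ => Subsingleton.elim _ _
             rho_rho := fun _ => Subsingleton.elim _ _ }⟩
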